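/- Let $\mathcal X\subseteq\mathbb R^{d_x}$, $\mathcal Y\subseteq\mathbb R^{d_y}$, $\mathcal Z\subseteq\mathbb R^{d_z}$ be Borel sets, with arbitrary norms $\|\cdot\|$ on the ambient spaces. Let $p\in[1,\infty)$, $\epsilon>0$, $\rho\ge 0$. Let $f:\mathcal X\to\mathcal Z$ and $\Psi:\mathcal Z\times\mathcal Y\to\mathbb R\cup\{\infty\}$ be measurable. Let $\widehat{\mathbb P}$ be a probability measure on $\mathcal X\times\mathcal Y$ with finite $p$-th moment (for example, an empirical distribution), with first marginal $\widehat{\mathbb P}_{\widehat X}$ and regular conditional distribution $\widehat{\mathbb P}_{\widehat Y\mid\widehat X}$. Let $\nu_{\mathcal X},\nu_{\mathcal Y}$ be measures on $\mathcal X,\mathcal Y$ such that $\int e^{-\delta\|u\|^p}\,d\nu_{\mathcal X}(u)<\infty$ and $\int e^{-\delta\|u\|^p}\,d\nu_{\mathcal Y}(u)<\infty$ for every $\delta>0$. Put $c_p((\hat x,\hat y),(x,y))=\|x-\hat x\|^p+\|y-\hat y\|^p$. For a probability measure $\mathbb P$ on $\mathcal X\times\mathcal Y$ let $$R_p(\widehat{\mathbb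 P},\mathbb P)^p=\inf_{\gamma}\ \mathbb E_{\gamma}\Big[c_p+\epsilon\log\frac{d\gamma}{d(\widehat{\mathbb P}\otimes\nu_{\mathcal X}\otimes\nu_{\mathcal Y})}\Big],$$ where $\gamma$ ranges over the couplings of $\widehat{\mathbb P}$ and $\mathbb P$ such that, for $((\widehat X,\widehat Y),(X,Y))\sim\gamma$, $X$ and $\widehat Y$ are conditionally independent given $\widehat X$; the expectation is $+\infty$ if $\gamma$ is not absolutely continuous with respect to $\widehat{\mathbb P}\otimes\nu_{\mathcal X}\otimes\nu_{\mathcal Y}$. The primal problem is $$\sup_{\mathbb P}\big\{\mathbb E_{\mathbb P}[\Psi(f(x),y)]: R_p(\widehat{\mathbb P},\mathbb P)^p\le\rho^p\big\},$$ and a worst-case distribution is a feasible $\mathbb P$ that attains this supremum. For $\lambda>0$ let $$s_\lambda(\hat x,\hat y,x,y)=\frac{\Psi(f(x),y)-\lambda c_p((\hat x,\hat y),(x,y))}{\lambda\epsilon},\qquad r_\lambda(\hat x,x)=\mathbb E_{\hat y\sim\widehat{\mathbb P}_{\widehat Y\mid\widehat X=\hat x}}\Big[\log\int_{\mathcal Y}e^{s_\lambda(\hat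 x,\hat y,x,y)}\,d\nu_{\mathcal Y}(y)\Big].$$ The dual problem minimizes over $\lambda\ge 0$ the function $$v(\lambda)=\lambda\rho^p+\mathbb E_{\hat x\sim\widehat{\mathbb P}_{\widehat X}}\Big[\lambda\epsilon\log\int_{\mathcal X}e^{r_\lambda(\hat x,x)}\,d\nu_{\mathcal X}(x)\Big]\quad(\lambda>0),$$ where $v(0)$ is the $\nu_{\mathcal X}\otimes\nu_{\mathcal Y}$-essential supremum of $\Psi(f(x),y)$. Suppose that the dual problem has an optimal solution $\lambda^*>0$ with finite optimal value. Let $\mathbb P^*$ be the measure with density $$\frac{d\mathbb P^*}{d(\nu_{\mathcal X}\otimes\nu_{\mathcal Y})}(x,y)=\mathbb E_{(\hat x,\hat y)\sim\widehat{\mathbb P}}\Big[\alpha_{\hat x}\,\beta_{\hat x,\hat y,x}\,e^{r_{\lambda^*}(\hat x,x)+s_{\lambda^*}(\hat x,\hat y,x,y)}\Big],$$ where $\alpha_{\hat x}=\big(\int_{\mathcal X}e^{r_{\lambda^*}(\hat x,x)}d\nu_{\mathcal X}(x)\big)^{-1}$ and $\beta_{\hat x,\hat y,x}=\big(\int_{\mathcal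 Y}e^{s_{\lambda^*}(\hat x,\hat y,x,y)}d\nu_{\mathcal Y}(y)\big)^{-1}$. Then: 1. If $\Psi(f(x),y)$ is not $\nu_{\mathcal X}\otimes\nu_{\mathcal Y}$-almost everywhere equal to a real constant, then $v$ is strictly convex on $\{\lambda>0: v(\lambda)<\infty\}$, and $\lambda^*$ is the unique optimal solution of the dual problem. 2. Every worst-case distribution is equal to $\mathbb P^*$. If moreover $v(\lambda)<\infty$ for some $\lambda\in(0,\lambda^*)$, then $\mathbb P^*$ is a worst-case distribution (and hence the only one). -/

import Mathlib

open MeasureTheory ProbabilityTheory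
open scoped ENNReal

noncomputable section

namespace CausalSDRO

/-- Expectation of an extended-real function, `E[f⁺] - E[f⁻]`. (The indeterminate `∞ - ∞` is
`-∞` in `EReal`.) -/
def eexpect {α : Type*} [MeasurableSpace α] (μ : Measure α) (f : α → EReal) : EReal :=
  ((∫⁻ a, (f a).toENNReal ∂μ : ℝ≥0∞) : EReal) - ((∫⁻ a, (-(f a)).toENNReal ∂μ : ℝ≥0∞) : EReal)

/-- For `((X̂, Ŷ), (X, Y)) ∼ γ`: `X` and `Ŷ` are conditionally independent given `X̂`.
(This is the defining property of conditional independence in terms of conditional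
probabilities given the sigma-algebra generated by `X̂`.) -/
def IsCausal {X Y : Type*} [MeasurableSpace X] [MeasurableSpace Y]
    (γ : Measure ((X × Y) × (X × Y))) : Prop :=
  ∀ (A : Set X) (B : Set Y), MeasurableSet A → MeasurableSet B →
    γ⟦(fun ω : (X × Y) × (X × Y) => ω.2.1) ⁻¹' A ∩ (fun ω => ω.1.2) ⁻¹' B |
        MeasurableSpace.comap (fun ω : (X × Y) × (X × Y) => ω.1.1) inferInstance⟧
      =ᵐ[γ] fun ω =>
        (γ⟦(fun ω : (X × Y) × (X × Y) => ω.2.1) ⁻¹' A |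
          MeasurableSpace.comap (fun ω : (X × Y) × (X × Y) => ω.1.1) inferInstance⟧) ω *
        (γ⟦(fun ω : (X × Y) × (X × Y) => ω.1.2) ⁻¹' B |
          MeasurableSpace.comap (fun ω : (X × Y) × (X × Y) => ω.1.1) inferInstance⟧) ω

section Model

variable {E F G : Type*}
  [NormedAddCommGroup E] [MeasurableSpace E]
  [NormedAddCommGroup F] [MeasurableSpace F]
  [MeasurableSpace G]

/-- The data of the problem for a fixed decision rule: covariate set `𝒳`, outcome set `𝒴`,
decision set `𝒵`. No properties are recorded here. -/
structure Data (𝒳 : Set E) (𝒴 : Set F) (𝒵 : Set G) where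
  /-- the nominal (empirical) joint distribution of `(X̂, Ŷ)` -/
  Phat : Measure (𝒳 × 𝒴)
  /-- the conditional distribution of `Ŷ` given `X̂` under `Phat` -/
  condY : Kernel 𝒳 𝒴
  /-- reference measure on `𝒳` -/
  νX : Measure 𝒳
  /-- reference measure on `𝒴` -/
  νY : Measure 𝒴
  /-- decision rule -/
  f : 𝒳 → 𝒵
  /-- loss function, with values in `ℝ ∪ {∞}` -/
  Ψ : 𝒵 → 𝒴 → EReal
  /-- order of the transport cost -/
  p : ℝ
  /-- regularization parameter -/
  ε : ℝ
  /-- radius of the ambiguity set -/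
  ρ : ℝ

variable {𝒳 : Set E} {𝒴 : Set F} {𝒵 : Set G}

/-- Standing assumptions. (Regular conditional distributions exist because `𝒳` and `𝒴` are Borel
subsets of finite-dimensional spaces, and the transport cost is automatically measurable,
nonnegative and finite, so neither has to be assumed.) -/
structure Data.Assumptions (M : Data 𝒳 𝒴 𝒵) : Prop where
  measurableSet_X : MeasurableSet 𝒳
  measurableSet_Y : MeasurableSet 𝒴
  measurableSet_Z : MeasurableSet 𝒵
  one_le_p : 1 ≤ M.p
  ε_pos : 0 < M.ε
  ρ_nonneg : 0 ≤ M.ρ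
  /-- `Phat` is a probability measure -/
  prob : IsProbabilityMeasure M.Phat
  /-- `Phat` has a finite moment of order `p` (automatic for an empirical distribution) -/
  moment : ∫⁻ q, ENNReal.ofReal (‖(q.1 : E)‖ ^ M.p + ‖(q.2 : F)‖ ^ M.p) ∂M.Phat < ∞
  /-- `condY` is a version of the regular conditional distribution of `Ŷ` given `X̂` -/
  markov : IsMarkovKernel M.condY
  disint : M.Phat.IsCondKernel M.condY
  measurable_f : Measurable M.f
  measurable_Ψ : Measurable (fun q : 𝒵 × 𝒴 => M.Ψ q.1 q.2)
  Ψ_ne_bot : ∀ z y, M.Ψ z y ≠ ⊥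
  /-- light tails of the reference measures relative to the cost -/
  tail_X : ∀ δ : ℝ, 0 < δ → ∫⁻ u, ENNReal.ofReal (Real.exp (-δ * ‖(u : E)‖ ^ M.p)) ∂M.νX < ∞
  tail_Y : ∀ δ : ℝ, 0 < δ → ∫⁻ u, ENNReal.ofReal (Real.exp (-δ * ‖(u : F)‖ ^ M.p)) ∂M.νY < ∞

variable (M : Data 𝒳 𝒴 𝒵)

/-- The loss `Ψ(f(x), y)` of the decision rule as a function of `(x, y)`. -/
def Data.loss (q : 𝒳 × 𝒴) : EReal := M.Ψ (M.f q.1) q.2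

/-- The transport cost `c_p((x̂, ŷ), (x, y)) = ‖x - x̂‖ ^ p + ‖y - ŷ‖ ^ p`. -/
def Data.cost (qhat q : 𝒳 × 𝒴) : ℝ :=
  ‖(q.1 : E) - (qhat.1 : E)‖ ^ M.p + ‖(q.2 : F) - (qhat.2 : F)‖ ^ M.p

/-- The product reference measure. -/
def Data.ν : Measure (𝒳 × 𝒴) := M.νX.prod M.νY

/-! ### Primal problem -/

/-- `γ` is a causal transport plan from `Phat` to `P`. -/
def Data.IsCausalPlan (P : Measure (𝒳 × 𝒴)) (γ : Measure ((𝒳 × 𝒴) × (𝒳 × 𝒴))) : Prop :=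
  γ.fst = M.Phat ∧ γ.snd = P ∧ IsCausal γ

open Classical in
/-- The entropic transport cost `E_γ[c_p] + ε H(γ | Phat ⊗ (ν_X ⊗ ν_Y))` of a plan, written under
one expectation `E_γ[c_p + ε log (dγ / d(Phat ⊗ ν_X ⊗ ν_Y))]`, so that it does not become
indeterminate when `E_γ[c_p] = ∞`; it is `∞` if `γ` is not absolutely continuous. -/
def Data.planCost (γ : Measure ((𝒳 × 𝒴) × (𝒳 × 𝒴))) : EReal :=
  if γ ≪ M.Phat.prod M.ν then
    eexpect γ (fun ω => ((M.cost ω.1 ω.2 : ℝ) : EReal)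
      + (M.ε : EReal) * ENNReal.log (γ.rnDeriv (M.Phat.prod M.ν) ω))
  else ⊤

/-- The `p`-th power `R_p(Phat, P) ^ p` of the causal Sinkhorn discrepancy, i.e. the infimum of the
entropic cost over causal plans. (The infimum may be negative, in which case only this power makes
sense; only the power enters the ambiguity set.) -/
def Data.csdPow (P : Measure (𝒳 × 𝒴)) : EReal :=
  ⨅ (γ : Measure ((𝒳 × 𝒴) × (𝒳 × 𝒴))) (_ : M.IsCausalPlan P γ), M.planCost γ

/-- `P` lies in the ambiguity set. -/
def Data.IsFeasible (P : Measure (𝒳 × 𝒴)) : Prop :=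
  IsProbabilityMeasure P ∧ M.csdPow P ≤ ((M.ρ ^ M.p : ℝ) : EReal)

/-- `P` is a worst-case distribution: it attains the maximum of the expected loss over the
ambiguity set. -/
def Data.IsWorstCase (P : Measure (𝒳 × 𝒴)) : Prop :=
  M.IsFeasible P ∧ ∀ Q, M.IsFeasible Q → eexpect Q M.loss ≤ eexpect P M.loss

/-! ### Dual problem and Gibbs densities -/

/-- `s(x̂, ŷ, x, y) = (Ψ(f(x), y) - lam c_p((x̂, ŷ), (x, y))) / (lam ε)`. -/
def Data.s (lam : ℝ) (qhat q : 𝒳 × 𝒴) : EReal :=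
  (M.loss q - ((lam * M.cost qhat q : ℝ) : EReal)) / ((lam * M.ε : ℝ) : EReal)

/-- `∫ exp(s(x̂, ŷ, x, y)) dν_Y(y)`. -/
def Data.innerInt (lam : ℝ) (qhat : 𝒳 × 𝒴) (x : 𝒳) : ℝ≥0∞ :=
  ∫⁻ y, EReal.exp (M.s lam qhat (x, y)) ∂M.νY

/-- `g(x̂, x, lam) = E_{ŷ ∼ Phat(· | x̂)}[lam ε log ∫ exp(s(x̂, ŷ, x, y)) dν_Y(y)]`. -/
def Data.g (lam : ℝ) (xhat x : 𝒳) : EReal :=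
  eexpect (M.condY xhat)
    (fun yhat => ((lam * M.ε : ℝ) : EReal) * ENNReal.log (M.innerInt lam (xhat, yhat) x))

/-- The dual objective `lam ρ^p + E_{x̂}[lam ε log ∫ exp(g(x̂, x, lam) / (lam ε)) dν_X(x)]` for
`lam > 0`; at `lam = 0` it is read as its limit, the essential supremum of the loss. -/
def Data.dualObj (lam : ℝ) : EReal :=
  if lam = 0 then essSup M.loss M.ν
  else ((lam * M.ρ ^ M.p : ℝ) : EReal)
    + eexpect M.Phat.fst (fun xhat => ((lam * M.ε : ℝ) : EReal) *
        ENNReal.log (∫⁻ x, EReal.exp (M.g lam xhat x / ((lam * M.ε : ℝ) : EReal)) ∂M.νX))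

/-- `lam` is an optimal solution of the dual problem: it minimizes the dual objective over
`[0, ∞)`, with a finite optimal value. -/
def Data.IsDualOptimal (lam : ℝ) : Prop :=
  0 ≤ lam ∧ M.dualObj lam ≠ ⊥ ∧ M.dualObj lam ≠ ⊤ ∧
    ∀ lam' : ℝ, 0 ≤ lam' → M.dualObj lam ≤ M.dualObj lam'

/-- `r(x̂, x) = E_{ŷ ∼ Phat(· | x̂)}[log ∫ exp(s(x̂, ŷ, x, y)) dν_Y(y)]`. -/
def Data.r (lam : ℝ) (xhat x : 𝒳) : EReal :=
  eexpect (M.condY xhat) (fun yhat => ENNReal.log (M.innerInt lam (xhat, yhat) x))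

/-- `α(x̂) = (∫ exp(r(x̂, x)) dν_X(x))⁻¹`. -/
def Data.α (lam : ℝ) (xhat : 𝒳) : ℝ≥0∞ := (∫⁻ x, EReal.exp (M.r lam xhat x) ∂M.νX)⁻¹

/-- `β(x̂, ŷ, x) = (∫ exp(s(x̂, ŷ, x, y)) dν_Y(y))⁻¹`. -/
def Data.β (lam : ℝ) (qhat : 𝒳 × 𝒴) (x : 𝒳) : ℝ≥0∞ := (M.innerInt lam qhat x)⁻¹

/-- The mixture density
`(x, y) ↦ E_{(x̂, ŷ) ∼ Phat}[α(x̂) β(x̂, ŷ, x) exp(r(x̂, x) + s(x̂, ŷ, x, y))]`. -/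
def Data.gibbsDensity (lam : ℝ) (q : 𝒳 × 𝒴) : ℝ≥0∞ :=
  ∫⁻ qhat, M.α lam qhat.1 * M.β lam qhat q.1
    * EReal.exp (M.r lam qhat.1 q.1 + M.s lam qhat q) ∂M.Phat

end Model

end CausalSDRO

end

namespace CausalSDRO

section Integrals

variable {α : Type*} [MeasurableSpace α] {μ : Measure α}

theorem integrable_of_lintegral_ofReal {p : α → ℝ} (hp : AEMeasurable p μ)
    (h₁ : ∫⁻ a, ENNReal.ofReal (p a) ∂μ ≠ ∞) (h₂ : ∫⁻ a, ENNReal.ofReal (-p a) ∂μ ≠ ∞) :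
    Integrable p μ := by
  refine ⟨hp.aestronglyMeasurable, ?_⟩
  rw [hasFiniteIntegral_iff_norm]
  calc ∫⁻ a, ENNReal.ofReal ‖p a‖ ∂μ
      ≤ ∫⁻ a, (ENNReal.ofReal (p a) + ENNReal.ofReal (-p a)) ∂μ := by
        refine lintegral_mono fun a => ?_
        rcases le_total 0 (p a) with h | h
        · rw [Real.norm_of_nonneg h]; exact le_self_add
        · rw [Real.norm_of_nonpos h]; exact le_add_self
    _ = ∫⁻ a, ENNReal.ofReal (p a) ∂μ + ∫⁻ a, ENNReal.ofReal (-p a) ∂μ :=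
        lintegral_add_left' hp.ennreal_ofReal _
    _ < ∞ := ENNReal.add_lt_top.2 ⟨h₁.lt_top, h₂.lt_top⟩

theorem lintegral_ofReal_ne_top {p : α → ℝ} (hp : Integrable p μ) :
    ∫⁻ a, ENNReal.ofReal (p a) ∂μ ≠ ∞ := hp.lintegral_lt_top.ne

theorem lintegral_ofReal_neg_ne_top {p : α → ℝ} (hp : Integrable p μ) :
    ∫⁻ a, ENNReal.ofReal (-p a) ∂μ ≠ ∞ := hp.neg.lintegral_lt_top.ne

/-- If `p ≥ -(q⁻) - w` with integrable bounds, the negative part of `p` is integrable. -/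
theorem lintegral_ofReal_ne_top_of_le {p q w : α → ℝ} (hw : Integrable w μ)
    (hq : ∫⁻ a, ENNReal.ofReal (q a) ∂μ ≠ ∞) (h : ∀ᵐ a ∂μ, p a ≤ max (q a) 0 + w a) :
    ∫⁻ a, ENNReal.ofReal (p a) ∂μ ≠ ∞ := by
  refine ne_top_of_le_ne_top (b := ∫⁻ a, ENNReal.ofReal (q a) ∂μ + ∫⁻ a, ENNReal.ofReal (w a) ∂μ)
    (ENNReal.add_ne_top.2 ⟨hq, lintegral_ofReal_ne_top hw⟩) ?_
  rw [← lintegral_add_right' _ hw.1.aemeasurable.ennreal_ofReal]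
  refine lintegral_mono_ae (h.mono fun a ha => ?_)
  calc ENNReal.ofReal (p a) ≤ ENNReal.ofReal (max (q a) 0 + w a) := ENNReal.ofReal_le_ofReal ha
    _ ≤ ENNReal.ofReal (max (q a) 0) + ENNReal.ofReal (w a) := ENNReal.ofReal_add_le
    _ = _ := by congr 1; rcases le_total (q a) 0 with h | h <;> simp [h]

/-- A function that becomes integrable with integral zero on an exhausting sequence of sets. -/
def IsCentered (μ : Measure α) (D : α → ℝ) : Prop :=
  ∃ B : ℕ → Set α, Monotone B ∧ (∀ n, MeasurableSet (B n)) ∧ (∀ᵐ a ∂μ, ∃ n, a ∈ B n) ∧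
    (∀ n, IntegrableOn D (B n) μ) ∧ ∀ n, ∫ a in B n, D a ∂μ = 0

theorem lintegral_le_of_exhaustion {B : ℕ → Set α} (hB : Monotone B)
    (hcov : ∀ᵐ a ∂μ, ∃ n, a ∈ B n) {f : α → ℝ≥0∞} {C : ℝ≥0∞}
    (h : ∀ n, ∫⁻ a in B n, f a ∂μ ≤ C) : ∫⁻ a, f a ∂μ ≤ C := by
  have hU : (⋃ n, B n) =ᵐ[μ] Set.univ := by
    filter_upwards [hcov] with a ha
    exact propext ⟨fun _ => trivial, fun _ => Set.mem_iUnion.2 ha⟩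
  rw [← setLIntegral_univ, ← setLIntegral_congr hU,
    setLIntegral_iUnion_of_directed _ hB.directed_le]
  exact iSup_le h

theorem IsCentered.integrable_of_add_eq {p q w D : α → ℝ} (hD : IsCentered μ D)
    (hpm : AEMeasurable p μ) (hqm : AEMeasurable q μ)
    (hp : ∫⁻ a, ENNReal.ofReal (-p a) ∂μ ≠ ∞) (hq : ∫⁻ a, ENNReal.ofReal (-q a) ∂μ ≠ ∞)
    (hw : Integrable w μ) (h : ∀ᵐ a ∂μ, p a + q a = w a + D a) :
    Integrable p μ ∧ Integrable q μ ∧ ∫ a, p a ∂μ + ∫ a, q a ∂μ = ∫ a, w a ∂μ := by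
  obtain ⟨B, hBm, hBmeas, hcov, hDi, hD0⟩ := hD
  have key : ∀ p q : α → ℝ, AEMeasurable p μ → AEMeasurable q μ →
      ∫⁻ a, ENNReal.ofReal (-p a) ∂μ ≠ ∞ → ∫⁻ a, ENNReal.ofReal (-q a) ∂μ ≠ ∞ →
      (∀ᵐ a ∂μ, p a + q a = w a + D a) → ∀ n, IntegrableOn p (B n) μ := by
    intro p q hpm hqm hp hq h n
    refine integrable_of_lintegral_ofReal hpm.restrict ?_
      (ne_top_of_le_ne_top hp (setLIntegral_le_lintegral _ _))
    refine lintegral_ofReal_ne_top_of_le (q := fun a => -q a) (w := fun a => w a + D a)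
      (hw.integrableOn.add (hDi n)) (ne_top_of_le_ne_top hq (setLIntegral_le_lintegral _ _)) ?_
    filter_upwards [ae_restrict_of_ae h] with a ha
    linarith [le_max_left (-q a) 0]
  have hpB := key p q hpm hqm hp hq h
  have hqB := key q p hqm hpm hq hp (h.mono fun a ha => by rw [add_comm]; exact ha)
  have hsum : ∀ n, ∫ a in B n, p a ∂μ + ∫ a in B n, q a ∂μ = ∫ a in B n, w a ∂μ := by
    intro n
    rw [← integral_add (hpB n) (hqB n)]
    have : ∫ a in B n, (w a + D a) ∂μ = ∫ a in B n, w a ∂μ := by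
      rw [integral_add hw.integrableOn (hDi n), hD0 n, add_zero]
    rw [← this]
    exact integral_congr_ae (ae_restrict_of_ae h)
  have lower : ∀ p : α → ℝ, (∀ n, IntegrableOn p (B n) μ) →
      ∫⁻ a, ENNReal.ofReal (-p a) ∂μ ≠ ∞ → ∀ n,
      (∫⁻ a in B n, ENNReal.ofReal (p a) ∂μ).toReal - (∫⁻ a, ENNReal.ofReal (-p a) ∂μ).toReal
        ≤ ∫ a in B n, p a ∂μ := by
    intro p hpB hp n
    rw [integral_eq_lintegral_pos_part_sub_lintegral_neg_part (hpB n)]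
    gcongr
    exact Measure.restrict_le_self
  have key2 : ∀ p q : α → ℝ, AEMeasurable p μ → (∀ n, IntegrableOn p (B n) μ) →
      (∀ n, IntegrableOn q (B n) μ) →
      ∫⁻ a, ENNReal.ofReal (-p a) ∂μ ≠ ∞ → ∫⁻ a, ENNReal.ofReal (-q a) ∂μ ≠ ∞ →
      (∀ n, ∫ a in B n, p a ∂μ + ∫ a in B n, q a ∂μ = ∫ a in B n, w a ∂μ) → Integrable p μ := by
    intro p q hpm hpB hqB hp hq hs
    refine integrable_of_lintegral_ofReal hpm ?_ hp
    refine ne_top_of_le_ne_top (b := ENNReal.ofReal (∫ a, ‖w a‖ ∂μ +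
      (∫⁻ a, ENNReal.ofReal (-p a) ∂μ).toReal + (∫⁻ a, ENNReal.ofReal (-q a) ∂μ).toReal))
      ENNReal.ofReal_ne_top ?_
    refine lintegral_le_of_exhaustion hBm hcov fun n => ?_
    rw [← ENNReal.ofReal_toReal (lintegral_ofReal_ne_top (hpB n))]
    apply ENNReal.ofReal_le_ofReal
    have h1 := lower p hpB hp n
    have h2 := lower q hqB hq n
    have h3 := hs n
    have h4 : ∫ a in B n, w a ∂μ ≤ ∫ a, ‖w a‖ ∂μ :=
      (le_abs_self _).trans ((norm_integral_le_integral_norm _).trans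
        (setIntegral_le_integral hw.norm (Filter.Eventually.of_forall fun a => norm_nonneg _)))
    have h5 : 0 ≤ (∫⁻ a in B n, ENNReal.ofReal (q a) ∂μ).toReal := ENNReal.toReal_nonneg
    linarith
  have hpI := key2 p q hpm hpB hqB hp hq hsum
  have hqI := key2 q p hqm hqB hpB hq hp (fun n => by rw [add_comm]; exact hsum n)
  refine ⟨hpI, hqI, ?_⟩
  have hU : (⋃ n, B n) =ᵐ[μ] Set.univ := by
    filter_upwards [hcov] with a ha
    exact propext ⟨fun _ => trivial, fun _ => Set.mem_iUnion.2 ha⟩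
  have lim : ∀ f : α → ℝ, Integrable f μ →
      Filter.Tendsto (fun n => ∫ a in B n, f a ∂μ) Filter.atTop (nhds (∫ a, f a ∂μ)) := by
    intro f hf
    have := tendsto_setIntegral_of_monotone hBmeas hBm (hf.integrableOn (s := ⋃ n, B n))
    rwa [setIntegral_congr_set hU, setIntegral_univ] at this
  exact tendsto_nhds_unique ((lim p hpI).add (lim q hqI)) ((lim w hw).congr fun n => (hsum n).symm)

/-- The negative part of a log-likelihood ratio is integrable. -/
theorem lintegral_ofReal_sub_log_le {f : α → ℝ≥0∞} (hf : Measurable f)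
    {G : α → ℝ} (hG : Measurable G) (hfin : ∀ᵐ a ∂μ, f a ≠ ∞) :
    ∫⁻ a, ENNReal.ofReal (Real.exp (G a - Real.log (f a).toReal)) ∂(μ.withDensity f)
      ≤ ∫⁻ a, ENNReal.ofReal (Real.exp (G a)) ∂μ := by
  rw [lintegral_withDensity_eq_lintegral_mul _ hf (by fun_prop)]
  refine lintegral_mono_ae (hfin.mono fun a ha => ?_)
  simp only [Pi.mul_apply]
  rcases eq_or_ne (f a) 0 with h0 | h0
  · simp [h0]
  · have hpos : 0 < (f a).toReal := ENNReal.toReal_pos h0 ha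
    have h1 : f a = ENNReal.ofReal (f a).toReal := (ENNReal.ofReal_toReal ha).symm
    rw [Real.exp_sub, Real.exp_log hpos]
    nth_rewrite 1 [h1]
    rw [← ENNReal.ofReal_mul hpos.le, mul_div_cancel₀ _ hpos.ne']

theorem lintegral_ofReal_le_lintegral_exp (μ : Measure α) (G : α → ℝ) :
    ∫⁻ a, ENNReal.ofReal (G a) ∂μ ≤ ∫⁻ a, ENNReal.ofReal (Real.exp (G a)) ∂μ :=
  lintegral_mono fun a => ENNReal.ofReal_le_ofReal (by linarith [Real.add_one_le_exp (G a)])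

/-- Differentiation under the integral sign for integrands that are convex in the parameter. -/
theorem differentiableAt_integral_of_convexOn {F : ℝ → α → ℝ} {t δ : ℝ} (hδ : 0 < δ)
    (hmeas : ∀ s ∈ Set.Icc (t - δ) (t + δ), AEStronglyMeasurable (F s) μ)
    (hl : Integrable (F (t - δ)) μ) (hm : Integrable (F t) μ) (hr : Integrable (F (t + δ)) μ)
    (hconv : ∀ᵐ a ∂μ, ConvexOn ℝ (Set.Icc (t - δ) (t + δ)) fun s => F s a)
    (hdiff : ∀ᵐ a ∂μ, DifferentiableAt ℝ (fun s => F s a) t) :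
    (∀ s ∈ Set.Icc (t - δ) (t + δ), Integrable (F s) μ) ∧
      DifferentiableAt ℝ (fun s => ∫ a, F s a ∂μ) t := by
  set B : α → ℝ := fun a => (|F (t + δ) a - F t a| + |F (t - δ) a - F t a|) / δ with hB
  have hBi : Integrable B μ := ((hr.sub hm).abs.add (hl.sub hm).abs).div_const δ
  have ht : t ∈ Set.Icc (t - δ) (t + δ) := ⟨by linarith, by linarith⟩
  have hslope : ∀ᵐ a ∂μ, ∀ s ∈ Set.Icc (t - δ) (t + δ), s ≠ t →
      |(F s a - F t a) / (s - t)| ≤ B a := by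
    filter_upwards [hconv] with a ha s hs hst
    have h1 := ha.secant_mono ht (x := t - δ) (y := s) ⟨le_rfl, by linarith⟩ hs (by linarith)
      hst hs.1
    have h2 := ha.secant_mono ht (x := s) (y := t + δ) hs ⟨by linarith, le_rfl⟩ hst
      (by linarith) hs.2
    rw [show t - δ - t = -δ by ring] at h1
    rw [show t + δ - t = δ by ring] at h2
    have h3 : (F (t + δ) a - F t a) / δ ≤ B a := by
      rw [hB]; dsimp only; gcongr
      linarith [le_abs_self (F (t + δ) a - F t a), abs_nonneg (F (t - δ) a - F t a)]
    have h4 : -B a ≤ (F (t - δ) a - F t a) / -δ := by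
      rw [hB]; dsimp only; rw [div_neg]; gcongr
      linarith [le_abs_self (F (t - δ) a - F t a), abs_nonneg (F (t + δ) a - F t a)]
    exact abs_le.2 ⟨h4.trans h1, h2.trans h3⟩
  have hint : ∀ s ∈ Set.Icc (t - δ) (t + δ), Integrable (F s) μ := by
    intro s hs
    rcases eq_or_ne s t with rfl | hst
    · exact hm
    refine (hm.norm.add (hBi.const_mul |s - t|)).mono' (hmeas s hs) ?_
    filter_upwards [hslope] with a ha
    have h1 := ha s hs hst
    rw [abs_div, div_le_iff₀ (abs_pos.2 (sub_ne_zero.2 hst)), mul_comm] at h1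
    simp only [Pi.add_apply, Real.norm_eq_abs]
    calc |F s a| = |F t a + (F s a - F t a)| := by ring_nf
      _ ≤ |F t a| + |F s a - F t a| := abs_add_le _ _
      _ ≤ _ := by gcongr
  refine ⟨hint, ?_⟩
  refine HasDerivAt.differentiableAt (f' := ∫ a, deriv (fun s => F s a) t ∂μ) ?_
  rw [hasDerivAt_iff_tendsto_slope]
  have hnb : ∀ᶠ s in nhdsWithin t {t}ᶜ, s ∈ Set.Icc (t - δ) (t + δ) ∧ s ≠ t := by
    refine Filter.Eventually.and ?_ self_mem_nhdsWithin
    exact mem_nhdsWithin_of_mem_nhds (Icc_mem_nhds (by linarith) (by linarith))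
  have := tendsto_integral_filter_of_dominated_convergence (l := nhdsWithin t {t}ᶜ)
    (F := fun s a => (F s a - F t a) / (s - t)) (f := fun a => deriv (fun s => F s a) t)
    (μ := μ) B ?_ ?_ hBi ?_
  · refine this.congr' ?_
    filter_upwards [hnb] with s hs
    rw [integral_div, integral_sub (hint s hs.1) hm, slope_def_field]
  · filter_upwards [hnb] with s hs
    simp only [div_eq_mul_inv]
    exact AEStronglyMeasurable.mul_const ((hmeas s hs.1).sub (hmeas t ht)) _
  · filter_upwards [hnb] with s hs
    filter_upwards [hslope] with a ha
    exact ha s hs.1 hs.2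
  · filter_upwards [hdiff] with a ha
    have := ha.hasDerivAt
    rw [hasDerivAt_iff_tendsto_slope] at this
    exact this.congr fun s => by rw [slope_def_field]

end Integrals

section LogInt

variable {α : Type*} [MeasurableSpace α]

/-- The exponential integral `∫ exp(f) dμ`. -/
noncomputable def expInt (μ : Measure α) (f : α → ℝ) : ℝ≥0∞ :=
  ∫⁻ a, ENNReal.ofReal (Real.exp (f a)) ∂μ

/-- The logarithm of the exponential integral. -/
noncomputable def logInt (μ : Measure α) (f : α → ℝ) : ℝ := Real.log (expInt μ f).toReal

variable {μ : Measure α} {f g : α → ℝ}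

theorem expInt_ne_zero (hμ : μ ≠ 0) (hf : Measurable f) : expInt μ f ≠ 0 := by
  intro h
  rw [expInt, lintegral_eq_zero_iff (by fun_prop)] at h
  apply hμ
  rw [← ae_eq_bot, ← Filter.eventually_false_iff_eq_bot]
  filter_upwards [h] with a ha
  simp only [Pi.zero_apply, ENNReal.ofReal_eq_zero] at ha
  linarith [Real.exp_pos (f a)]

theorem ofReal_exp_logInt (hμ : μ ≠ 0) (hf : Measurable f) (h : expInt μ f ≠ ∞) :
    ENNReal.ofReal (Real.exp (logInt μ f)) = expInt μ f := by
  rw [logInt, Real.exp_log (ENNReal.toReal_pos (expInt_ne_zero hμ hf) h), ENNReal.ofReal_toReal h]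

theorem log_expInt (hμ : μ ≠ 0) (hf : Measurable f) (h : expInt μ f ≠ ∞) :
    ENNReal.log (expInt μ f) = (logInt μ f : EReal) := by
  rw [← ofReal_exp_logInt hμ hf h, ENNReal.log_ofReal_of_pos (Real.exp_pos _), Real.log_exp]

theorem logInt_le (hμ : μ ≠ 0) (hf : Measurable f) {C : ℝ}
    (h : expInt μ f ≤ ENNReal.ofReal (Real.exp C)) : logInt μ f ≤ C := by
  rw [← ofReal_exp_logInt hμ hf (ne_top_of_le_ne_top ENNReal.ofReal_ne_top h)] at h
  rw [ENNReal.ofReal_le_ofReal_iff (Real.exp_pos _).le] at h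
  exact Real.exp_le_exp.1 h

theorem le_logInt (hμ : μ ≠ 0) (hf : Measurable f) {C : ℝ} (hfin : expInt μ f ≠ ∞)
    (h : ENNReal.ofReal (Real.exp C) ≤ expInt μ f) : C ≤ logInt μ f := by
  rw [← ofReal_exp_logInt hμ hf hfin, ENNReal.ofReal_le_ofReal_iff (Real.exp_pos _).le] at h
  exact Real.exp_le_exp.1 h

theorem expInt_add_const (μ : Measure α) (f : α → ℝ) (C : ℝ) :
    expInt μ (fun a => f a + C) = expInt μ f * ENNReal.ofReal (Real.exp C) := by
  simp only [expInt, Real.exp_add, ENNReal.ofReal_mul (Real.exp_pos _).le]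
  exact lintegral_mul_const' _ _ ENNReal.ofReal_ne_top

theorem expInt_mono (h : ∀ᵐ a ∂μ, f a ≤ g a) : expInt μ f ≤ expInt μ g :=
  lintegral_mono_ae (h.mono fun _ ha => ENNReal.ofReal_le_ofReal (Real.exp_le_exp.2 ha))

/-- Hölder's inequality: the exponential integral is logarithmically convex. -/
theorem expInt_convexComb_le (hf : Measurable f) (hg : Measurable g) {v w : ℝ} (hv : 0 ≤ v)
    (hw : 0 ≤ w) (hvw : v + w = 1) :
    expInt μ (fun a => v * f a + w * g a) ≤ expInt μ f ^ v * expInt μ g ^ w := by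
  have := ENNReal.lintegral_mul_norm_pow_le (μ := μ)
    (f := fun a => ENNReal.ofReal (Real.exp (f a))) (g := fun a => ENNReal.ofReal (Real.exp (g a)))
    (by fun_prop) (by fun_prop) hv hw hvw
  refine le_trans (le_of_eq (lintegral_congr fun a => ?_)) this
  rw [ENNReal.ofReal_rpow_of_pos (Real.exp_pos _), ENNReal.ofReal_rpow_of_pos (Real.exp_pos _),
    ← ENNReal.ofReal_mul (by positivity), ← Real.exp_mul, ← Real.exp_mul, ← Real.exp_add]
  ring_nf

theorem expInt_convexComb_le_exp (hμ : μ ≠ 0) (hf : Measurable f) (hg : Measurable g) {v w : ℝ}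
    (hv : 0 ≤ v) (hw : 0 ≤ w) (hvw : v + w = 1) (hf' : expInt μ f ≠ ∞) (hg' : expInt μ g ≠ ∞) :
    expInt μ (fun a => v * f a + w * g a)
      ≤ ENNReal.ofReal (Real.exp (v * logInt μ f + w * logInt μ g)) := by
  refine (expInt_convexComb_le hf hg hv hw hvw).trans (le_of_eq ?_)
  rw [← ofReal_exp_logInt hμ hf hf', ← ofReal_exp_logInt hμ hg hg',
    ENNReal.ofReal_rpow_of_pos (Real.exp_pos _), ENNReal.ofReal_rpow_of_pos (Real.exp_pos _),
    ← ENNReal.ofReal_mul (by positivity), ← Real.exp_mul, ← Real.exp_mul, ← Real.exp_add]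
  ring_nf

end LogInt

end CausalSDRO

namespace CausalSDRO

/-- The data of the entropic problem in terms of real-valued functions: a nominal distribution `P`
with conditional distribution `η`, reference measures, a real loss `ψ` and separated costs `c₁`,
`c₂`, with `P`-integrable functions `wX`, `wY` that control the costs. -/
structure GibbsModel (X Y : Type*) [MeasurableSpace X] [MeasurableSpace Y] where
  P : Measure (X × Y)
  η : Kernel X Y
  νX : Measure X
  νY : Measure Y
  ψ : X × Y → ℝ
  c₁ : X → X → ℝ
  c₂ : Y → Y → ℝ
  wX : X → ℝ
  wY : Y → ℝ
  prob : IsProbabilityMeasure P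
  markov : IsMarkovKernel η
  sigmaFinite_νX : SigmaFinite νX
  sigmaFinite_νY : SigmaFinite νY
  νX_ne_zero : νX ≠ 0
  νY_ne_zero : νY ≠ 0
  disint : P.fst ⊗ₘ η = P
  measurable_ψ : Measurable ψ
  measurable_c₁ : Measurable (Function.uncurry c₁)
  measurable_c₂ : Measurable (Function.uncurry c₂)
  measurable_wX : Measurable wX
  measurable_wY : Measurable wY
  wX_nonneg : ∀ x, 0 ≤ wX x
  wY_nonneg : ∀ y, 0 ≤ wY y
  integrable_wX : Integrable (fun q : X × Y => wX q.1) P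
  integrable_wY : Integrable (fun q : X × Y => wY q.2) P
  c₁_le : ∃ C, 0 ≤ C ∧ ∀ x x', c₁ x x' ≤ C * (wX x + wX x')
  c₂_le : ∃ C, 0 ≤ C ∧ ∀ y y', c₂ y y' ≤ C * (wY y + wY y')
  tail₁ : ∃ C, 0 ≤ C ∧
    ∀ x, expInt νX (fun x' => -c₁ x x') ≤ ENNReal.ofReal (Real.exp (C * (1 + wX x)))
  tail₂ : ∀ θ : ℝ, 0 ≤ θ → θ < 1 → ∃ C, 0 ≤ C ∧
    ∀ y y', expInt νY (fun u => (θ * c₂ y u - c₂ y' u) / (1 - θ))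
      ≤ ENNReal.ofReal (Real.exp (C * (1 + wY y + wY y')))

namespace GibbsModel

attribute [instance] GibbsModel.prob GibbsModel.markov GibbsModel.sigmaFinite_νX
  GibbsModel.sigmaFinite_νY

variable {X Y : Type*} [MeasurableSpace X] [MeasurableSpace Y] (G : GibbsModel X Y)

/-- The exponent `t ψ(x, y) - c₁(x̂, x) - c₂(ŷ, y)`. -/
def e (t : ℝ) (x' : X) (y' : Y) (x : X) (y : Y) : ℝ := t * G.ψ (x, y) - G.c₁ x' x - G.c₂ y' y

/-- Log-partition function of the conditional law of `y`. -/
noncomputable def a (t : ℝ) (x' : X) (y' : Y) (x : X) : ℝ := logInt G.νY (G.e t x' y' x)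

/-- Conditional mean of `a` given `x̂`. -/
noncomputable def b (t : ℝ) (x' x : X) : ℝ := ∫ y', G.a t x' y' x ∂(G.η x')

/-- Log-partition function of the conditional law of `x`. -/
noncomputable def z (t : ℝ) (x' : X) : ℝ := logInt G.νX (G.b t x')

/-- The mean of the log-partition function. -/
noncomputable def K (t : ℝ) : ℝ := ∫ x', G.z t x' ∂G.P.fst

/-- All the partition functions are finite and their logarithms are integrable. -/
structure Good (t : ℝ) : Prop where
  fin_a : ∀ᵐ x' ∂G.P.fst, ∀ᵐ x ∂G.νX, ∀ᵐ y' ∂(G.η x'), expInt G.νY (G.e t x' y' x) ≠ ∞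
  int_a : ∀ᵐ x' ∂G.P.fst, ∀ᵐ x ∂G.νX, Integrable (fun y' => G.a t x' y' x) (G.η x')
  fin_z : ∀ᵐ x' ∂G.P.fst, expInt G.νX (G.b t x') ≠ ∞
  int_z : Integrable (G.z t) G.P.fst

/-- The product reference measure. -/
noncomputable def ref : Measure ((X × Y) × (X × Y)) := G.P.prod (G.νX.prod G.νY)

section Measurability

variable {δ : Type*} [MeasurableSpace δ]

@[fun_prop]
theorem measurable_ψ_comp {f : δ → X × Y} (hf : Measurable f) : Measurable fun d => G.ψ (f d) :=
  G.measurable_ψ.comp hf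

@[fun_prop]
theorem measurable_wX_comp {f : δ → X} (hf : Measurable f) : Measurable fun d => G.wX (f d) :=
  G.measurable_wX.comp hf

@[fun_prop]
theorem measurable_wY_comp {f : δ → Y} (hf : Measurable f) : Measurable fun d => G.wY (f d) :=
  G.measurable_wY.comp hf

@[fun_prop]
theorem measurable_c₁_comp {f g : δ → X} (hf : Measurable f) (hg : Measurable g) :
    Measurable fun d => G.c₁ (f d) (g d) :=
  G.measurable_c₁.comp (hf.prodMk hg)

@[fun_prop]
theorem measurable_c₂_comp {f g : δ → Y} (hf : Measurable f) (hg : Measurable g) :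
    Measurable fun d => G.c₂ (f d) (g d) :=
  G.measurable_c₂.comp (hf.prodMk hg)

@[fun_prop]
theorem measurable_e_comp (t : ℝ) {f : δ → X} {g : δ → Y} {h : δ → X} {k : δ → Y}
    (hf : Measurable f) (hg : Measurable g) (hh : Measurable h) (hk : Measurable k) :
    Measurable fun d => G.e t (f d) (g d) (h d) (k d) := by
  unfold e; fun_prop

@[fun_prop]
theorem measurable_expInt_e (t : ℝ) {f : δ → X} {g : δ → Y} {h : δ → X}
    (hf : Measurable f) (hg : Measurable g) (hh : Measurable h) :
    Measurable fun d => expInt G.νY (G.e t (f d) (g d) (h d)) := by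
  unfold expInt
  exact Measurable.lintegral_prod_right'
    (f := fun p : δ × Y => ENNReal.ofReal (Real.exp (G.e t (f p.1) (g p.1) (h p.1) p.2)))
    (by fun_prop)

@[fun_prop]
theorem measurable_a_comp (t : ℝ) {f : δ → X} {g : δ → Y} {h : δ → X}
    (hf : Measurable f) (hg : Measurable g) (hh : Measurable h) :
    Measurable fun d => G.a t (f d) (g d) (h d) := by
  unfold a logInt; fun_prop

@[fun_prop]
theorem measurable_b_comp (t : ℝ) {f h : δ → X} (hf : Measurable f) (hh : Measurable h) :
    Measurable fun d => G.b t (f d) (h d) := by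
  have h1 : StronglyMeasurable fun p : X × X =>
      ∫ y', G.a t p.1 y' p.2 ∂(G.η.comap Prod.fst measurable_fst p) :=
    StronglyMeasurable.integral_kernel_prod_right'
      (f := fun p : (X × X) × Y => G.a t p.1.1 p.2 p.1.2)
      (Measurable.stronglyMeasurable (by fun_prop))
  exact h1.measurable.comp (hf.prodMk hh)

@[fun_prop]
theorem measurable_expInt_b (t : ℝ) {f : δ → X} (hf : Measurable f) :
    Measurable fun d => expInt G.νX (G.b t (f d)) := by
  unfold expInt
  exact Measurable.lintegral_prod_right'
    (f := fun p : δ × X => ENNReal.ofReal (Real.exp (G.b t (f p.1) p.2))) (by fun_prop)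

@[fun_prop]
theorem measurable_z_comp (t : ℝ) {f : δ → X} (hf : Measurable f) :
    Measurable fun d => G.z t (f d) := by
  unfold z logInt; fun_prop

end Measurability

theorem lintegral_P {f : X × Y → ℝ≥0∞} (hf : Measurable f) :
    ∫⁻ q, f q ∂G.P = ∫⁻ x', ∫⁻ y', f (x', y') ∂(G.η x') ∂G.P.fst := by
  conv_lhs => rw [← G.disint]
  rw [Measure.lintegral_compProd hf]

theorem lintegral_ref {f : (X × Y) × (X × Y) → ℝ≥0∞} (hf : Measurable f) :
    ∫⁻ ω, f ω ∂G.ref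
      = ∫⁻ x', ∫⁻ x, ∫⁻ y', ∫⁻ y, f ((x', y'), (x, y)) ∂G.νY ∂(G.η x') ∂G.νX ∂G.P.fst := by
  rw [ref, lintegral_prod _ hf.aemeasurable]
  have h1 : ∀ q : X × Y, ∫⁻ r, f (q, r) ∂(G.νX.prod G.νY) = ∫⁻ x, ∫⁻ y, f (q, (x, y)) ∂G.νY ∂G.νX :=
    fun q => lintegral_prod _ (by fun_prop)
  simp_rw [h1]
  have hmeas : Measurable fun p : (X × Y) × X => ∫⁻ y, f (p.1, (p.2, y)) ∂G.νY :=
    Measurable.lintegral_prod_right'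
      (f := fun p : ((X × Y) × X) × Y => f (p.1.1, (p.1.2, p.2))) (by fun_prop)
  rw [G.lintegral_P (f := fun q => ∫⁻ x, ∫⁻ y, f (q, (x, y)) ∂G.νY ∂G.νX)
    (Measurable.lintegral_prod_right' hmeas)]
  refine lintegral_congr fun x' => ?_
  rw [lintegral_lintegral_swap]
  exact (hmeas.comp (by fun_prop : Measurable fun p : Y × X => ((x', p.1), p.2))).aemeasurable

theorem ae_ref_of_ae {p : X → Y → X → Prop}
    (hp : MeasurableSet {u : X × Y × X | p u.1 u.2.1 u.2.2})
    (h : ∀ᵐ x' ∂G.P.fst, ∀ᵐ x ∂G.νX, ∀ᵐ y' ∂(G.η x'), p x' y' x) :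
    ∀ᵐ ω ∂G.ref, p ω.1.1 ω.1.2 ω.2.1 := by
  have hS : MeasurableSet {ω : (X × Y) × (X × Y) | ¬ p ω.1.1 ω.1.2 ω.2.1} :=
    (hp.preimage (by fun_prop : Measurable fun ω : (X × Y) × (X × Y) =>
      (ω.1.1, ω.1.2, ω.2.1))).compl
  rw [ae_iff, ← lintegral_indicator_one hS,
    G.lintegral_ref (measurable_one.indicator hS)]
  rw [← lintegral_zero (μ := G.P.fst)]
  refine lintegral_congr_ae (h.mono fun x' h1 => ?_)
  dsimp only
  rw [← lintegral_zero (μ := G.νX)]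
  refine lintegral_congr_ae (h1.mono fun x h2 => ?_)
  dsimp only
  rw [← lintegral_zero (μ := G.η x')]
  refine lintegral_congr_ae (h2.mono fun y' h3 => ?_)
  simp [h3]

theorem ae_ref_of_ae₂ {p : X → X → Prop} (hp : MeasurableSet {u : X × X | p u.1 u.2})
    (h : ∀ᵐ x' ∂G.P.fst, ∀ᵐ x ∂G.νX, p x' x) : ∀ᵐ ω ∂G.ref, p ω.1.1 ω.2.1 :=
  G.ae_ref_of_ae (p := fun x' _ x => p x' x)
    (hp.preimage (by fun_prop : Measurable fun u : X × Y × X => (u.1, u.2.2)))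
    (h.mono fun _ h1 => h1.mono fun _ h2 => Filter.Eventually.of_forall fun _ => h2)

theorem ae_ref_of_ae₁ {p : X → Prop} (h : ∀ᵐ x' ∂G.P.fst, p x') : ∀ᵐ ω ∂G.ref, p ω.1.1 := by
  have h1 : ∀ᵐ q ∂G.P, p q.1 := by
    rw [Measure.fst] at h
    exact ae_of_ae_map measurable_fst.aemeasurable h
  exact Measure.quasiMeasurePreserving_fst.ae h1

/-- The mean of `wY` given `x̂`. -/
noncomputable def mY (x' : X) : ℝ := ∫ y', G.wY y' ∂(G.η x')

theorem mY_nonneg (x' : X) : 0 ≤ G.mY x' := integral_nonneg fun y => G.wY_nonneg y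

theorem integrable_wY_ae : ∀ᵐ x' ∂G.P.fst, Integrable G.wY (G.η x') := by
  have h := G.integrable_wY
  rw [← G.disint, Measure.integrable_compProd_iff
    (G.measurable_wY_comp measurable_snd).aestronglyMeasurable] at h
  exact h.1

theorem integrable_mY : Integrable G.mY G.P.fst := by
  have h := G.integrable_wY
  rw [← G.disint, Measure.integrable_compProd_iff
    (G.measurable_wY_comp measurable_snd).aestronglyMeasurable] at h
  refine h.2.congr (Filter.Eventually.of_forall fun x' => ?_)
  simp only [mY]
  exact integral_congr_ae (Filter.Eventually.of_forall fun y =>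
    Real.norm_of_nonneg (G.wY_nonneg y))

theorem integrable_wX_fst : Integrable G.wX G.P.fst := by
  rw [Measure.fst, integrable_map_measure (by fun_prop) (by fun_prop)]
  exact G.integrable_wX

/-- Sets of points `x` at which the loss is uniformly bounded from below. -/
def core (n : ℕ) : Set X :=
  {x | G.wX x ≤ n ∧ ((n : ℝ≥0∞) + 1)⁻¹ ≤ G.νY {y | -(n : ℝ) ≤ G.ψ (x, y) ∧ G.wY y ≤ n}}

theorem core_mono : Monotone G.core := by
  intro m n hmn x hx
  have hmn' : (m : ℝ) ≤ n := by exact_mod_cast hmn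
  refine ⟨hx.1.trans hmn', ?_⟩
  calc ((n : ℝ≥0∞) + 1)⁻¹ ≤ ((m : ℝ≥0∞) + 1)⁻¹ := by gcongr
    _ ≤ _ := hx.2
    _ ≤ _ := by
        refine measure_mono fun y hy => ?_
        have hy' : -(m : ℝ) ≤ G.ψ (x, y) ∧ G.wY y ≤ m := hy
        exact ⟨by linarith [hy'.1], hy'.2.trans hmn'⟩

theorem measurableSet_core (n : ℕ) : MeasurableSet (G.core n) := by
  have h1 : MeasurableSet {p : X × Y | -(n : ℝ) ≤ G.ψ p ∧ G.wY p.2 ≤ n} :=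
    MeasurableSet.inter (s₁ := {p : X × Y | -(n : ℝ) ≤ G.ψ p}) (s₂ := {p : X × Y | G.wY p.2 ≤ n})
      (measurableSet_le measurable_const (by fun_prop))
      (measurableSet_le (by fun_prop) measurable_const)
  exact MeasurableSet.inter (s₁ := {x : X | G.wX x ≤ n})
    (s₂ := {x | ((n : ℝ≥0∞) + 1)⁻¹ ≤ G.νY {y | -(n : ℝ) ≤ G.ψ (x, y) ∧ G.wY y ≤ n}})
    (measurableSet_le (by fun_prop) measurable_const)
    (measurableSet_le measurable_const (measurable_measure_prodMk_left h1))

theorem exists_mem_core (x : X) : ∃ n, x ∈ G.core n := by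
  set S : ℕ → Set Y := fun n => {y | -(n : ℝ) ≤ G.ψ (x, y) ∧ G.wY y ≤ n} with hS
  have hmono : Monotone S := by
    intro m n hmn y hy
    have hmn' : (m : ℝ) ≤ n := by exact_mod_cast hmn
    exact ⟨by linarith [hy.1], hy.2.trans hmn'⟩
  have hU : ⋃ n, S n = Set.univ := by
    refine Set.eq_univ_of_forall fun y => Set.mem_iUnion.2 ?_
    obtain ⟨n, hn⟩ := exists_nat_ge (max (-G.ψ (x, y)) (G.wY y))
    exact ⟨n, by linarith [(le_max_left _ _).trans hn], (le_max_right _ _).trans hn⟩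
  have hpos : 0 < G.νY (⋃ n, S n) := by
    rw [hU]; exact Measure.measure_univ_pos.2 G.νY_ne_zero
  obtain ⟨k, hk⟩ : ∃ k, 0 < G.νY (S k) := by
    by_contra! h
    exact hpos.ne' (measure_iUnion_null fun n => le_antisymm (h n) zero_le)
  obtain ⟨m, hm⟩ := ENNReal.exists_inv_nat_lt hk.ne'
  obtain ⟨l, hl⟩ := exists_nat_ge (G.wX x)
  refine ⟨max (max k m) l, hl.trans (by exact_mod_cast le_max_right _ _), ?_⟩
  calc (((max (max k m) l : ℕ) : ℝ≥0∞) + 1)⁻¹ ≤ (m : ℝ≥0∞)⁻¹ := by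
        refine ENNReal.inv_le_inv.2 (le_trans ?_ le_self_add)
        exact_mod_cast (le_max_right k m).trans (le_max_left _ l)
    _ ≤ G.νY (S k) := hm.le
    _ ≤ _ := measure_mono (hmono ((le_max_left k m).trans (le_max_left _ l)))

theorem exists_core_measure_ge : ∃ n : ℕ, ((n : ℝ≥0∞) + 1)⁻¹ ≤ G.νX (G.core n) := by
  have hpos : 0 < G.νX (⋃ n, G.core n) := by
    rw [Set.eq_univ_of_forall fun x => Set.mem_iUnion.2 (G.exists_mem_core x)]
    exact Measure.measure_univ_pos.2 G.νX_ne_zero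
  obtain ⟨k, hk⟩ : ∃ k, 0 < G.νX (G.core k) := by
    by_contra! h
    exact hpos.ne' (measure_iUnion_null fun n => le_antisymm (h n) zero_le)
  obtain ⟨m, hm⟩ := ENNReal.exists_inv_nat_lt hk.ne'
  refine ⟨max k m, ?_⟩
  calc (((max k m : ℕ) : ℝ≥0∞) + 1)⁻¹ ≤ (m : ℝ≥0∞)⁻¹ := by
        refine ENNReal.inv_le_inv.2 (le_trans ?_ le_self_add)
        exact_mod_cast le_max_right k m
    _ ≤ G.νX (G.core k) := hm.le
    _ ≤ _ := measure_mono (G.core_mono (le_max_left k m))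

end GibbsModel

theorem ofReal_exp_le_expInt {α : Type*} [MeasurableSpace α] {μ : Measure α} {f : α → ℝ} {s : Set α}
    (hs : MeasurableSet s) {C : ℝ} {n : ℕ} (hμ : ((n : ℝ≥0∞) + 1)⁻¹ ≤ μ s) (h : ∀ a ∈ s, C ≤ f a) :
    ENNReal.ofReal (Real.exp (C - Real.log (n + 1))) ≤ expInt μ f := by
  have hn : (0 : ℝ) < n + 1 := by positivity
  calc ENNReal.ofReal (Real.exp (C - Real.log (n + 1)))
      = ENNReal.ofReal (Real.exp C) * ((n : ℝ≥0∞) + 1)⁻¹ := by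
        rw [Real.exp_sub, Real.exp_log hn, ENNReal.ofReal_div_of_pos hn, div_eq_mul_inv]
        congr 2
        rw [ENNReal.ofReal_add (by positivity) zero_le_one, ENNReal.ofReal_natCast,
          ENNReal.ofReal_one]
    _ ≤ ENNReal.ofReal (Real.exp C) * μ s := by gcongr
    _ = ∫⁻ _ in s, ENNReal.ofReal (Real.exp C) ∂μ := (setLIntegral_const _ _).symm
    _ ≤ ∫⁻ a in s, ENNReal.ofReal (Real.exp (f a)) ∂μ :=
        setLIntegral_mono' hs fun a ha =>
          ENNReal.ofReal_le_ofReal (Real.exp_le_exp.2 (h a ha))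
    _ ≤ expInt μ f := setLIntegral_le_lintegral _ _

theorem le_logInt_of_nonpos {α : Type*} [MeasurableSpace α] {μ : Measure α} {f : α → ℝ} {C : ℝ}
    (hμ : μ ≠ 0) (hf : Measurable f) (hC : C ≤ 0)
    (h : ENNReal.ofReal (Real.exp C) ≤ expInt μ f) : C ≤ logInt μ f := by
  rcases eq_or_ne (expInt μ f) ∞ with h1 | h1
  · simpa [logInt, h1] using hC
  · exact le_logInt hμ hf h1 h

namespace GibbsModel

variable {X Y : Type*} [MeasurableSpace X] [MeasurableSpace Y] (G : GibbsModel X Y)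

theorem le_expInt_e {t : ℝ} (ht : 0 ≤ t) (n : ℕ) : ∃ C, 0 ≤ C ∧ ∀ x ∈ G.core n, ∀ x' y',
    ENNReal.ofReal (Real.exp (-(C * (1 + G.wX x' + G.wY y')))) ≤ expInt G.νY (G.e t x' y' x) := by
  obtain ⟨C₁, hC₁, h₁⟩ := G.c₁_le
  obtain ⟨C₂, hC₂, h₂⟩ := G.c₂_le
  have hlog : 0 ≤ Real.log ((n : ℝ) + 1) := Real.log_nonneg (by linarith [Nat.cast_nonneg (α := ℝ) n])
  have hn : (0 : ℝ) ≤ n := Nat.cast_nonneg n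
  refine ⟨t * n + C₁ * n + C₂ * n + Real.log (n + 1) + C₁ + C₂, by positivity, ?_⟩
  intro x hx x' y'
  have hX := G.wX_nonneg x'
  have hY := G.wY_nonneg y'
  have hS : MeasurableSet {y | -(n : ℝ) ≤ G.ψ (x, y) ∧ G.wY y ≤ n} :=
    MeasurableSet.inter (s₁ := {y | -(n : ℝ) ≤ G.ψ (x, y)}) (s₂ := {y | G.wY y ≤ n})
      (measurableSet_le measurable_const (by fun_prop))
      (measurableSet_le (by fun_prop) measurable_const)
  refine le_trans (ENNReal.ofReal_le_ofReal (Real.exp_le_exp.2 ?_)) (ofReal_exp_le_expInt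
    (C := -(t * n) - C₁ * (G.wX x' + n) - C₂ * (G.wY y' + n)) (n := n) hS hx.2 ?_)
  · nlinarith [mul_nonneg ht hn, mul_nonneg hC₁ hn, mul_nonneg hC₂ hn, mul_nonneg hC₁ hX,
      mul_nonneg hC₁ hY, mul_nonneg hC₂ hX, mul_nonneg hC₂ hY, mul_nonneg hlog hX,
      mul_nonneg hlog hY, mul_nonneg (mul_nonneg ht hn) hX, mul_nonneg (mul_nonneg ht hn) hY,
      mul_nonneg (mul_nonneg hC₁ hn) hX, mul_nonneg (mul_nonneg hC₁ hn) hY,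
      mul_nonneg (mul_nonneg hC₂ hn) hX, mul_nonneg (mul_nonneg hC₂ hn) hY]
  · intro y hy
    have h3 := h₁ x' x
    have h4 := h₂ y' y
    have h5 : C₁ * (G.wX x' + G.wX x) ≤ C₁ * (G.wX x' + n) := by gcongr; exact hx.1
    have h6 : C₂ * (G.wY y' + G.wY y) ≤ C₂ * (G.wY y' + n) := by gcongr; exact hy.2
    have h7 : t * -(n : ℝ) ≤ t * G.ψ (x, y) := by gcongr; exact hy.1
    unfold e
    linarith

theorem le_a {t : ℝ} (ht : 0 ≤ t) (n : ℕ) : ∃ C, 0 ≤ C ∧ ∀ x ∈ G.core n, ∀ x' y',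
    -(C * (1 + G.wX x' + G.wY y')) ≤ G.a t x' y' x := by
  obtain ⟨C, hC, h⟩ := G.le_expInt_e ht n
  refine ⟨C, hC, fun x hx x' y' => le_logInt_of_nonpos G.νY_ne_zero (by fun_prop) ?_ (h x hx x' y')⟩
  have := G.wX_nonneg x'
  have := G.wY_nonneg y'
  have : 0 ≤ C * (1 + G.wX x' + G.wY y') := by positivity
  linarith

theorem le_b {t : ℝ} (ht : 0 ≤ t) (n : ℕ) : ∃ C, 0 ≤ C ∧ ∀ x ∈ G.core n, ∀ x',
    Integrable G.wY (G.η x') → -(C * (1 + G.wX x' + G.mY x')) ≤ G.b t x' x := by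
  obtain ⟨C, hC, h⟩ := G.le_a ht n
  refine ⟨C, hC, fun x hx x' hw => ?_⟩
  by_cases hi : Integrable (fun y' => G.a t x' y' x) (G.η x')
  · calc -(C * (1 + G.wX x' + G.mY x')) = ∫ y', -(C * (1 + G.wX x' + G.wY y')) ∂(G.η x') := by
          rw [integral_neg, integral_const_mul, integral_add (integrable_const _) hw]
          simp [mY]
      _ ≤ _ := integral_mono (((integrable_const _).add hw).const_mul C).neg hi (h x hx x')
  · rw [b, integral_undef hi]
    have := G.wX_nonneg x'
    have := G.mY_nonneg x'
    have : 0 ≤ C * (1 + G.wX x' + G.mY x') := by positivity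
    linarith

theorem le_z {t : ℝ} (ht : 0 ≤ t) : ∃ C, 0 ≤ C ∧ ∀ x',
    Integrable G.wY (G.η x') → -(C * (1 + G.wX x' + G.mY x')) ≤ G.z t x' := by
  obtain ⟨n, hn⟩ := G.exists_core_measure_ge
  obtain ⟨C, hC, h⟩ := G.le_b ht n
  have hlog : 0 ≤ Real.log ((n : ℝ) + 1) := Real.log_nonneg (by linarith [Nat.cast_nonneg (α := ℝ) n])
  refine ⟨C + Real.log (n + 1), by positivity, fun x' hw => ?_⟩
  have hX := G.wX_nonneg x'
  have hY := G.mY_nonneg x'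
  have h0 : 0 ≤ (C + Real.log (n + 1)) * (1 + G.wX x' + G.mY x') := by positivity
  refine le_logInt_of_nonpos G.νX_ne_zero (by fun_prop) (by linarith) ?_
  refine le_trans (ENNReal.ofReal_le_ofReal (Real.exp_le_exp.2 ?_))
    (ofReal_exp_le_expInt (C := -(C * (1 + G.wX x' + G.mY x'))) (G.measurableSet_core n) hn
      fun x hx => h x hx x' hw)
  nlinarith [mul_nonneg hlog hX, mul_nonneg hlog hY]

/-- A criterion for finiteness; the lower bounds are automatic. -/
theorem good_of_le {t : ℝ} (ht : 0 ≤ t) {U : X → X → Y → ℝ} {V : X → ℝ}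
    (hU : ∀ᵐ x' ∂G.P.fst, ∀ᵐ x ∂G.νX, Integrable (U x' x) (G.η x') ∧
      ∀ᵐ y' ∂(G.η x'), expInt G.νY (G.e t x' y' x) ≤ ENNReal.ofReal (Real.exp (U x' x y')))
    (hV : Integrable V G.P.fst)
    (hVb : ∀ᵐ x' ∂G.P.fst, expInt G.νX (fun x => ∫ y', U x' x y' ∂(G.η x'))
      ≤ ENNReal.ofReal (Real.exp (V x'))) :
    G.Good t ∧ G.K t ≤ ∫ x', V x' ∂G.P.fst := by
  have hia : ∀ᵐ x' ∂G.P.fst, ∀ᵐ x ∂G.νX, Integrable (fun y' => G.a t x' y' x) (G.η x') := by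
    filter_upwards [hU, G.integrable_wY_ae] with x' h1 hw
    filter_upwards [h1] with x h2
    obtain ⟨n, hn⟩ := G.exists_mem_core x
    obtain ⟨C, hC, hCl⟩ := G.le_a ht n
    have hb : Integrable (fun y' => |U x' x y'| + C * (1 + G.wX x' + G.wY y')) (G.η x') :=
      h2.1.abs.add (((integrable_const _).add hw).const_mul _)
    refine hb.mono' (by fun_prop) ?_
    filter_upwards [h2.2] with y' h3
    have h4 := hCl x hn x' y'
    have h5 : G.a t x' y' x ≤ U x' x y' := logInt_le G.νY_ne_zero (by fun_prop) h3
    have hX := G.wX_nonneg x'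
    have hY := G.wY_nonneg y'
    have : 0 ≤ C * (1 + G.wX x' + G.wY y') := by positivity
    rw [Real.norm_eq_abs, abs_le]
    constructor <;> linarith [le_abs_self (U x' x y'), abs_nonneg (U x' x y')]
  have hVb' : ∀ᵐ x' ∂G.P.fst, expInt G.νX (G.b t x') ≤ ENNReal.ofReal (Real.exp (V x')) := by
    filter_upwards [hU, hVb, hia] with x' h1 h2 h3
    refine (expInt_mono ?_).trans h2
    filter_upwards [h1, h3] with x h4 h5
    exact integral_mono_ae h5 h4.1 (h4.2.mono fun y' h6 => logInt_le G.νY_ne_zero (by fun_prop) h6)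
  have hz : ∀ᵐ x' ∂G.P.fst, G.z t x' ≤ V x' :=
    hVb'.mono fun x' h => logInt_le G.νX_ne_zero (by fun_prop) h
  obtain ⟨C', hC', hlow⟩ := G.le_z ht
  have hzi : Integrable (G.z t) G.P.fst := by
    have hb : Integrable (fun x' => |V x'| + C' * (1 + G.wX x' + G.mY x')) G.P.fst :=
      hV.abs.add ((((integrable_const _).add G.integrable_wX_fst).add G.integrable_mY).const_mul _)
    refine hb.mono' (by fun_prop) ?_
    filter_upwards [hz, G.integrable_wY_ae] with x' h1 h2
    have h3 := hlow x' h2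
    have hX := G.wX_nonneg x'
    have hY := G.mY_nonneg x'
    have : 0 ≤ C' * (1 + G.wX x' + G.mY x') := by positivity
    rw [Real.norm_eq_abs, abs_le]
    constructor <;> linarith [le_abs_self (V x'), abs_nonneg (V x')]
  refine ⟨⟨?_, hia, ?_, hzi⟩, integral_mono_ae hzi hV hz⟩
  · filter_upwards [hU] with x' h1
    filter_upwards [h1] with x h2
    filter_upwards [h2.2] with y' h3
    exact ne_top_of_le_ne_top ENNReal.ofReal_ne_top h3
  · exact hVb'.mono fun x' h => ne_top_of_le_ne_top ENNReal.ofReal_ne_top h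

end GibbsModel

end CausalSDRO

namespace CausalSDRO

namespace GibbsModel

variable {X Y : Type*} [MeasurableSpace X] [MeasurableSpace Y] {G : GibbsModel X Y}

theorem e_convexComb {s t v w : ℝ} (hvw : v + w = 1) (x' : X) (y' : Y) (x : X) :
    G.e (v * s + w * t) x' y' x = fun y => v * G.e s x' y' x y + w * G.e t x' y' x y := by
  funext y
  unfold e
  linear_combination (G.c₁ x' x + G.c₂ y' y) * hvw

theorem expInt_e_convexComb_le {s t v w : ℝ} (hv : 0 ≤ v) (hw : 0 ≤ w) (hvw : v + w = 1)
    {x' : X} {y' : Y} {x : X} (hs : expInt G.νY (G.e s x' y' x) ≠ ∞)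
    (ht : expInt G.νY (G.e t x' y' x) ≠ ∞) :
    expInt G.νY (G.e (v * s + w * t) x' y' x)
      ≤ ENNReal.ofReal (Real.exp (v * G.a s x' y' x + w * G.a t x' y' x)) := by
  rw [e_convexComb hvw]
  exact expInt_convexComb_le_exp G.νY_ne_zero (by fun_prop) (by fun_prop) hv hw hvw hs ht

theorem a_convexComb_le {s t v w : ℝ} (hv : 0 ≤ v) (hw : 0 ≤ w) (hvw : v + w = 1)
    {x' : X} {y' : Y} {x : X} (hs : expInt G.νY (G.e s x' y' x) ≠ ∞)
    (ht : expInt G.νY (G.e t x' y' x) ≠ ∞) :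
    G.a (v * s + w * t) x' y' x ≤ v * G.a s x' y' x + w * G.a t x' y' x :=
  logInt_le G.νY_ne_zero (by fun_prop) (expInt_e_convexComb_le hv hw hvw hs ht)

theorem b_convexComb_le {s t v w : ℝ} (hv : 0 ≤ v) (hw : 0 ≤ w) (hvw : v + w = 1)
    {x' x : X} (hs : ∀ᵐ y' ∂(G.η x'), expInt G.νY (G.e s x' y' x) ≠ ∞)
    (ht : ∀ᵐ y' ∂(G.η x'), expInt G.νY (G.e t x' y' x) ≠ ∞)
    (his : Integrable (fun y' => G.a s x' y' x) (G.η x'))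
    (hit : Integrable (fun y' => G.a t x' y' x) (G.η x'))
    (hi : Integrable (fun y' => G.a (v * s + w * t) x' y' x) (G.η x')) :
    G.b (v * s + w * t) x' x ≤ v * G.b s x' x + w * G.b t x' x := by
  unfold b
  rw [← integral_const_mul, ← integral_const_mul,
    ← integral_add (his.const_mul v) (hit.const_mul w)]
  refine integral_mono_ae hi ((his.const_mul v).add (hit.const_mul w)) ?_
  filter_upwards [hs, ht] with y' h1 h2
  exact a_convexComb_le hv hw hvw h1 h2

/-- The set of finiteness is convex, and so is the mean log-partition function. -/
theorem Good.convexComb {s t v w : ℝ} (hs : G.Good s) (ht : G.Good t) (hs0 : 0 ≤ s) (ht0 : 0 ≤ t)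
    (hv : 0 ≤ v) (hw : 0 ≤ w) (hvw : v + w = 1) :
    G.Good (v * s + w * t) ∧ G.K (v * s + w * t) ≤ v * G.K s + w * G.K t := by
  have h := G.good_of_le (t := v * s + w * t) (by positivity)
    (U := fun x' x y' => v * G.a s x' y' x + w * G.a t x' y' x)
    (V := fun x' => v * G.z s x' + w * G.z t x') ?_ ((hs.int_z.const_mul v).add
      (ht.int_z.const_mul w)) ?_
  · refine ⟨h.1, h.2.trans (le_of_eq ?_)⟩
    rw [integral_add (hs.int_z.const_mul v) (ht.int_z.const_mul w), integral_const_mul,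
      integral_const_mul]
    rfl
  · filter_upwards [hs.fin_a, ht.fin_a, hs.int_a, ht.int_a] with x' h1 h2 h3 h4
    filter_upwards [h1, h2, h3, h4] with x h5 h6 h7 h8
    refine ⟨(h7.const_mul v).add (h8.const_mul w), ?_⟩
    filter_upwards [h5, h6] with y' h9 h10
    exact expInt_e_convexComb_le hv hw hvw h9 h10
  · filter_upwards [hs.fin_z, ht.fin_z, hs.int_a, ht.int_a] with x' h1 h2 h3 h4
    refine le_trans (expInt_mono ?_) (expInt_convexComb_le_exp G.νX_ne_zero
      (f := G.b s x') (g := G.b t x') (by fun_prop) (by fun_prop) hv hw hvw h1 h2)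
    filter_upwards [h3, h4] with x h5 h6
    rw [integral_add (h5.const_mul v) (h6.const_mul w), integral_const_mul, integral_const_mul]
    rfl

theorem exists_expInt_e_zero_le (G : GibbsModel X Y) : ∃ C, 0 ≤ C ∧ ∀ x' y' x,
    expInt G.νY (G.e 0 x' y' x)
      ≤ ENNReal.ofReal (Real.exp (C * (1 + 2 * G.wY y') - G.c₁ x' x)) := by
  obtain ⟨C, hC, h⟩ := G.tail₂ 0 le_rfl zero_lt_one
  refine ⟨C, hC, fun x' y' x => ?_⟩
  have h1 := h y' y'
  have h2 : G.e 0 x' y' x = fun y => (0 * G.c₂ y' y - G.c₂ y' y) / (1 - 0) + -G.c₁ x' x := by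
    funext y; unfold e; ring
  rw [h2, expInt_add_const, sub_eq_add_neg (C * _), Real.exp_add, ENNReal.ofReal_mul (Real.exp_pos _).le,
    show C * (1 + 2 * G.wY y') = C * (1 + G.wY y' + G.wY y') by ring]
  gcongr

theorem good_zero (G : GibbsModel X Y) : G.Good 0 := by
  obtain ⟨C, hC, h⟩ := G.exists_expInt_e_zero_le
  obtain ⟨C', hC', h'⟩ := G.tail₁
  refine (G.good_of_le le_rfl (U := fun x' x y' => C * (1 + 2 * G.wY y') - G.c₁ x' x)
    (V := fun x' => C * (1 + 2 * G.mY x') + C' * (1 + G.wX x')) ?_ ?_ ?_).1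
  · filter_upwards [G.integrable_wY_ae] with x' hw
    refine Filter.Eventually.of_forall fun x => ⟨?_, Filter.Eventually.of_forall fun y' => h x' y' x⟩
    exact (((integrable_const _).add (hw.const_mul 2)).const_mul C).sub (integrable_const _)
  · exact (((integrable_const _).add (G.integrable_mY.const_mul 2)).const_mul C).add
      (((integrable_const _).add G.integrable_wX_fst).const_mul C')
  · filter_upwards [G.integrable_wY_ae] with x' hw
    have h1 : (fun x => ∫ y', (C * (1 + 2 * G.wY y') - G.c₁ x' x) ∂(G.η x'))
        = fun x => -G.c₁ x' x + C * (1 + 2 * G.mY x') := by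
      funext x
      have h2 : Integrable (fun y' => 1 + 2 * G.wY y') (G.η x') :=
        (integrable_const _).add (hw.const_mul 2)
      rw [integral_sub (h2.const_mul C) (integrable_const _), integral_const_mul,
        integral_add (integrable_const _) (hw.const_mul 2), integral_const_mul]
      simp only [integral_const, probReal_univ, smul_eq_mul, mY]
      ring
    rw [h1, expInt_add_const, add_comm (C * _), Real.exp_add, ENNReal.ofReal_mul (Real.exp_pos _).le]
    gcongr
    exact h' x'

theorem good_of_ae_le {S : ℝ} (hS : ∀ᵐ q ∂(G.νX.prod G.νY), G.ψ q ≤ S) {t : ℝ} (ht : 0 ≤ t) :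
    G.Good t ∧ G.K t ≤ t * S + G.K 0 := by
  have h0 := G.good_zero
  have h := G.good_of_le (t := t) ht (U := fun x' x y' => G.a 0 x' y' x + t * S)
    (V := fun x' => G.z 0 x' + t * S) ?_ (h0.int_z.add (integrable_const _)) ?_
  · refine ⟨h.1, h.2.trans (le_of_eq ?_)⟩
    rw [integral_add h0.int_z (integrable_const _)]
    simp only [integral_const, probReal_univ, smul_eq_mul, K]
    ring
  · filter_upwards [h0.fin_a, h0.int_a] with x' h1 h2
    filter_upwards [h1, h2, Measure.ae_ae_of_ae_prod hS] with x h3 h4 h5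
    refine ⟨h4.add (integrable_const _), ?_⟩
    filter_upwards [h3] with y' h6
    have h7 : expInt G.νY (G.e t x' y' x) ≤ expInt G.νY (fun y => G.e 0 x' y' x y + t * S) := by
      refine expInt_mono (h5.mono fun y h8 => ?_)
      have := mul_le_mul_of_nonneg_left h8 ht
      unfold e
      linarith
    refine h7.trans (le_of_eq ?_)
    rw [expInt_add_const, a, Real.exp_add, ENNReal.ofReal_mul (Real.exp_pos _).le,
      ofReal_exp_logInt G.νY_ne_zero (by fun_prop) h6]
  · filter_upwards [h0.fin_z, h0.int_a] with x' h1 h2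
    have h3 : expInt G.νX (fun x => ∫ y', (G.a 0 x' y' x + t * S) ∂(G.η x'))
        ≤ expInt G.νX (fun x => G.b 0 x' x + t * S) := by
      refine expInt_mono (h2.mono fun x h4 => ?_)
      rw [integral_add h4 (integrable_const _)]
      simp [b]
    refine h3.trans (le_of_eq ?_)
    rw [expInt_add_const, z, Real.exp_add, ENNReal.ofReal_mul (Real.exp_pos _).le,
      ofReal_exp_logInt G.νX_ne_zero (by fun_prop) h1]

theorem Good.of_le {s t : ℝ} (ht : G.Good t) (hs : 0 ≤ s) (hst : s ≤ t) : G.Good s := by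
  rcases hs.eq_or_lt with rfl | hs
  · exact G.good_zero
  have ht0 : 0 < t := hs.trans_le hst
  have h := (G.good_zero.convexComb ht le_rfl ht0.le (v := 1 - s / t) (w := s / t)
    (sub_nonneg.2 ((div_le_one ht0).2 hst)) (by positivity) (by ring)).1
  rwa [mul_zero, zero_add, div_mul_cancel₀ _ ht0.ne'] at h

theorem Good.ref_fin_a {t : ℝ} (h : G.Good t) :
    ∀ᵐ ω ∂G.ref, expInt G.νY (G.e t ω.1.1 ω.1.2 ω.2.1) ≠ ∞ :=
  G.ae_ref_of_ae (p := fun x' y' x => expInt G.νY (G.e t x' y' x) ≠ ∞)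
    (measurableSet_eq_fun (by fun_prop) measurable_const).compl h.fin_a

theorem Good.ref_int_a {t : ℝ} (h : G.Good t) :
    ∀ᵐ ω ∂G.ref, Integrable (fun y' => G.a t ω.1.1 y' ω.2.1) (G.η ω.1.1) := by
  refine G.ae_ref_of_ae₂ (p := fun x' x => Integrable (fun y' => G.a t x' y' x) (G.η x'))
    ?_ h.int_a
  exact measurableSet_kernel_integrable (κ := G.η.comap Prod.fst measurable_fst)
    (f := fun (u : X × X) (y' : Y) => G.a t u.1 y' u.2)
    (Measurable.stronglyMeasurable (by unfold Function.uncurry; fun_prop))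

theorem Good.ref_fin_a_ae {t : ℝ} (h : G.Good t) :
    ∀ᵐ ω ∂G.ref, ∀ᵐ y' ∂(G.η ω.1.1), expInt G.νY (G.e t ω.1.1 y' ω.2.1) ≠ ∞ := by
  refine G.ae_ref_of_ae₂ (p := fun x' x => ∀ᵐ y' ∂(G.η x'), expInt G.νY (G.e t x' y' x) ≠ ∞)
    ?_ h.fin_a
  simp only [ae_iff]
  refine measurableSet_eq_fun ?_ measurable_const
  exact Kernel.measurable_kernel_prodMk_left (κ := G.η.comap Prod.fst measurable_fst)
    (t := {p : (X × X) × Y | ¬expInt G.νY (G.e t p.1.1 p.2 p.1.2) ≠ ∞})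
    (measurableSet_eq_fun (by fun_prop) measurable_const).compl.compl

theorem Good.ref_fin_z {t : ℝ} (h : G.Good t) : ∀ᵐ ω ∂G.ref, expInt G.νX (G.b t ω.1.1) ≠ ∞ :=
  G.ae_ref_of_ae₁ h.fin_z

end GibbsModel

end CausalSDRO

namespace CausalSDRO

theorem IsCentered.of_map {α β : Type*} [MeasurableSpace α] [MeasurableSpace β] {μ : Measure α}
    {T : α → β} (hT : Measurable T) {D : β → ℝ} (hDm : Measurable D)
    (h : IsCentered (μ.map T) D) : IsCentered μ fun a => D (T a) := by
  obtain ⟨B, h1, h2, h3, h4, h5⟩ := h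
  refine ⟨fun n => T ⁻¹' B n, fun m n hmn => Set.preimage_mono (h1 hmn), fun n => hT (h2 n),
    ae_of_ae_map hT.aemeasurable h3, fun n => ?_, fun n => ?_⟩
  · have := h4 n
    rw [IntegrableOn, Measure.restrict_map hT (h2 n),
      integrable_map_measure hDm.aestronglyMeasurable hT.aemeasurable] at this
    exact this
  · rw [← h5 n, setIntegral_map (h2 n) hDm.aestronglyMeasurable hT.aemeasurable]

theorem isCentered_compProd {α β : Type*} [MeasurableSpace α] [MeasurableSpace β] {m : Measure α}
    [IsFiniteMeasure m] {κ : Kernel α β} [IsMarkovKernel κ] {D : α × β → ℝ} (hD : Measurable D)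
    (h : ∀ᵐ a ∂m, Integrable (fun b => D (a, b)) (κ a) ∧ ∫ b, D (a, b) ∂(κ a) = 0) :
    IsCentered (m ⊗ₘ κ) D := by
  set N : α → ℝ≥0∞ := fun a => ∫⁻ b, ‖D (a, b)‖ₑ ∂(κ a) with hN
  have hNm : Measurable N := Measurable.lintegral_kernel_prod_right' (f := fun p => ‖D p‖ₑ)
    hD.enorm
  set S : ℕ → Set α := fun n => {a | N a ≤ n} with hS
  have hSm : ∀ n, MeasurableSet (S n) := fun n => measurableSet_le hNm measurable_const
  have hint : ∀ n, IntegrableOn D (S n ×ˢ Set.univ) (m ⊗ₘ κ) := by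
    intro n
    refine ⟨hD.aestronglyMeasurable, ?_⟩
    rw [hasFiniteIntegral_iff_enorm,
      Measure.setLIntegral_compProd hD.enorm (hSm n) MeasurableSet.univ]
    calc ∫⁻ a in S n, ∫⁻ b in Set.univ, ‖D (a, b)‖ₑ ∂(κ a) ∂m
        ≤ ∫⁻ a in S n, (n : ℝ≥0∞) ∂m := by
          refine setLIntegral_mono' (hSm n) fun a ha => ?_
          rw [setLIntegral_univ]; exact ha
      _ = n * m (S n) := setLIntegral_const _ _
      _ < ∞ := ENNReal.mul_lt_top (ENNReal.natCast_lt_top n) (measure_lt_top _ _)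
  refine ⟨fun n => S n ×ˢ Set.univ, fun i j hij => Set.prod_mono (fun a ha => ?_) le_rfl,
    fun n => (hSm n).prod MeasurableSet.univ, ?_, hint, fun n => ?_⟩
  · have ha' : N a ≤ i := ha
    exact ha'.trans (by exact_mod_cast hij)
  · have hfin : ∀ᵐ a ∂m, ∃ n : ℕ, N a ≤ n := by
      filter_upwards [h] with a ha
      have h1 : N a < ∞ := ha.1.2
      obtain ⟨n, hn⟩ := ENNReal.exists_nat_gt h1.ne
      exact ⟨n, hn.le⟩
    have := Measure.ae_compProd_of_ae_ae (μ := m) (κ := κ)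
      (p := fun q : α × β => ∃ n : ℕ, q ∈ S n ×ˢ (Set.univ : Set β)) ?_ ?_
    · exact this
    · have : {q : α × β | ∃ n : ℕ, q ∈ S n ×ˢ (Set.univ : Set β)}
          = ⋃ n, S n ×ˢ (Set.univ : Set β) := by ext; simp
      rw [this]
      exact MeasurableSet.iUnion fun n => (hSm n).prod MeasurableSet.univ
    · filter_upwards [hfin] with a ⟨n, hn⟩
      exact Filter.Eventually.of_forall fun b => ⟨n, hn, trivial⟩
  · rw [Measure.setIntegral_compProd (hSm n) MeasurableSet.univ (hint n)]
    simp only [Measure.restrict_univ]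
    rw [integral_eq_zero_of_ae]
    exact ae_restrict_of_ae (h.mono fun a ha => ha.2)

namespace GibbsModel

variable {X Y : Type*} [MeasurableSpace X] [MeasurableSpace Y] (G : GibbsModel X Y)

/-- Under `γ`, the conditional law of `ŷ` given `(x̂, x)` is `η x̂`. -/
def CausalLaw (γ : Measure ((X × Y) × (X × Y))) : Prop :=
  γ.map (fun ω => ((ω.1.1, ω.2.1), ω.1.2))
    = (γ.map fun ω => (ω.1.1, ω.2.1)) ⊗ₘ (G.η.comap Prod.fst measurable_fst)

variable {G}

theorem CausalLaw.isCentered {γ : Measure ((X × Y) × (X × Y))} [IsFiniteMeasure γ]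
    (hγ : G.CausalLaw γ) {D : X → Y → X → ℝ}
    (hD : Measurable fun p : (X × X) × Y => D p.1.1 p.2 p.1.2)
    (h : ∀ᵐ ω ∂γ, Integrable (fun y' => D ω.1.1 y' ω.2.1) (G.η ω.1.1) ∧
      ∫ y', D ω.1.1 y' ω.2.1 ∂(G.η ω.1.1) = 0) :
    IsCentered γ fun ω => D ω.1.1 ω.1.2 ω.2.1 := by
  refine IsCentered.of_map (T := fun ω : (X × Y) × (X × Y) => ((ω.1.1, ω.2.1), ω.1.2))
    (D := fun p : (X × X) × Y => D p.1.1 p.2 p.1.2) (by fun_prop) hD ?_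
  rw [hγ]
  refine isCentered_compProd hD ?_
  have hm : Measurable fun ω : (X × Y) × (X × Y) => (ω.1.1, ω.2.1) := by fun_prop
  rw [ae_map_iff hm.aemeasurable]
  · exact h
  · have h1 : StronglyMeasurable fun p : (X × X) × Y => D p.1.1 p.2 p.1.2 := hD.stronglyMeasurable
    refine MeasurableSet.inter (measurableSet_kernel_integrable
      (κ := G.η.comap Prod.fst measurable_fst) (f := fun (u : X × X) y' => D u.1 y' u.2) h1) ?_
    exact measurableSet_eq_fun
      (StronglyMeasurable.integral_kernel_prod_right' (κ := G.η.comap Prod.fst measurable_fst)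
        (f := fun p : (X × X) × Y => D p.1.1 p.2 p.1.2) h1).measurable measurable_const

variable (G)

/-- The logarithm of the Gibbs density. -/
noncomputable def F (t : ℝ) (ω : (X × Y) × (X × Y)) : ℝ :=
  (G.b t ω.1.1 ω.2.1 - G.z t ω.1.1)
    + (G.e t ω.1.1 ω.1.2 ω.2.1 ω.2.2 - G.a t ω.1.1 ω.1.2 ω.2.1)

@[fun_prop]
theorem measurable_F (t : ℝ) : Measurable (G.F t) := by unfold F; fun_prop

/-- The Gibbs plan. -/
noncomputable def gibbs (t : ℝ) : Measure ((X × Y) × (X × Y)) :=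
  G.ref.withDensity fun ω => ENNReal.ofReal (Real.exp (G.F t ω))

variable {G}

theorem expInt_sub_logInt {α : Type*} [MeasurableSpace α] {μ : Measure α} (hμ : μ ≠ 0) {f : α → ℝ}
    (hf : Measurable f) (h : expInt μ f ≠ ∞) : expInt μ (fun a => f a - logInt μ f) = 1 := by
  simp only [sub_eq_add_neg]
  rw [expInt_add_const, ← ofReal_exp_logInt hμ hf h, ← ENNReal.ofReal_mul (Real.exp_pos _).le,
    ← Real.exp_add]
  simp

theorem lintegral_exp_add_le_one {g₁ : X → X → ℝ} {g₂ : X → Y → X → Y → ℝ}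
    (hm : Measurable fun ω : (X × Y) × (X × Y) => g₁ ω.1.1 ω.2.1 + g₂ ω.1.1 ω.1.2 ω.2.1 ω.2.2)
    (h₁ : ∀ᵐ x' ∂G.P.fst, expInt G.νX (g₁ x') ≤ 1)
    (h₂ : ∀ᵐ x' ∂G.P.fst, ∀ᵐ x ∂G.νX, ∀ᵐ y' ∂(G.η x'), expInt G.νY (g₂ x' y' x) ≤ 1) :
    expInt G.ref (fun ω => g₁ ω.1.1 ω.2.1 + g₂ ω.1.1 ω.1.2 ω.2.1 ω.2.2) ≤ 1 := by
  rw [expInt, G.lintegral_ref (by fun_prop)]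
  calc _ ≤ ∫⁻ _, 1 ∂G.P.fst := by
        refine lintegral_mono_ae ?_
        filter_upwards [h₁, h₂] with x' h3 h4
        refine le_trans (lintegral_mono_ae (h4.mono fun x h5 => ?_)) h3
        calc _ ≤ ∫⁻ y', ENNReal.ofReal (Real.exp (g₁ x' x)) ∂(G.η x') := by
              refine lintegral_mono_ae (h5.mono fun y' h6 => ?_)
              simp_rw [Real.exp_add, ENNReal.ofReal_mul (Real.exp_pos _).le]
              rw [lintegral_const_mul' _ _ ENNReal.ofReal_ne_top]
              exact mul_le_of_le_one_right' h6
          _ = _ := by simp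
    _ = 1 := by simp

theorem Good.lintegral_gibbs {t : ℝ} (ht : G.Good t) {f : X → Y → X → ℝ≥0∞}
    (hf : Measurable fun p : X × Y × X => f p.1 p.2.1 p.2.2) :
    ∫⁻ ω, f ω.1.1 ω.1.2 ω.2.1 ∂(G.gibbs t)
      = ∫⁻ x', ∫⁻ x, ENNReal.ofReal (Real.exp (G.b t x' x - G.z t x')) *
          ∫⁻ y', f x' y' x ∂(G.η x') ∂G.νX ∂G.P.fst := by
  have hf' : Measurable fun ω : (X × Y) × (X × Y) => f ω.1.1 ω.1.2 ω.2.1 :=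
    hf.comp (by fun_prop : Measurable fun ω : (X × Y) × (X × Y) => (ω.1.1, ω.1.2, ω.2.1))
  rw [gibbs, lintegral_withDensity_eq_lintegral_mul _ (by fun_prop) hf',
    G.lintegral_ref (Measurable.mul (by fun_prop) hf')]
  refine lintegral_congr_ae (ht.fin_a.mono fun x' h1 => ?_)
  refine lintegral_congr_ae (h1.mono fun x h2 => ?_)
  dsimp only
  rw [← lintegral_const_mul' _ _ ENNReal.ofReal_ne_top]
  refine lintegral_congr_ae (h2.mono fun y' h3 => ?_)
  dsimp only [Pi.mul_apply, F]
  rw [lintegral_mul_const _ (by fun_prop)]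
  congr 1
  simp_rw [Real.exp_add, ENNReal.ofReal_mul (Real.exp_pos _).le]
  rw [lintegral_const_mul' _ _ ENNReal.ofReal_ne_top]
  have := expInt_sub_logInt G.νY_ne_zero (f := G.e t x' y' x) (by fun_prop) h3
  rw [expInt] at this
  exact (congrArg _ this).trans (mul_one _)

theorem Good.gibbs_fst {t : ℝ} (ht : G.Good t) : (G.gibbs t).fst = G.P := by
  ext S hS
  rw [Measure.fst_apply hS, ← lintegral_indicator_one (hS.preimage measurable_fst)]
  have hm : Measurable (S.indicator (1 : X × Y → ℝ≥0∞)) := measurable_one.indicator hS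
  have h1 : ∀ ω : (X × Y) × (X × Y), (Prod.fst ⁻¹' S).indicator (1 : (X × Y) × (X × Y) → ℝ≥0∞) ω
      = S.indicator 1 (ω.1.1, ω.1.2) := fun ω => rfl
  simp_rw [h1]
  rw [ht.lintegral_gibbs (f := fun x' y' _ => S.indicator 1 (x', y')) (by fun_prop)]
  rw [← lintegral_indicator_one hS, G.lintegral_P hm]
  refine lintegral_congr_ae (ht.fin_z.mono fun x' h2 => ?_)
  dsimp only
  rw [lintegral_mul_const _ (by fun_prop)]
  have := expInt_sub_logInt G.νX_ne_zero (f := G.b t x') (by fun_prop) h2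
  rw [expInt] at this
  exact (congrArg (· * _) this).trans (one_mul _)

theorem Good.isProbabilityMeasure_gibbs {t : ℝ} (ht : G.Good t) :
    IsProbabilityMeasure (G.gibbs t) := by
  constructor
  rw [← Measure.fst_univ, ht.gibbs_fst, measure_univ]

theorem Good.causalLaw_gibbs {t : ℝ} (ht : G.Good t) : G.CausalLaw (G.gibbs t) := by
  have := ht.isProbabilityMeasure_gibbs
  have hm : Measurable fun ω : (X × Y) × (X × Y) => (ω.1.1, ω.2.1) := by fun_prop
  have hm' : Measurable fun ω : (X × Y) × (X × Y) => ((ω.1.1, ω.2.1), ω.1.2) := by fun_prop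
  refine Measure.ext_of_lintegral _ fun f hf => ?_
  have hm2 : Measurable fun p : X × X => ∫⁻ y', f (p, y') ∂(G.η p.1) :=
    Measurable.lintegral_kernel_prod_right' (κ := G.η.comap Prod.fst measurable_fst) hf
  have : IsFiniteMeasure ((G.gibbs t).map fun ω => (ω.1.1, ω.2.1)) := inferInstance
  rw [lintegral_map hf hm', Measure.lintegral_compProd hf, lintegral_map _ hm]
  · rw [ht.lintegral_gibbs (f := fun x' y' x => f ((x', x), y')) (by fun_prop),]
    have := ht.lintegral_gibbs (f := fun x' _ x => ∫⁻ y', f ((x', x), y') ∂(G.η x'))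
      (hm2.comp (by fun_prop : Measurable fun p : X × Y × X => (p.1, p.2.2)))
    refine Eq.trans ?_ this.symm
    simp
  · exact hm2

end GibbsModel

end CausalSDRO

namespace CausalSDRO

namespace GibbsModel

variable {X Y : Type*} [MeasurableSpace X] [MeasurableSpace Y] {G : GibbsModel X Y}

/-- `γ` is a plan with first marginal `P`, density `f`, and the causal conditional law. -/
structure IsPlan (G : GibbsModel X Y) (γ : Measure ((X × Y) × (X × Y)))
    (f : (X × Y) × (X × Y) → ℝ≥0∞) : Prop where
  measurable : Measurable f
  eq : γ = G.ref.withDensity f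
  fst : γ.fst = G.P
  law : G.CausalLaw γ

/-- Logarithm of the density plus transport cost. -/
noncomputable def kap (G : GibbsModel X Y) (f : (X × Y) × (X × Y) → ℝ≥0∞)
    (ω : (X × Y) × (X × Y)) : ℝ :=
  Real.log (f ω).toReal + G.c₁ ω.1.1 ω.2.1 + G.c₂ ω.1.2 ω.2.2

/-- Logarithm of the density relative to the Gibbs plan. -/
noncomputable def logRatio (G : GibbsModel X Y) (t : ℝ) (f : (X × Y) × (X × Y) → ℝ≥0∞)
    (ω : (X × Y) × (X × Y)) : ℝ :=
  Real.log (f ω).toReal - G.F t ω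

namespace IsPlan

variable {γ : Measure ((X × Y) × (X × Y))} {f : (X × Y) × (X × Y) → ℝ≥0∞}

theorem isProbabilityMeasure (h : G.IsPlan γ f) : IsProbabilityMeasure γ :=
  ⟨by rw [← Measure.fst_univ, h.fst, measure_univ]⟩

theorem ac (h : G.IsPlan γ f) : γ ≪ G.ref := by
  rw [h.eq]; exact withDensity_absolutelyContinuous _ _

theorem ae_ne_top (h : G.IsPlan γ f) : ∀ᵐ ω ∂G.ref, f ω ≠ ∞ := by
  have := h.isProbabilityMeasure
  have h1 : ∫⁻ ω, f ω ∂G.ref = 1 := by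
    rw [← setLIntegral_univ, ← withDensity_apply _ MeasurableSet.univ, ← h.eq, measure_univ]
  exact (ae_lt_top h.measurable (by rw [h1]; exact ENNReal.one_ne_top)).mono fun _ => ne_of_lt

theorem measurable_kap (h : G.IsPlan γ f) : Measurable (G.kap f) := by
  have := h.measurable
  unfold kap; fun_prop

theorem measurable_logRatio (h : G.IsPlan γ f) (t : ℝ) : Measurable (G.logRatio t f) := by
  have := h.measurable
  unfold logRatio; fun_prop

theorem lintegral_exp_sub_le (h : G.IsPlan γ f) {g : (X × Y) × (X × Y) → ℝ} (hg : Measurable g) :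
    ∫⁻ ω, ENNReal.ofReal (Real.exp (g ω - Real.log (f ω).toReal)) ∂γ ≤ expInt G.ref g := by
  have := lintegral_ofReal_sub_log_le h.measurable hg h.ae_ne_top
  rwa [← h.eq] at this

theorem integrable_comp_fst (h : G.IsPlan γ f) {g : X → ℝ} (hg : Integrable g G.P.fst) :
    Integrable (fun ω => g ω.1.1) γ := by
  have h1 : Integrable (fun q : X × Y => g q.1) γ.fst := by
    rw [h.fst]; exact hg.comp_measurable measurable_fst
  exact h1.comp_measurable measurable_fst

theorem integral_comp_fst (h : G.IsPlan γ f) {g : X → ℝ} (hg : Measurable g) :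
    ∫ ω, g ω.1.1 ∂γ = ∫ x', g x' ∂G.P.fst := by
  rw [← h.fst, Measure.fst, Measure.fst, Measure.map_map measurable_fst measurable_fst,
    integral_map (by fun_prop) hg.aestronglyMeasurable]
  rfl

theorem integrable_wY (h : G.IsPlan γ f) : Integrable (fun ω => G.wY ω.1.2) γ := by
  have h1 : Integrable (fun q : X × Y => G.wY q.2) γ.fst := by
    rw [h.fst]; exact G.integrable_wY
  exact h1.comp_measurable measurable_fst

theorem isCentered (h : G.IsPlan γ f) {s t v w : ℝ} (hs : G.Good s) (ht : G.Good t) :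
    IsCentered γ fun ω => v * (G.a s ω.1.1 ω.1.2 ω.2.1 - G.b s ω.1.1 ω.2.1)
      + w * (G.a t ω.1.1 ω.1.2 ω.2.1 - G.b t ω.1.1 ω.2.1) := by
  have := h.isProbabilityMeasure
  refine h.law.isCentered (D := fun x' y' x => v * (G.a s x' y' x - G.b s x' x)
    + w * (G.a t x' y' x - G.b t x' x)) (by fun_prop) ?_
  filter_upwards [h.ac.ae_le hs.ref_int_a, h.ac.ae_le ht.ref_int_a] with ω h1 h2
  have h3 : Integrable (fun y' => v * (G.a s ω.1.1 y' ω.2.1 - G.b s ω.1.1 ω.2.1)) (G.η ω.1.1) :=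
    (h1.sub (integrable_const (G.b s ω.1.1 ω.2.1))).const_mul v
  have h4 : Integrable (fun y' => w * (G.a t ω.1.1 y' ω.2.1 - G.b t ω.1.1 ω.2.1)) (G.η ω.1.1) :=
    (h2.sub (integrable_const (G.b t ω.1.1 ω.2.1))).const_mul w
  refine ⟨h3.add h4, ?_⟩
  rw [integral_add h3 h4, integral_const_mul, integral_const_mul,
    integral_sub h1 (integrable_const _), integral_sub h2 (integrable_const _)]
  simp [b]

theorem lintegral_neg_kap_ne_top (h : G.IsPlan γ f) :
    ∫⁻ ω, ENNReal.ofReal (-G.kap f ω) ∂γ ≠ ∞ := by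
  have := h.isProbabilityMeasure
  obtain ⟨C, hC, h1⟩ := G.tail₁
  obtain ⟨C', hC', h2⟩ := G.tail₂ 0 le_rfl zero_lt_one
  have h3 := lintegral_exp_add_le_one (G := G)
    (g₁ := fun x' x => -G.c₁ x' x + -(C * (1 + G.wX x')))
    (g₂ := fun _ y' _ y => (0 * G.c₂ y' y - G.c₂ y' y) / (1 - 0) + -(C' * (1 + G.wY y' + G.wY y')))
    (by fun_prop) (Filter.Eventually.of_forall fun x' => ?_)
    (Filter.Eventually.of_forall fun x' => Filter.Eventually.of_forall fun x =>
      Filter.Eventually.of_forall fun y' => ?_)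
  · have h4 := (lintegral_ofReal_le_lintegral_exp γ _).trans
      ((h.lintegral_exp_sub_le (by fun_prop)).trans h3)
    refine lintegral_ofReal_ne_top_of_le (w := fun ω => C * (1 + G.wX ω.1.1)
      + C' * (1 + G.wY ω.1.2 + G.wY ω.1.2)) ?_ (ne_top_of_le_ne_top ENNReal.one_ne_top h4) ?_
    · exact (((integrable_const _).add (h.integrable_comp_fst G.integrable_wX_fst)).const_mul C).add
        ((((integrable_const _).add h.integrable_wY).add h.integrable_wY).const_mul C')
    · refine Filter.Eventually.of_forall fun ω => ?_
      refine le_trans (le_of_eq ?_) (add_le_add_left (le_max_left _ 0) _)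
      unfold kap
      ring
  · rw [expInt_add_const, Real.exp_neg, ENNReal.ofReal_inv_of_pos (Real.exp_pos _)]
    exact ENNReal.div_le_of_le_mul (by rw [one_mul]; exact h1 x')
  · rw [expInt_add_const, Real.exp_neg, ENNReal.ofReal_inv_of_pos (Real.exp_pos _)]
    exact ENNReal.div_le_of_le_mul (by rw [one_mul]; exact h2 y' y')

/-- The basic entropy identity. -/
theorem entropy_identity (h : G.IsPlan γ f) {t : ℝ} (ht : G.Good t)
    (hψ : ∫⁻ ω, ENNReal.ofReal (-(t * G.ψ ω.2)) ∂γ ≠ ∞) (hk : Integrable (G.kap f) γ) :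
    Integrable (G.logRatio t f) γ ∧ Integrable (fun ω => t * G.ψ ω.2) γ ∧
      ∫ ω, G.logRatio t f ω ∂γ + ∫ ω, t * G.ψ ω.2 ∂γ = ∫ ω, G.kap f ω ∂γ + G.K t := by
  have hF : expInt G.ref (G.F t) = 1 := by
    have := ht.isProbabilityMeasure_gibbs
    rw [← measure_univ (μ := G.gibbs t), gibbs, withDensity_apply _ MeasurableSet.univ,
      setLIntegral_univ, expInt]
  have hu : ∫⁻ ω, ENNReal.ofReal (-G.logRatio t f ω) ∂γ ≠ ∞ := by
    refine ne_top_of_le_ne_top (b := 1) ENNReal.one_ne_top ?_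
    refine le_trans (le_of_eq (lintegral_congr fun ω => ?_))
      ((lintegral_ofReal_le_lintegral_exp γ _).trans
        ((h.lintegral_exp_sub_le (g := G.F t) (by fun_prop)).trans hF.le))
    rw [logRatio, neg_sub]
  have hz := h.integrable_comp_fst ht.int_z
  have := (h.isCentered (v := 1) (w := 0) ht ht).integrable_of_add_eq
    (p := G.logRatio t f) (q := fun ω => t * G.ψ ω.2) (w := fun ω => G.kap f ω + G.z t ω.1.1)
    (h.measurable_logRatio t).aemeasurable (by fun_prop) hu hψ (hk.add hz)
    (Filter.Eventually.of_forall fun ω => by unfold logRatio kap F e; ring)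
  refine ⟨this.1, this.2.1, this.2.2.trans ?_⟩
  rw [integral_add hk hz, h.integral_comp_fst (by fun_prop)]
  rfl

theorem integrable_exp_neg_logRatio (h : G.IsPlan γ f) {t : ℝ} (ht : G.Good t)
    {U : Set ((X × Y) × (X × Y))} (hU : MeasurableSet U) {τ : ℝ} (hτ : 0 ≤ τ) :
    Integrable (fun ω => Real.exp (U.indicator (fun _ => τ) ω - G.logRatio t f ω)) γ ∧
      ∫ ω, Real.exp (U.indicator (fun _ => τ) ω - G.logRatio t f ω) ∂γ
        ≤ 1 + (Real.exp τ - 1) * (G.gibbs t).real U := by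
  have := ht.isProbabilityMeasure_gibbs
  have hUm : Measurable (U.indicator fun _ => τ) := measurable_const.indicator hU
  have h1 := h.lintegral_exp_sub_le (g := fun ω => U.indicator (fun _ => τ) ω + G.F t ω)
    (by fun_prop)
  have h2 : expInt G.ref (fun ω => U.indicator (fun _ => τ) ω + G.F t ω)
      = ENNReal.ofReal (1 + (Real.exp τ - 1) * (G.gibbs t).real U) := by
    have h3 : expInt G.ref (fun ω => U.indicator (fun _ => τ) ω + G.F t ω)
        = ∫⁻ ω, ENNReal.ofReal (Real.exp (U.indicator (fun _ => τ) ω)) ∂(G.gibbs t) := by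
      rw [gibbs, lintegral_withDensity_eq_lintegral_mul _ (by fun_prop) (by fun_prop)]
      refine lintegral_congr fun ω => ?_
      rw [Pi.mul_apply, ← ENNReal.ofReal_mul (Real.exp_pos _).le, ← Real.exp_add, add_comm]
    have h4 : ∀ ω, Real.exp (U.indicator (fun _ => τ) ω)
        = 1 + U.indicator (fun _ => Real.exp τ - 1) ω := by
      intro ω
      by_cases hω : ω ∈ U <;> simp [hω]
    have h5 : Integrable (fun ω => 1 + U.indicator (fun _ => Real.exp τ - 1) ω) (G.gibbs t) :=
      (integrable_const _).add ((integrable_const _).indicator hU)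
    rw [h3]
    simp_rw [h4]
    rw [← ofReal_integral_eq_lintegral_ofReal h5, integral_add (integrable_const _)
      ((integrable_const _).indicator hU), integral_indicator_const _ hU]
    · simp [mul_comm]
    · refine Filter.Eventually.of_forall fun ω => ?_
      exact le_of_le_of_eq (Real.exp_pos _).le (h4 ω)
  have h6 : ∀ ω, U.indicator (fun _ => τ) ω + G.F t ω - Real.log (f ω).toReal
      = U.indicator (fun _ => τ) ω - G.logRatio t f ω := fun ω => by unfold logRatio; ring
  simp_rw [h6] at h1
  rw [h2] at h1
  have hm : Measurable fun ω => Real.exp (U.indicator (fun _ => τ) ω - G.logRatio t f ω) := by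
    have := h.measurable_logRatio t
    fun_prop
  have hi : Integrable (fun ω => Real.exp (U.indicator (fun _ => τ) ω - G.logRatio t f ω)) γ :=
    integrable_of_lintegral_ofReal hm.aemeasurable (ne_top_of_le_ne_top ENNReal.ofReal_ne_top h1)
      (by simp [ENNReal.ofReal_of_nonpos, (Real.exp_pos _).le])
  refine ⟨hi, ?_⟩
  rw [← ofReal_integral_eq_lintegral_ofReal hi
    (Filter.Eventually.of_forall fun ω => (Real.exp_pos _).le),
    ENNReal.ofReal_le_ofReal_iff] at h1
  · exact h1
  · have : 0 ≤ Real.exp τ - 1 := by linarith [Real.add_one_le_exp τ]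
    positivity

/-- A one-sided transport-entropy inequality for the probabilities of a set. -/
theorem mul_measure_le (h : G.IsPlan γ f) {t : ℝ} (ht : G.Good t)
    (hi : Integrable (G.logRatio t f) γ) {U : Set ((X × Y) × (X × Y))} (hU : MeasurableSet U)
    {τ : ℝ} (hτ : 0 ≤ τ) :
    τ * γ.real U ≤ (Real.exp τ - 1) * (G.gibbs t).real U + ∫ ω, G.logRatio t f ω ∂γ := by
  have := h.isProbabilityMeasure
  obtain ⟨h1, h2⟩ := h.integrable_exp_neg_logRatio ht hU hτ
  have hind : Integrable (U.indicator fun _ => τ) γ := (integrable_const _).indicator hU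
  have hsub : Integrable (fun ω => U.indicator (fun _ => τ) ω - G.logRatio t f ω) γ := hind.sub hi
  have h3 := integral_mono (hsub.add (integrable_const (1 : ℝ))) h1
    fun ω => Real.add_one_le_exp (U.indicator (fun _ => τ) ω - G.logRatio t f ω)
  have h4 : ∫ ω, (U.indicator (fun _ => τ) ω - G.logRatio t f ω + 1) ∂γ
      = τ * γ.real U - ∫ ω, G.logRatio t f ω ∂γ + 1 := by
    rw [integral_add hsub (integrable_const _), integral_sub hind hi,
      integral_indicator_const _ hU]
    simp [mul_comm]
  have h5 := h4 ▸ (h3.trans h2)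
  linarith

theorem integral_logRatio_nonneg (h : G.IsPlan γ f) {t : ℝ} (ht : G.Good t)
    (hi : Integrable (G.logRatio t f) γ) : 0 ≤ ∫ ω, G.logRatio t f ω ∂γ := by
  simpa using h.mul_measure_le ht hi MeasurableSet.empty le_rfl

theorem logRatio_ae_eq_zero (h : G.IsPlan γ f) {t : ℝ} (ht : G.Good t)
    (hi : Integrable (G.logRatio t f) γ) (h0 : ∫ ω, G.logRatio t f ω ∂γ = 0) :
    ∀ᵐ ω ∂γ, G.logRatio t f ω = 0 := by
  have := h.isProbabilityMeasure
  obtain ⟨h1, h2⟩ := h.integrable_exp_neg_logRatio ht MeasurableSet.empty le_rfl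
  simp only [Set.indicator_empty, zero_sub, Real.exp_zero, sub_self, zero_mul, add_zero] at h1 h2
  have h3 : Integrable (fun ω => Real.exp (-G.logRatio t f ω) - 1 + G.logRatio t f ω) γ :=
    (h1.sub (integrable_const _)).add hi
  have hnn : ∀ ω, 0 ≤ Real.exp (-G.logRatio t f ω) - 1 + G.logRatio t f ω := fun ω => by
    linarith [Real.add_one_le_exp (-G.logRatio t f ω)]
  have h4 : ∫ ω, (Real.exp (-G.logRatio t f ω) - 1 + G.logRatio t f ω) ∂γ = 0 := by
    refine le_antisymm ?_ (integral_nonneg hnn)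
    have h5 : Integrable (fun ω => Real.exp (-G.logRatio t f ω) - 1) γ :=
      h1.sub (integrable_const _)
    rw [integral_add h5 hi, integral_sub h1 (integrable_const _), h0]
    simp only [integral_const, probReal_univ, smul_eq_mul]
    linarith
  rw [integral_eq_zero_iff_of_nonneg hnn h3] at h4
  filter_upwards [h4] with ω hω
  by_contra hne
  have := Real.add_one_lt_exp (neg_ne_zero.2 hne)
  simp only [Pi.zero_apply] at hω
  linarith

end IsPlan

theorem Good.isPlan_gibbs {t : ℝ} (ht : G.Good t) :
    G.IsPlan (G.gibbs t) fun ω => ENNReal.ofReal (Real.exp (G.F t ω)) :=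
  ⟨by fun_prop, rfl, ht.gibbs_fst, ht.causalLaw_gibbs⟩

end GibbsModel

/-- Probability measures satisfying the limiting transport-entropy inequality are equal. -/
theorem eq_of_mul_measure_le {α : Type*} [MeasurableSpace α] {P Q : Measure α}
    [IsProbabilityMeasure P] [IsProbabilityMeasure Q]
    (h : ∀ U, MeasurableSet U → ∀ τ : ℝ, 0 < τ → τ * P.real U ≤ (Real.exp τ - 1) * Q.real U) :
    P = Q := by
  have hle : ∀ U, MeasurableSet U → P.real U ≤ Q.real U := by
    intro U hU
    have h1 : Filter.Tendsto (fun τ : ℝ => (Real.exp τ - 1) / τ * Q.real U)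
        (nhdsWithin 0 (Set.Ioi 0)) (nhds (1 * Q.real U)) := by
      refine Filter.Tendsto.mul_const _ ?_
      have h2 := (Real.hasDerivAt_exp 0)
      rw [hasDerivAt_iff_tendsto_slope, Real.exp_zero] at h2
      refine (h2.mono_left (nhdsWithin_mono _ fun x hx => ne_of_gt hx)).congr fun τ => ?_
      rw [slope_def_field, Real.exp_zero, sub_zero]
    rw [one_mul] at h1
    refine ge_of_tendsto h1 ?_
    filter_upwards [self_mem_nhdsWithin] with τ hτ
    have hτ' : 0 < τ := hτ
    have := h U hU τ hτ'
    rw [div_mul_eq_mul_div, le_div_iff₀ hτ', mul_comm]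
    exact this
  ext U hU
  have h1 := hle U hU
  have h2 := hle Uᶜ hU.compl
  rw [probReal_compl_eq_one_sub hU, probReal_compl_eq_one_sub hU] at h2
  have h3 : P.real U = Q.real U := le_antisymm h1 (by linarith)
  rw [Measure.real, Measure.real,
    ENNReal.toReal_eq_toReal_iff' (measure_ne_top _ _) (measure_ne_top _ _)] at h3
  exact h3

end CausalSDRO

namespace CausalSDRO

namespace GibbsModel

variable {X Y : Type*} [MeasurableSpace X] [MeasurableSpace Y] {G : GibbsModel X Y}

/-- Comparison of the log-partition functions at two nominal points. -/
theorem exists_a_comparison (G : GibbsModel X Y) {θ : ℝ} (hθ0 : 0 ≤ θ) (hθ1 : θ < 1) :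
    ∃ C, 0 ≤ C ∧ ∀ t x' x y₁ y₂, expInt G.νY (G.e t x' y₁ x) ≠ ∞ →
      G.a (θ * t) x' y₂ x + G.c₁ x' x
        ≤ θ * (G.a t x' y₁ x + G.c₁ x' x) + C * (1 + G.wY y₁ + G.wY y₂) := by
  obtain ⟨C, hC, h⟩ := G.tail₂ θ hθ0 hθ1
  refine ⟨(1 - θ) * C, mul_nonneg (by linarith) hC, fun t x' x y₁ y₂ hfin => ?_⟩
  have hθ : 0 < 1 - θ := by linarith
  set g : Y → ℝ := fun u => (θ * G.c₂ y₁ u - G.c₂ y₂ u) / (1 - θ) with hg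
  have hgm : Measurable g := by fun_prop
  have h1 : G.e (θ * t) x' y₂ x = fun y => (θ * G.e t x' y₁ x y + (1 - θ) * g y)
      + (θ - 1) * G.c₁ x' x := by
    funext y
    rw [hg]
    dsimp only
    rw [mul_div_cancel₀ _ hθ.ne']
    unfold e
    ring
  have hgfin : expInt G.νY g ≠ ∞ := ne_top_of_le_ne_top ENNReal.ofReal_ne_top (h y₁ y₂)
  have h2 : logInt G.νY g ≤ C * (1 + G.wY y₁ + G.wY y₂) := logInt_le G.νY_ne_zero hgm (h y₁ y₂)
  have h3 := expInt_convexComb_le_exp G.νY_ne_zero (f := G.e t x' y₁ x) (by fun_prop) hgm hθ0 hθ.le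
    (by ring) hfin hgfin
  have h4 : G.a (θ * t) x' y₂ x ≤ (θ * G.a t x' y₁ x + (1 - θ) * logInt G.νY g)
      + (θ - 1) * G.c₁ x' x := by
    refine logInt_le G.νY_ne_zero (by fun_prop) ?_
    rw [h1, expInt_add_const, Real.exp_add, ENNReal.ofReal_mul (Real.exp_pos _).le]
    exact mul_le_mul_left h3 _
  have h5 := mul_le_mul_of_nonneg_left h2 hθ.le
  linarith

theorem exists_b_comparison (G : GibbsModel X Y) {θ : ℝ} (hθ0 : 0 ≤ θ) (hθ1 : θ < 1) :
    ∃ C, 0 ≤ C ∧ ∀ t x' x y₁, expInt G.νY (G.e t x' y₁ x) ≠ ∞ → Integrable G.wY (G.η x') →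
      Integrable (fun y' => G.a (θ * t) x' y' x) (G.η x') →
      G.b (θ * t) x' x + G.c₁ x' x
        ≤ θ * (G.a t x' y₁ x + G.c₁ x' x) + C * (1 + G.wY y₁ + G.mY x') := by
  obtain ⟨C, hC, h⟩ := G.exists_a_comparison hθ0 hθ1
  refine ⟨C, hC, fun t x' x y₁ hfin hw hi => ?_⟩
  have h2 : Integrable (fun y' => 1 + G.wY y₁ + G.wY y') (G.η x') := (integrable_const _).add hw
  have h1 := integral_mono (hi.add (integrable_const (G.c₁ x' x)))
    ((integrable_const (θ * (G.a t x' y₁ x + G.c₁ x' x))).add (h2.const_mul C))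
    fun y₂ => h t x' x y₁ y₂ hfin
  have h3 : ∫ y', (G.a (θ * t) x' y' x + G.c₁ x' x) ∂(G.η x')
      = G.b (θ * t) x' x + G.c₁ x' x := by
    rw [integral_add hi (integrable_const _)]; simp [b]
  have h4 : ∫ y', (θ * (G.a t x' y₁ x + G.c₁ x' x) + C * (1 + G.wY y₁ + G.wY y')) ∂(G.η x')
      = θ * (G.a t x' y₁ x + G.c₁ x' x) + C * (1 + G.wY y₁ + G.mY x') := by
    rw [integral_add (integrable_const _) (h2.const_mul C), integral_const_mul C,
      integral_add (integrable_const _) hw]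
    simp [mY]
  calc _ = ∫ y', (G.a (θ * t) x' y' x + G.c₁ x' x) ∂(G.η x') := h3.symm
    _ ≤ _ := h1
    _ = _ := h4

theorem Good.integrable_posPart {t : ℝ} (ht : G.Good t) {g : (X × Y) × (X × Y) → ℝ}
    (hg : Measurable g) (h : expInt G.ref g ≤ 1) :
    Integrable (fun ω => max (g ω - G.F t ω) 0) (G.gibbs t) := by
  have h1 := (lintegral_ofReal_le_lintegral_exp (G.gibbs t) _).trans
    ((ht.isPlan_gibbs.lintegral_exp_sub_le hg).trans h)
  simp only [ENNReal.toReal_ofReal (Real.exp_pos _).le, Real.log_exp] at h1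
  refine integrable_of_lintegral_ofReal (by fun_prop) ?_ ?_
  · refine ne_top_of_le_ne_top ENNReal.one_ne_top (le_trans (le_of_eq ?_) h1)
    refine lintegral_congr fun ω => ?_
    rcases le_total (g ω - G.F t ω) 0 with h2 | h2 <;> simp [h2]
  · simp [ENNReal.ofReal_of_nonpos]

theorem Good.expInt_e_sub_a {t : ℝ} (ht : G.Good t) :
    ∀ᵐ x' ∂G.P.fst, ∀ᵐ x ∂G.νX, ∀ᵐ y' ∂(G.η x'),
      expInt G.νY (fun y => G.e t x' y' x y - G.a t x' y' x) ≤ 1 :=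
  ht.fin_a.mono fun _ h1 => h1.mono fun _ h2 => h2.mono fun _ h3 =>
    (expInt_sub_logInt G.νY_ne_zero (by fun_prop) h3).le

theorem Good.expInt_b_sub_z {t : ℝ} (ht : G.Good t) :
    ∀ᵐ x' ∂G.P.fst, expInt G.νX (fun x => G.b t x' x - G.z t x') ≤ 1 :=
  ht.fin_z.mono fun _ h => (expInt_sub_logInt G.νX_ne_zero (by fun_prop) h).le

theorem Good.lintegral_neg_ψ_ne_top {t t₁ : ℝ} (ht₁ : G.Good t₁) (h0 : 0 < t) (h1 : t < t₁) :
    ∫⁻ ω, ENNReal.ofReal (-(t * G.ψ ω.2)) ∂(G.gibbs t) ≠ ∞ := by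
  have ht := ht₁.of_le h0.le h1.le
  have hhalf := ht.of_le (s := 1 / 2 * t) (by positivity) (by linarith)
  have hzero := G.good_zero
  have hP := ht.isPlan_gibbs
  have := hP.isProbabilityMeasure
  obtain ⟨C, hC, hcmp⟩ := G.exists_b_comparison (θ := 1 / 2) (by norm_num) (by norm_num)
  obtain ⟨C₀, hC₀, ha0⟩ := G.exists_expInt_e_zero_le
  obtain ⟨C₁, hC₁, htail⟩ := G.tail₁
  have i1 := ht.integrable_posPart
    (g := fun ω => (G.b t ω.1.1 ω.2.1 - G.z t ω.1.1)
      + (G.e 0 ω.1.1 ω.1.2 ω.2.1 ω.2.2 - G.a 0 ω.1.1 ω.1.2 ω.2.1)) (by fun_prop)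
    (lintegral_exp_add_le_one (g₁ := fun x' x => G.b t x' x - G.z t x')
      (g₂ := fun x' y' x y => G.e 0 x' y' x y - G.a 0 x' y' x) (by fun_prop)
      ht.expInt_b_sub_z hzero.expInt_e_sub_a)
  have i2 := ht.integrable_posPart
    (g := fun ω => (G.b t₁ ω.1.1 ω.2.1 - G.z t₁ ω.1.1)
      + (G.e t ω.1.1 ω.1.2 ω.2.1 ω.2.2 - G.a t ω.1.1 ω.1.2 ω.2.1)) (by fun_prop)
    (lintegral_exp_add_le_one (g₁ := fun x' x => G.b t₁ x' x - G.z t₁ x')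
      (g₂ := fun x' y' x y => G.e t x' y' x y - G.a t x' y' x) (by fun_prop)
      ht₁.expInt_b_sub_z ht.expInt_e_sub_a)
  have i3 := ht.integrable_posPart
    (g := fun ω => (-G.c₁ ω.1.1 ω.2.1 + -(C₁ * (1 + G.wX ω.1.1)))
      + (G.e t ω.1.1 ω.1.2 ω.2.1 ω.2.2 - G.a t ω.1.1 ω.1.2 ω.2.1)) (by fun_prop)
    (lintegral_exp_add_le_one (g₁ := fun x' x => -G.c₁ x' x + -(C₁ * (1 + G.wX x')))
      (g₂ := fun x' y' x y => G.e t x' y' x y - G.a t x' y' x) (by fun_prop)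
      (Filter.Eventually.of_forall fun x' => by
        rw [expInt_add_const, Real.exp_neg, ENNReal.ofReal_inv_of_pos (Real.exp_pos _)]
        exact ENNReal.div_le_of_le_mul (by rw [one_mul]; exact htail x')) ht.expInt_e_sub_a)
  -- `t = v * (t / 2) + w * t₁`
  set w : ℝ := (t / 2) / (t₁ - t / 2) with hw
  set v : ℝ := (t₁ - t) / (t₁ - t / 2) with hv
  have hd : 0 < t₁ - t / 2 := by linarith
  have hv0 : 0 < v := div_pos (by linarith) hd
  have hw0 : 0 < w := div_pos (by linarith) hd
  have hvw : v + w = 1 := by rw [hv, hw, ← add_div, div_eq_one_iff_eq hd.ne']; ring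
  have hcomb : v * (1 / 2 * t) + w * t₁ = t := by
    rw [hv, hw, div_mul_eq_mul_div (t₁ - t), div_mul_eq_mul_div (t / 2), ← add_div,
      div_eq_iff hd.ne']
    ring
  have iX := hP.integrable_comp_fst G.integrable_wX_fst
  have iM := hP.integrable_comp_fst G.integrable_mY
  have iY := hP.integrable_wY
  have iz := hP.integrable_comp_fst ht.int_z
  have iz1 := hP.integrable_comp_fst ht₁.int_z
  have hint := (((i1.add ((i2.add (iz1.sub iz)).const_mul (2 * w / v))).add
    ((i3.add (iz.neg.add (((integrable_const (1 : ℝ)).add iX).const_mul C₁))).const_mul 2)).add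
    (((integrable_const (1 : ℝ)).add (iY.const_mul 2)).const_mul C₀)).add
    ((((integrable_const (1 : ℝ)).add iY).add iM).const_mul (2 * C))
  refine ne_top_of_le_ne_top (lintegral_ofReal_ne_top hint) (lintegral_mono_ae ?_)
  filter_upwards [hP.ac.ae_le ht.ref_fin_a, hP.ac.ae_le ht₁.ref_fin_a_ae,
    hP.ac.ae_le hhalf.ref_fin_a_ae, hP.ac.ae_le hhalf.ref_int_a, hP.ac.ae_le ht.ref_int_a,
    hP.ac.ae_le ht₁.ref_int_a, hP.ac.ae_le (G.ae_ref_of_ae₁ G.integrable_wY_ae)]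
    with ω f1 f2 f3 j1 j2 j3 j4
  apply ENNReal.ofReal_le_ofReal
  simp only [Pi.add_apply, Pi.sub_apply, Pi.neg_apply]
  have k1 := hcmp t ω.1.1 ω.2.1 ω.1.2 f1 j4 j1
  have k2 := b_convexComb_le hv0.le hw0.le hvw f3 f2 j1 j3 (by rw [hcomb]; exact j2)
  rw [hcomb] at k2
  have k3 : G.a 0 ω.1.1 ω.1.2 ω.2.1 ≤ C₀ * (1 + 2 * G.wY ω.1.2) - G.c₁ ω.1.1 ω.2.1 :=
    logInt_le G.νY_ne_zero (by fun_prop) (ha0 _ _ _)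
  have l1 := le_max_left (G.b t ω.1.1 ω.2.1 - G.z t ω.1.1
      + (G.e 0 ω.1.1 ω.1.2 ω.2.1 ω.2.2 - G.a 0 ω.1.1 ω.1.2 ω.2.1) - G.F t ω) 0
  have l2 := le_max_left (G.b t₁ ω.1.1 ω.2.1 - G.z t₁ ω.1.1
      + (G.e t ω.1.1 ω.1.2 ω.2.1 ω.2.2 - G.a t ω.1.1 ω.1.2 ω.2.1) - G.F t ω) 0
  have l3 := le_max_left (-G.c₁ ω.1.1 ω.2.1 + -(C₁ * (1 + G.wX ω.1.1))
      + (G.e t ω.1.1 ω.1.2 ω.2.1 ω.2.2 - G.a t ω.1.1 ω.1.2 ω.2.1) - G.F t ω) 0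
  set m1 := max (G.b t ω.1.1 ω.2.1 - G.z t ω.1.1
      + (G.e 0 ω.1.1 ω.1.2 ω.2.1 ω.2.2 - G.a 0 ω.1.1 ω.1.2 ω.2.1) - G.F t ω) 0
  set m2 := max (G.b t₁ ω.1.1 ω.2.1 - G.z t₁ ω.1.1
      + (G.e t ω.1.1 ω.1.2 ω.2.1 ω.2.2 - G.a t ω.1.1 ω.1.2 ω.2.1) - G.F t ω) 0
  set m3 := max (-G.c₁ ω.1.1 ω.2.1 + -(C₁ * (1 + G.wX ω.1.1))
      + (G.e t ω.1.1 ω.1.2 ω.2.1 ω.2.2 - G.a t ω.1.1 ω.1.2 ω.2.1) - G.F t ω) 0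
  have l1' : -(t * G.ψ ω.2) - G.a 0 ω.1.1 ω.1.2 ω.2.1 + G.a t ω.1.1 ω.1.2 ω.2.1 ≤ m1 := by
    refine le_trans (le_of_eq ?_) l1
    unfold F e; ring
  have l2' : G.b t₁ ω.1.1 ω.2.1 - G.b t ω.1.1 ω.2.1
      ≤ m2 + (G.z t₁ ω.1.1 - G.z t ω.1.1) := by
    have : G.b t₁ ω.1.1 ω.2.1 - G.b t ω.1.1 ω.2.1 - (G.z t₁ ω.1.1 - G.z t ω.1.1) ≤ m2 := by
      refine le_trans (le_of_eq ?_) l2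
      unfold F e; ring
    linarith
  have l3' : -(G.b t ω.1.1 ω.2.1 + G.c₁ ω.1.1 ω.2.1)
      ≤ m3 + (-G.z t ω.1.1 + C₁ * (1 + G.wX ω.1.1)) := by
    have : -(G.b t ω.1.1 ω.2.1 + G.c₁ ω.1.1 ω.2.1) - (-G.z t ω.1.1 + C₁ * (1 + G.wX ω.1.1))
        ≤ m3 := by
      refine le_trans (le_of_eq ?_) l3
      unfold F e; ring
    linarith
  -- divide the convexity inequality by `v`
  have k2' : G.b t ω.1.1 ω.2.1 + G.c₁ ω.1.1 ω.2.1
      - w / v * (G.b t₁ ω.1.1 ω.2.1 - G.b t ω.1.1 ω.2.1)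
      ≤ G.b (1 / 2 * t) ω.1.1 ω.2.1 + G.c₁ ω.1.1 ω.2.1 := by
    have h3 : (G.b t ω.1.1 ω.2.1 - w * G.b t₁ ω.1.1 ω.2.1) / v ≤ G.b (1 / 2 * t) ω.1.1 ω.2.1 := by
      rw [div_le_iff₀ hv0]; linarith
    have h4 : (G.b t ω.1.1 ω.2.1 - w * G.b t₁ ω.1.1 ω.2.1) / v
        = G.b t ω.1.1 ω.2.1 - w / v * (G.b t₁ ω.1.1 ω.2.1 - G.b t ω.1.1 ω.2.1) := by
      rw [show w = 1 - v by linarith]; field_simp; ring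
    linarith
  have l2'' := mul_le_mul_of_nonneg_left l2' (by positivity : 0 ≤ 2 * w / v)
  have e1 : 2 * w / v * (G.b t₁ ω.1.1 ω.2.1 - G.b t ω.1.1 ω.2.1)
      = 2 * (w / v * (G.b t₁ ω.1.1 ω.2.1 - G.b t ω.1.1 ω.2.1)) := by ring
  rw [e1] at l2''
  linarith

/-- Under the Gibbs plan the loss and the entropic cost are integrable, as soon as the partition
functions are finite for a larger inverse multiplier. -/
theorem Good.gibbs_integrable {t t₁ : ℝ} (ht₁ : G.Good t₁) (h0 : 0 < t) (h1 : t < t₁) :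
    Integrable (fun ω => G.ψ ω.2) (G.gibbs t) ∧
      Integrable (G.kap fun ω => ENNReal.ofReal (Real.exp (G.F t ω))) (G.gibbs t) ∧
      ∫ ω, G.kap (fun ω => ENNReal.ofReal (Real.exp (G.F t ω))) ω ∂(G.gibbs t)
        = t * ∫ ω, G.ψ ω.2 ∂(G.gibbs t) - G.K t := by
  have ht := ht₁.of_le h0.le h1.le
  have hP := ht.isPlan_gibbs
  have := hP.isProbabilityMeasure
  have hneg := ht₁.lintegral_neg_ψ_ne_top h0 h1
  have hd : 0 < t₁ - t := by linarith
  have hF₁ : expInt G.ref (G.F t₁) ≤ 1 :=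
    lintegral_exp_add_le_one (g₁ := fun x' x => G.b t₁ x' x - G.z t₁ x')
      (g₂ := fun x' y' x y => G.e t₁ x' y' x y - G.a t₁ x' y' x) (by fun_prop)
      ht₁.expInt_b_sub_z ht₁.expInt_e_sub_a
  have hneg' : ∫⁻ ω, ENNReal.ofReal (-((t₁ - t) * G.ψ ω.2)) ∂(G.gibbs t) ≠ ∞ := by
    have h2 : ∀ ω : (X × Y) × (X × Y), ENNReal.ofReal (-((t₁ - t) * G.ψ ω.2))
        = ENNReal.ofReal ((t₁ - t) / t) * ENNReal.ofReal (-(t * G.ψ ω.2)) := fun ω => by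
      rw [← ENNReal.ofReal_mul (by positivity)]
      congr 1
      field_simp
    simp_rw [h2]
    rw [lintegral_const_mul' _ _ ENNReal.ofReal_ne_top]
    exact ENNReal.mul_ne_top ENNReal.ofReal_ne_top hneg
  have hu : ∫⁻ ω, ENNReal.ofReal (-(G.F t ω - G.F t₁ ω)) ∂(G.gibbs t) ≠ ∞ := by
    have := lintegral_ofReal_ne_top (ht.integrable_posPart (g := G.F t₁) (by fun_prop) hF₁)
    refine ne_top_of_le_ne_top this (lintegral_mono fun ω => ENNReal.ofReal_le_ofReal ?_)
    rw [neg_sub]; exact le_max_left _ _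
  have iz := hP.integrable_comp_fst ht.int_z
  have iz1 := hP.integrable_comp_fst ht₁.int_z
  have hψ := ((hP.isCentered (v := 1) (w := -1) ht₁ ht).integrable_of_add_eq
    (p := fun ω => G.F t ω - G.F t₁ ω) (q := fun ω => (t₁ - t) * G.ψ ω.2)
    (w := fun ω => G.z t₁ ω.1.1 - G.z t ω.1.1) (by fun_prop) (by fun_prop) hu hneg'
    (iz1.sub iz) (Filter.Eventually.of_forall fun ω => by unfold F e; ring)).2.1
  have hψ' : Integrable (fun ω => G.ψ ω.2) (G.gibbs t) := by
    refine (hψ.const_mul (t₁ - t)⁻¹).congr (Filter.Eventually.of_forall fun ω => ?_)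
    exact inv_mul_cancel_left₀ hd.ne' _
  have hk := (hP.isCentered (v := -1) (w := 0) ht ht).integrable_of_add_eq
    (p := G.kap fun ω => ENNReal.ofReal (Real.exp (G.F t ω))) (q := fun ω => -(t * G.ψ ω.2))
    (w := fun ω => -G.z t ω.1.1) hP.measurable_kap.aemeasurable (by fun_prop)
    hP.lintegral_neg_kap_ne_top (lintegral_ofReal_neg_ne_top (hψ'.const_mul t).neg)
    iz.neg (Filter.Eventually.of_forall fun ω => by
      simp only [kap, ENNReal.toReal_ofReal (Real.exp_pos _).le, Real.log_exp]
      unfold F e; ring)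
  refine ⟨hψ', hk.1, ?_⟩
  have h3 := hk.2.2
  rw [integral_neg, integral_const_mul, integral_neg, hP.integral_comp_fst (by fun_prop)] at h3
  change _ = -G.K t at h3
  linarith

end GibbsModel

end CausalSDRO

namespace CausalSDRO

section ConvexDiff

variable {α : Type*} [MeasurableSpace α] {μ : Measure α}

theorem convexOn_integral_of_ae {F : ℝ → α → ℝ} {I : Set ℝ} (hI : Convex ℝ I)
    (hint : ∀ s ∈ I, Integrable (F s) μ) (hconv : ∀ᵐ a ∂μ, ConvexOn ℝ I fun s => F s a) :
    ConvexOn ℝ I fun s => ∫ a, F s a ∂μ := by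
  refine ⟨hI, fun s hs t ht v w hv hw hvw => ?_⟩
  simp only [smul_eq_mul]
  rw [← integral_const_mul, ← integral_const_mul,
    ← integral_add ((hint s hs).const_mul v) ((hint t ht).const_mul w)]
  refine integral_mono_ae (hint _ (hI hs ht hv hw hvw))
    (((hint s hs).const_mul v).add ((hint t ht).const_mul w)) ?_
  filter_upwards [hconv] with a ha
  exact ha.2 hs ht hv hw hvw

theorem logInt_eq_log_integral {f : α → ℝ} (hf : Measurable f) :
    logInt μ f = Real.log (∫ a, Real.exp (f a) ∂μ) := by
  rw [logInt, expInt, integral_eq_lintegral_of_nonneg_ae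
    (Filter.Eventually.of_forall fun a => (Real.exp_pos _).le) (by fun_prop)]

theorem integrable_exp_of_expInt_ne_top {f : α → ℝ} (hf : Measurable f) (h : expInt μ f ≠ ∞) :
    Integrable (fun a => Real.exp (f a)) μ :=
  integrable_of_lintegral_ofReal (by fun_prop) h
    (by simp [ENNReal.ofReal_of_nonpos, (Real.exp_pos _).le])

/-- Convexity and differentiability of a log-partition function whose exponent is convex and
differentiable in the parameter. -/
theorem logInt_convexOn_differentiableAt (hμ : μ ≠ 0) {f : ℝ → α → ℝ} {t δ : ℝ} (hδ : 0 < δ)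
    (hm : ∀ s, Measurable (f s)) (hl : expInt μ (f (t - δ)) ≠ ∞) (hr : expInt μ (f (t + δ)) ≠ ∞)
    (hconv : ∀ᵐ a ∂μ, ConvexOn ℝ (Set.Icc (t - δ) (t + δ)) fun s => f s a)
    (hdiff : ∀ᵐ a ∂μ, DifferentiableAt ℝ (fun s => f s a) t) :
    ConvexOn ℝ (Set.Icc (t - δ) (t + δ)) (fun s => logInt μ (f s)) ∧
      DifferentiableAt ℝ (fun s => logInt μ (f s)) t := by
  have hle : t - δ ≤ t + δ := by linarith
  have key : ∀ s ∈ Set.Icc (t - δ) (t + δ), ∀ s' ∈ Set.Icc (t - δ) (t + δ),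
      expInt μ (f s) ≠ ∞ → expInt μ (f s') ≠ ∞ → ∀ v w : ℝ, 0 ≤ v → 0 ≤ w → v + w = 1 →
      expInt μ (f (v * s + w * s'))
        ≤ ENNReal.ofReal (Real.exp (v * logInt μ (f s) + w * logInt μ (f s'))) := by
    intro s hs s' hs' h1 h2 v w hv hw hvw
    refine le_trans (expInt_mono ?_)
      (expInt_convexComb_le_exp hμ (hm s) (hm s') hv hw hvw h1 h2)
    filter_upwards [hconv] with a ha
    exact ha.2 hs hs' hv hw hvw
  have hfin : ∀ s ∈ Set.Icc (t - δ) (t + δ), expInt μ (f s) ≠ ∞ := by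
    intro s hs
    have h1 := key (t - δ) (Set.left_mem_Icc.2 hle) (t + δ) (Set.right_mem_Icc.2 hle) hl hr
      ((t + δ - s) / (2 * δ)) ((s - (t - δ)) / (2 * δ))
      (div_nonneg (by linarith [hs.2]) (by linarith)) (div_nonneg (by linarith [hs.1]) (by linarith))
      (by field_simp; ring)
    have h2 : (t + δ - s) / (2 * δ) * (t - δ) + (s - (t - δ)) / (2 * δ) * (t + δ) = s := by
      field_simp; ring
    rw [h2] at h1
    exact ne_top_of_le_ne_top ENNReal.ofReal_ne_top h1
  refine ⟨⟨convex_Icc _ _, fun s hs s' hs' v w hv hw hvw => ?_⟩, ?_⟩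
  · exact logInt_le hμ (hm _) (key s hs s' hs' (hfin s hs) (hfin s' hs') v w hv hw hvw)
  · have ht : t ∈ Set.Icc (t - δ) (t + δ) := ⟨by linarith, by linarith⟩
    have hi : ∀ s ∈ Set.Icc (t - δ) (t + δ), Integrable (fun a => Real.exp (f s a)) μ :=
      fun s hs => integrable_exp_of_expInt_ne_top (hm s) (hfin s hs)
    have h1 := (differentiableAt_integral_of_convexOn (μ := μ)
      (F := fun s a => Real.exp (f s a)) hδ (fun s hs => (hi s hs).1)
      (hi _ (Set.left_mem_Icc.2 hle)) (hi t ht) (hi _ (Set.right_mem_Icc.2 hle))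
      (by
        filter_upwards [hconv] with a ha
        refine ⟨convex_Icc _ _, fun s hs s' hs' v w hv hw hvw => ?_⟩
        exact (Real.exp_le_exp.2 (ha.2 hs hs' hv hw hvw)).trans
          (convexOn_exp.2 (Set.mem_univ _) (Set.mem_univ _) hv hw hvw))
      (hdiff.mono fun a ha => ha.exp)).2
    have h2 : (fun s => logInt μ (f s)) = fun s => Real.log (∫ a, Real.exp (f s a) ∂μ) := by
      funext s; exact logInt_eq_log_integral (hm s)
    rw [h2]
    refine h1.log (ne_of_gt ?_)
    have := ENNReal.toReal_pos (expInt_ne_zero hμ (hm t)) (hfin t ht)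
    rwa [expInt, ← integral_eq_lintegral_of_nonneg_ae
      (Filter.Eventually.of_forall fun a => (Real.exp_pos _).le) (hi t ht).1] at this

end ConvexDiff

namespace GibbsModel

variable {X Y : Type*} [MeasurableSpace X] [MeasurableSpace Y] {G : GibbsModel X Y}

/-- The Gibbs plan provides a supporting line of the mean log-partition function. -/
theorem Good.support_line {t t₁ s : ℝ} (ht₁ : G.Good t₁) (h0 : 0 < t) (h1 : t < t₁)
    (hs : G.Good s) :
    G.K t + (s - t) * ∫ ω, G.ψ ω.2 ∂(G.gibbs t) ≤ G.K s ∧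
      (G.K t + (s - t) * ∫ ω, G.ψ ω.2 ∂(G.gibbs t) = G.K s →
        ∀ᵐ ω ∂G.ref, G.F t ω = G.F s ω) := by
  have ht := ht₁.of_le h0.le h1.le
  obtain ⟨hψ, hk, hk'⟩ := ht₁.gibbs_integrable h0 h1
  have hP := ht.isPlan_gibbs
  obtain ⟨i1, -, i3⟩ := hP.entropy_identity hs
    (lintegral_ofReal_neg_ne_top (hψ.const_mul s)) hk
  rw [integral_const_mul, hk'] at i3
  have i4 := hP.integral_logRatio_nonneg hs i1
  refine ⟨by linarith, fun heq => ?_⟩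
  have i5 := hP.logRatio_ae_eq_zero hs i1 (by linarith)
  rw [gibbs, ae_withDensity_iff (by fun_prop)] at i5
  filter_upwards [i5] with ω hω
  have := hω (by simp [Real.exp_pos])
  simp only [logRatio, ENNReal.toReal_ofReal (Real.exp_pos _).le, Real.log_exp] at this
  linarith

theorem ae_eq_const_of_F_eq {s t : ℝ} (hs : G.Good s) (ht : G.Good t) (hst : s ≠ t)
    (h : ∀ᵐ ω ∂G.ref, G.F t ω = G.F s ω) : ∃ C : ℝ, ∀ᵐ q ∂(G.νX.prod G.νY), G.ψ q = C := by
  have h1 : ∀ᵐ q ∂G.P, ∀ᵐ r ∂(G.νX.prod G.νY), G.F t (q, r) = G.F s (q, r) :=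
    Measure.ae_ae_of_ae_prod h
  rw [← G.disint] at h1
  have h2 := Measure.ae_ae_of_ae_compProd h1
  obtain ⟨x', h3, h4, h5⟩ := (h2.and (hs.int_a.and ht.int_a)).exists
  have h6 : ∀ᵐ r ∂(G.νX.prod G.νY), ∀ᵐ y' ∂(G.η x'), G.F t ((x', y'), r) = G.F s ((x', y'), r) :=
    (Measure.ae_ae_comm (measurableSet_eq_fun
      (f := fun p : Y × (X × Y) => G.F t ((x', p.1), p.2))
      (g := fun p : Y × (X × Y) => G.F s ((x', p.1), p.2)) (by fun_prop) (by fun_prop))).1 h3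
  have h4' : ∀ᵐ r ∂(G.νX.prod G.νY), Integrable (fun y' => G.a s x' y' r.1) (G.η x') :=
    Measure.quasiMeasurePreserving_fst.ae h4
  have h5' : ∀ᵐ r ∂(G.νX.prod G.νY), Integrable (fun y' => G.a t x' y' r.1) (G.η x') :=
    Measure.quasiMeasurePreserving_fst.ae h5
  refine ⟨(G.z t x' - G.z s x') / (t - s), ?_⟩
  filter_upwards [h6, h4', h5'] with r h7 h8 h9
  have hts : t - s ≠ 0 := sub_ne_zero.2 hst.symm
  have h10 : ∫ y', (G.a t x' y' r.1 - G.a s x' y' r.1) ∂(G.η x')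
      = ∫ _, (G.b t x' r.1 - G.b s x' r.1 + (t - s) * G.ψ r - (G.z t x' - G.z s x')) ∂(G.η x') := by
    refine integral_congr_ae (h7.mono fun y' h11 => ?_)
    simp only [F, e] at h11
    linarith
  rw [integral_sub h9 h8] at h10
  simp only [integral_const, probReal_univ, one_smul] at h10
  rw [eq_div_iff hts]
  change G.b t x' r.1 - G.b s x' r.1 = _ at h10
  linarith

/-- Strict convexity of the mean log-partition function. -/
theorem K_strictConvex (hne : ¬ ∃ C : ℝ, ∀ᵐ q ∂(G.νX.prod G.νY), G.ψ q = C) {s t v w : ℝ}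
    (hs : G.Good s) (ht : G.Good t) (hs0 : 0 < s) (hst : s < t) (hv : 0 < v) (hw : 0 < w)
    (hvw : v + w = 1) : G.K (v * s + w * t) < v * G.K s + w * G.K t := by
  have ht0 : 0 < t := hs0.trans hst
  have hm0 : 0 < v * s + w * t := by positivity
  have e1 : v * s + w * t = t - v * (t - s) := by linear_combination t * hvw
  have e2 : v * s + w * t = s + w * (t - s) := by linear_combination s * hvw
  have hmt : v * s + w * t < t := by
    rw [e1]; linarith [mul_pos hv (sub_pos.2 hst)]
  have hsm : s < v * s + w * t := by
    rw [e2]; linarith [mul_pos hw (sub_pos.2 hst)]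
  have hm := ht.of_le hm0.le hmt.le
  obtain ⟨l1, l2⟩ := ht.support_line hm0 hmt hs
  obtain ⟨l3, -⟩ := ht.support_line hm0 hmt ht
  have l4 := lt_of_le_of_ne l1 fun heq => hne (ae_eq_const_of_F_eq hs hm hsm.ne (l2 heq))
  set I := ∫ ω, G.ψ ω.2 ∂(G.gibbs (v * s + w * t))
  have l5 := mul_lt_mul_of_pos_left l4 hv
  have l6 := mul_le_mul_of_nonneg_left l3 hw.le
  have l7 : v * (G.K (v * s + w * t) + (s - (v * s + w * t)) * I)
      + w * (G.K (v * s + w * t) + (t - (v * s + w * t)) * I) = G.K (v * s + w * t) := by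
    linear_combination (G.K (v * s + w * t) - (v * s + w * t) * I) * hvw
  linarith

theorem e_convexOn (x' : X) (y' : Y) (x : X) (y : Y) (I : Set ℝ) (hI : Convex ℝ I) :
    ConvexOn ℝ I fun s => G.e s x' y' x y := by
  refine ⟨hI, fun s _ t _ v w _ _ hvw => ?_⟩
  simp only [smul_eq_mul, e_convexComb hvw, le_refl]

/-- Differentiability of the mean log-partition function. -/
theorem K_differentiableAt {t δ : ℝ} (hδ : 0 < δ) (hl : G.Good (t - δ)) (hr : G.Good (t + δ))
    (hl0 : 0 ≤ t - δ) : DifferentiableAt ℝ G.K t := by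
  have ht := hr.of_le (s := t) (by linarith) (by linarith)
  have ha : ∀ x' x y', expInt G.νY (G.e (t - δ) x' y' x) ≠ ∞ →
      expInt G.νY (G.e (t + δ) x' y' x) ≠ ∞ →
      ConvexOn ℝ (Set.Icc (t - δ) (t + δ)) (fun s => G.a s x' y' x) ∧
        DifferentiableAt ℝ (fun s => G.a s x' y' x) t := by
    intro x' x y' h1 h2
    refine logInt_convexOn_differentiableAt G.νY_ne_zero hδ (fun s => by fun_prop) h1 h2
      (Filter.Eventually.of_forall fun y => e_convexOn x' y' x y _ (convex_Icc _ _))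
      (Filter.Eventually.of_forall fun y => ?_)
    unfold e; fun_prop
  have hb : ∀ᵐ x' ∂G.P.fst, ∀ᵐ x ∂G.νX,
      ConvexOn ℝ (Set.Icc (t - δ) (t + δ)) (fun s => G.b s x' x) ∧
        DifferentiableAt ℝ (fun s => G.b s x' x) t := by
    filter_upwards [hl.fin_a, hr.fin_a, hl.int_a, hr.int_a, ht.int_a] with x' h1 h2 h3 h4 h5
    filter_upwards [h1, h2, h3, h4, h5] with x h6 h7 h8 h9 h10
    have hab : ∀ᵐ y' ∂(G.η x'), ConvexOn ℝ (Set.Icc (t - δ) (t + δ)) (fun s => G.a s x' y' x) ∧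
        DifferentiableAt ℝ (fun s => G.a s x' y' x) t := by
      filter_upwards [h6, h7] with y' h11 h12
      exact ha x' x y' h11 h12
    obtain ⟨h13, h14⟩ := differentiableAt_integral_of_convexOn (μ := G.η x')
      (F := fun s y' => G.a s x' y' x) hδ
      (fun s _ => Measurable.aestronglyMeasurable (by fun_prop)) h8 h10 h9
      (hab.mono fun _ h => h.1) (hab.mono fun _ h => h.2)
    exact ⟨convexOn_integral_of_ae (convex_Icc _ _) h13 (hab.mono fun _ h => h.1), h14⟩
  have hz : ∀ᵐ x' ∂G.P.fst, ConvexOn ℝ (Set.Icc (t - δ) (t + δ)) (fun s => G.z s x') ∧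
        DifferentiableAt ℝ (fun s => G.z s x') t := by
    filter_upwards [hb, hl.fin_z, hr.fin_z] with x' h1 h2 h3
    exact logInt_convexOn_differentiableAt G.νX_ne_zero hδ (fun s => by fun_prop) h2 h3
      (h1.mono fun _ h => h.1) (h1.mono fun _ h => h.2)
  exact (differentiableAt_integral_of_convexOn (μ := G.P.fst) (F := G.z) hδ
    (fun s _ => Measurable.aestronglyMeasurable (by fun_prop)) hl.int_z ht.int_z hr.int_z
    (hz.mono fun _ h => h.1) (hz.mono fun _ h => h.2)).2

/-- At a differentiability point, the derivative is the mean loss under the Gibbs plan. -/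
theorem Good.hasDerivAt_K {t δ : ℝ} (hr : G.Good (t + δ)) (hδ : 0 < δ) (hl0 : 0 < t - δ) :
    HasDerivAt G.K (∫ ω, G.ψ ω.2 ∂(G.gibbs t)) t := by
  have hl := hr.of_le hl0.le (by linarith)
  have hd := (K_differentiableAt hδ hl hr hl0.le).hasDerivAt
  set m := ∫ ω, G.ψ ω.2 ∂(G.gibbs t) with hm
  have hmin : IsLocalMin (fun s => G.K s - s * m) t := by
    filter_upwards [Icc_mem_nhds (show t - δ < t by linarith) (show t < t + δ by linarith)] with s hs
    have := (hr.support_line (t := t) (by linarith) (by linarith)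
      (hr.of_le (s := s) (by linarith [hs.1]) hs.2)).1
    rw [← hm] at this
    linarith
  have hd2 : HasDerivAt (fun s => G.K s - s * m) (deriv G.K t - 1 * m) t :=
    hd.sub ((hasDerivAt_id t).mul_const m)
  have := hmin.hasDerivAt_eq_zero hd2
  have h3 : deriv G.K t = m := by linarith
  rwa [h3] at hd

end GibbsModel

end CausalSDRO

namespace CausalSDRO

section Expectation

variable {α : Type*} [MeasurableSpace α] {μ : Measure α}

theorem eexpect_congr_ae {f g : α → EReal} (h : f =ᵐ[μ] g) : eexpect μ f = eexpect μ g := by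
  unfold eexpect
  rw [lintegral_congr_ae (h.mono fun a ha => by simp only [ha] :
      (fun a => (f a).toENNReal) =ᵐ[μ] fun a => (g a).toENNReal),
    lintegral_congr_ae (h.mono fun a ha => by simp only [ha] :
      (fun a => (-f a).toENNReal) =ᵐ[μ] fun a => (-g a).toENNReal)]

theorem eexpect_mono_ae {f g : α → EReal} (h : ∀ᵐ a ∂μ, f a ≤ g a) :
    eexpect μ f ≤ eexpect μ g := by
  unfold eexpect
  refine EReal.sub_le_sub ?_ ?_
  · exact EReal.coe_ennreal_le_coe_ennreal_iff.2
      (lintegral_mono_ae (h.mono fun a ha => EReal.toENNReal_le_toENNReal ha))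
  · exact EReal.coe_ennreal_le_coe_ennreal_iff.2
      (lintegral_mono_ae (h.mono fun a ha =>
        EReal.toENNReal_le_toENNReal (EReal.neg_le_neg_iff.2 ha)))

theorem toENNReal_coe_real (x : ℝ) : (x : EReal).toENNReal = ENNReal.ofReal x := by
  rw [EReal.toENNReal_of_ne_top (EReal.coe_ne_top x), EReal.toReal_coe]

theorem eexpect_coe {f : α → ℝ} (hf : Integrable f μ) :
    eexpect μ (fun a => (f a : EReal)) = ((∫ a, f a ∂μ : ℝ) : EReal) := by
  unfold eexpect
  simp_rw [← EReal.coe_neg, toENNReal_coe_real]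
  rw [integral_eq_lintegral_pos_part_sub_lintegral_neg_part hf, EReal.coe_sub]
  congr 1
  · exact (EReal.coe_ennreal_toReal (lintegral_ofReal_ne_top hf)).symm
  · exact (EReal.coe_ennreal_toReal (lintegral_ofReal_neg_ne_top hf)).symm

theorem lintegral_neg_ne_top_of_eexpect_ne_bot {f : α → EReal} (h : eexpect μ f ≠ ⊥) :
    ∫⁻ a, (-f a).toENNReal ∂μ ≠ ∞ := by
  intro h'
  apply h
  rw [eexpect, h', EReal.coe_ennreal_top, EReal.sub_top]

theorem exists_integrable_of_eexpect_ne_top {f : α → EReal} (hf : AEMeasurable f μ)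
    (hneg : ∫⁻ a, (-f a).toENNReal ∂μ ≠ ∞) (h : eexpect μ f ≠ ⊤) :
    (∀ᵐ a ∂μ, f a = ((f a).toReal : EReal)) ∧ Integrable (fun a => (f a).toReal) μ := by
  have hpos : ∫⁻ a, (f a).toENNReal ∂μ ≠ ∞ := by
    intro h'
    apply h
    rw [eexpect, h', EReal.coe_ennreal_top, ← ENNReal.coe_toNNReal hneg]
    rfl
  have h1 := ae_lt_top' hf.ereal_toENNReal hpos
  have h2 := ae_lt_top' hf.neg.ereal_toENNReal hneg
  have h3 : ∀ᵐ a ∂μ, f a = ((f a).toReal : EReal) := by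
    filter_upwards [h1, h2] with a h1 h2
    refine (EReal.coe_toReal ?_ ?_).symm
    · intro h; rw [h] at h1; simp at h1
    · intro h
      simp only [Pi.neg_apply, h] at h2; simp at h2
  refine ⟨h3, integrable_of_lintegral_ofReal hf.ereal_toReal ?_ ?_⟩
  · rwa [lintegral_congr_ae (h3.mono fun a ha => ?_ :
      (fun a => ENNReal.ofReal (f a).toReal) =ᵐ[μ] fun a => (f a).toENNReal)]
    dsimp only
    conv_rhs => rw [ha, toENNReal_coe_real]
  · rwa [lintegral_congr_ae (h3.mono fun a ha => ?_ :
      (fun a => ENNReal.ofReal (-(f a).toReal)) =ᵐ[μ] fun a => (-f a).toENNReal)]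
    dsimp only
    conv_rhs => rw [ha, ← EReal.coe_neg, toENNReal_coe_real]

theorem eexpect_eq_coe_of_ae {f : α → EReal} {g : α → ℝ} (hg : Integrable g μ)
    (h : ∀ᵐ a ∂μ, f a = (g a : EReal)) : eexpect μ f = ((∫ a, g a ∂μ : ℝ) : EReal) := by
  rw [eexpect_congr_ae h, eexpect_coe hg]

theorem lintegral_neg_ne_top_of_ae_le {f : α → EReal} {l : α → ℝ} (hl : Integrable l μ)
    (h : ∀ᵐ a ∂μ, (l a : EReal) ≤ f a) : ∫⁻ a, (-f a).toENNReal ∂μ ≠ ∞ := by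
  refine ne_top_of_le_ne_top (lintegral_ofReal_neg_ne_top hl) (lintegral_mono_ae ?_)
  filter_upwards [h] with a ha
  rw [← toENNReal_coe_real, EReal.coe_neg]
  exact EReal.toENNReal_le_toENNReal (EReal.neg_le_neg_iff.2 ha)

theorem tendsto_eexpect_of_monotone {f : ℕ → α → EReal} {F : α → EReal} {l : α → ℝ}
    (hf : ∀ n, AEMeasurable (f n) μ) (hmono : ∀ᵐ a ∂μ, Monotone fun n => f n a)
    (hl : Integrable l μ) (h0 : ∀ᵐ a ∂μ, (l a : EReal) ≤ f 0 a)
    (hlim : ∀ᵐ a ∂μ, Filter.Tendsto (fun n => f n a) Filter.atTop (nhds (F a))) :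
    Filter.Tendsto (fun n => eexpect μ (f n)) Filter.atTop (nhds (eexpect μ F)) := by
  have hneg0 : ∀ n, ∫⁻ a, (-f n a).toENNReal ∂μ ≠ ∞ := fun n => by
    refine lintegral_neg_ne_top_of_ae_le hl ?_
    filter_upwards [h0, hmono] with a h1 h2
    exact h1.trans (h2 (Nat.zero_le n))
  have hnegF : ∫⁻ a, (-F a).toENNReal ∂μ ≠ ∞ := by
    refine lintegral_neg_ne_top_of_ae_le hl ?_
    filter_upwards [h0, hmono, hlim] with a h1 h2 h3
    exact h1.trans (h2.ge_of_tendsto h3 0)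
  have hp : Filter.Tendsto (fun n => ∫⁻ a, (f n a).toENNReal ∂μ) Filter.atTop
      (nhds (∫⁻ a, (F a).toENNReal ∂μ)) :=
    lintegral_tendsto_of_tendsto_of_monotone (fun n => (hf n).ereal_toENNReal)
      (hmono.mono fun a ha n m hnm => EReal.toENNReal_le_toENNReal (ha hnm))
      (hlim.mono fun a ha => (EReal.continuous_toENNReal.tendsto _).comp ha)
  have hn : Filter.Tendsto (fun n => ∫⁻ a, (-f n a).toENNReal ∂μ) Filter.atTop
      (nhds (∫⁻ a, (-F a).toENNReal ∂μ)) :=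
    lintegral_tendsto_of_tendsto_of_antitone (fun n => (hf n).neg.ereal_toENNReal)
      (hmono.mono fun a ha n m hnm =>
        EReal.toENNReal_le_toENNReal (EReal.neg_le_neg_iff.2 (ha hnm))) (hneg0 0)
      (hlim.mono fun a ha => ((EReal.continuous_toENNReal.comp continuous_neg).tendsto _).comp ha)
  unfold eexpect
  simp_rw [sub_eq_add_neg]
  have hc := (EReal.continuousAt_add
    (p := (((∫⁻ a, (F a).toENNReal ∂μ : ℝ≥0∞) : EReal),
      -((∫⁻ a, (-F a).toENNReal ∂μ : ℝ≥0∞) : EReal)))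
    (Or.inr (by simpa using hnegF)) (Or.inl (by simp))).tendsto
  refine hc.comp (Filter.Tendsto.prodMk_nhds ?_ ?_)
  · exact (continuous_coe_ennreal_ereal.tendsto _).comp hp
  · exact ((continuous_neg.comp continuous_coe_ennreal_ereal).tendsto _).comp hn

end Expectation

end CausalSDRO

namespace CausalSDRO

theorem GibbsModel.isCausal_iff_causalLaw {X Y : Type*} [MeasurableSpace X] [MeasurableSpace Y]
    [StandardBorelSpace X] [Nonempty X] [StandardBorelSpace Y] [Nonempty Y]
    (G : GibbsModel X Y) {γ : Measure ((X × Y) × (X × Y))} [IsProbabilityMeasure γ]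
    (h : γ.fst = G.P) : IsCausal γ ↔ G.CausalLaw γ := by
  have hg : Measurable fun ω : (X × Y) × (X × Y) => ω.2.1 := by fun_prop
  have hf : Measurable fun ω : (X × Y) × (X × Y) => ω.1.2 := by fun_prop
  have hk : Measurable fun ω : (X × Y) × (X × Y) => ω.1.1 := by fun_prop
  have hkg : Measurable fun ω : (X × Y) × (X × Y) => (ω.1.1, ω.2.1) := by fun_prop
  have hmapk : γ.map (fun ω => ω.1.1) = G.P.fst := by
    rw [← h, Measure.fst, Measure.fst, Measure.map_map measurable_fst measurable_fst]
    rfl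
  have hcd : condDistrib (fun ω : (X × Y) × (X × Y) => ω.1.2) (fun ω => ω.1.1) γ
      =ᵐ[γ.map fun ω => ω.1.1] G.η := by
    rw [condDistrib_ae_eq_iff_measure_eq_compProd _ hf.aemeasurable, hmapk, G.disint, ← h]
    rfl
  have hcd' : (condDistrib (fun ω : (X × Y) × (X × Y) => ω.1.2) (fun ω => ω.1.1) γ).prodMkRight X
      =ᵐ[γ.map fun ω => (ω.1.1, ω.2.1)] (G.η.comap Prod.fst measurable_fst : Kernel (X × X) Y) := by
    have h1 : γ.map (fun ω => ω.1.1) = (γ.map fun ω => (ω.1.1, ω.2.1)).map Prod.fst := by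
      rw [Measure.map_map measurable_fst hkg]
      rfl
    rw [h1] at hcd
    exact ae_of_ae_map measurable_fst.aemeasurable hcd
  have h1 := condIndepFun_iff_condExp_inter_preimage_eq_mul (m' := MeasurableSpace.comap
    (fun ω : (X × Y) × (X × Y) => ω.1.1) inferInstance) (hm' := hk.comap_le) (μ := γ) hg hf
  have h2 := condIndepFun_iff_condDistrib_prod_ae_eq_prodMkRight (μ := γ) hf hg hk
  unfold IsCausal
  rw [← h1, h2]
  unfold CausalLaw
  rw [← condDistrib_ae_eq_iff_measure_eq_compProd _ hf.aemeasurable]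
  exact ⟨fun h => h.trans hcd', fun h => h.trans hcd'.symm⟩

end CausalSDRO

namespace CausalSDRO

theorem exists_add_rpow_le {p κ : ℝ} (hp : 1 ≤ p) (hκ : 1 < κ) :
    ∃ C, 0 ≤ C ∧ ∀ a b : ℝ, 0 ≤ a → 0 ≤ b → (a + b) ^ p ≤ κ * a ^ p + C * b ^ p := by
  have hc : ContinuousAt (fun s : ℝ => s ^ (1 - p)) 1 :=
    Real.continuousAt_rpow_const 1 (1 - p) (Or.inl one_ne_zero)
  have h1 : ∀ᶠ s : ℝ in nhdsWithin 1 (Set.Iio 1), s ^ (1 - p) < κ := by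
    refine (hc.tendsto.mono_left nhdsWithin_le_nhds).eventually_lt_const ?_
    simpa using hκ
  have h2 : ∀ᶠ s : ℝ in nhdsWithin 1 (Set.Iio 1), 0 < s :=
    nhdsWithin_le_nhds (lt_mem_nhds one_pos)
  obtain ⟨s, ⟨hs1, hs0⟩, hsl⟩ := ((h1.and h2).and self_mem_nhdsWithin).exists
  have hsl : s < 1 := hsl
  have hs' : 0 < 1 - s := by linarith
  refine ⟨(1 - s) ^ (1 - p), by positivity, fun a b ha hb => ?_⟩
  have h3 := (convexOn_rpow hp).2 (x := a / s) (y := b / (1 - s)) (by positivity : 0 ≤ a / s)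
    (by positivity : 0 ≤ b / (1 - s)) hs0.le hs'.le (by ring)
  simp only [smul_eq_mul] at h3
  rw [mul_div_cancel₀ _ hs0.ne', mul_div_cancel₀ _ hs'.ne', Real.div_rpow ha hs0.le,
    Real.div_rpow hb hs'.le] at h3
  have e1 : s * (a ^ p / s ^ p) = s ^ (1 - p) * a ^ p := by
    rw [Real.rpow_sub hs0, Real.rpow_one]; ring
  have e2 : (1 - s) * (b ^ p / (1 - s) ^ p) = (1 - s) ^ (1 - p) * b ^ p := by
    rw [Real.rpow_sub hs', Real.rpow_one]; ring
  rw [e1, e2] at h3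
  have : s ^ (1 - p) * a ^ p ≤ κ * a ^ p := by gcongr
  linarith

theorem norm_sub_rpow_le {V : Type*} [NormedAddCommGroup V] {p κ C : ℝ} (hp : 1 ≤ p)
    (h : ∀ a b : ℝ, 0 ≤ a → 0 ≤ b → (a + b) ^ p ≤ κ * a ^ p + C * b ^ p) (u v : V) :
    ‖u - v‖ ^ p ≤ κ * ‖u‖ ^ p + C * ‖v‖ ^ p :=
  (Real.rpow_le_rpow (norm_nonneg _) (norm_sub_le u v) (by linarith)).trans
    (h _ _ (norm_nonneg _) (norm_nonneg _))

theorem exists_norm_sub_rpow_sub_le {V : Type*} [NormedAddCommGroup V] {p θ : ℝ} (hp : 1 ≤ p)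
    (hθ : 0 ≤ θ) (hθ' : θ < 1) : ∃ δ C, 0 < δ ∧ 0 ≤ C ∧ ∀ u v w : V,
      θ * ‖u - v‖ ^ p - ‖u - w‖ ^ p ≤ -δ * ‖u‖ ^ p + C * (‖v‖ ^ p + ‖w‖ ^ p) := by
  obtain ⟨κ, hκ1, hκ2⟩ : ∃ κ : ℝ, 1 < κ ∧ θ * κ < κ⁻¹ := by
    refine ⟨Real.sqrt (2 / (1 + θ)), Real.lt_sqrt_of_sq_lt ?_, ?_⟩
    · rw [lt_div_iff₀ (by linarith)]; linarith
    · have h0 : 0 < 2 / (1 + θ) := by positivity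
      have h1 : 0 < Real.sqrt (2 / (1 + θ)) := Real.sqrt_pos.2 h0
      rw [← one_div, lt_div_iff₀ h1, mul_assoc, Real.mul_self_sqrt h0.le, mul_div_assoc',
        div_lt_one (by linarith)]
      linarith
  have hκ0 : 0 < κ := by linarith
  obtain ⟨C, hC, h⟩ := exists_add_rpow_le hp hκ1
  refine ⟨κ⁻¹ - θ * κ, C, by linarith, hC, fun u v w => ?_⟩
  have h1 := mul_le_mul_of_nonneg_left (norm_sub_rpow_le hp h u v) hθ
  have h2 := mul_le_mul_of_nonneg_left (norm_sub_rpow_le hp h (u - w) (-w)) (inv_pos.2 hκ0).le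
  rw [sub_neg_eq_add, sub_add_cancel, norm_neg, mul_add, inv_mul_cancel_left₀ hκ0.ne'] at h2
  have h3 : θ * (C * ‖v‖ ^ p) ≤ C * ‖v‖ ^ p := mul_le_of_le_one_left (by positivity) hθ'.le
  have h4 : κ⁻¹ * (C * ‖w‖ ^ p) ≤ C * ‖w‖ ^ p :=
    mul_le_of_le_one_left (by positivity) (inv_le_one_of_one_le₀ hκ1.le)
  linarith

section Subtype

variable {V : Type*} [NormedAddCommGroup V] [MeasurableSpace V] {S : Set V} {ν : Measure S} {p : ℝ}

theorem sigmaFinite_of_tail [OpensMeasurableSpace V]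
    (h : ∫⁻ u, ENNReal.ofReal (Real.exp (-1 * ‖(u : V)‖ ^ p)) ∂ν < ∞) : SigmaFinite ν := by
  have hm : Measurable fun u : S => ENNReal.ofReal (Real.exp (-1 * ‖(u : V)‖ ^ p)) := by fun_prop
  have h1 : IsFiniteMeasure (ν.withDensity fun u => ENNReal.ofReal (Real.exp (-1 * ‖(u : V)‖ ^ p))) :=
    isFiniteMeasure_withDensity h.ne
  have h2 : ν = (ν.withDensity fun u => ENNReal.ofReal (Real.exp (-1 * ‖(u : V)‖ ^ p))).withDensity
      fun u => (ENNReal.ofReal (Real.exp (-1 * ‖(u : V)‖ ^ p)))⁻¹ :=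
    (withDensity_inv_same hm (Filter.Eventually.of_forall fun u => by simp [Real.exp_pos])
      (Filter.Eventually.of_forall fun u => ENNReal.ofReal_ne_top)).symm
  rw [h2]
  refine SigmaFinite.withDensity_of_ne_top (Filter.Eventually.of_forall fun u => ?_)
  simp [Real.exp_pos]

theorem exists_expInt_cost_le (hp : 1 ≤ p) {ε : ℝ} (hε : 0 < ε)
    (h : ∀ δ : ℝ, 0 < δ → ∫⁻ u, ENNReal.ofReal (Real.exp (-δ * ‖(u : V)‖ ^ p)) ∂ν < ∞)
    {θ : ℝ} (hθ : 0 ≤ θ) (hθ' : θ < 1) : ∃ C, 0 ≤ C ∧ ∀ y y' : S,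
      expInt ν (fun u => (θ * (‖(u : V) - y‖ ^ p / ε) - ‖(u : V) - y'‖ ^ p / ε) / (1 - θ))
        ≤ ENNReal.ofReal (Real.exp (C * (1 + ‖(y : V)‖ ^ p + ‖(y' : V)‖ ^ p))) := by
  obtain ⟨δ, C, hδ, hC, hb⟩ := exists_norm_sub_rpow_sub_le (V := V) hp hθ hθ'
  have h1 : 0 < 1 - θ := by linarith
  have hT := h (δ / (ε * (1 - θ))) (by positivity)
  set T := ∫⁻ u, ENNReal.ofReal (Real.exp (-(δ / (ε * (1 - θ))) * ‖(u : V)‖ ^ p)) ∂ν with hTdef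
  have hTle : T ≤ ENNReal.ofReal (Real.exp T.toReal) := by
    rw [← ENNReal.ofReal_toReal hT.ne]
    refine ENNReal.ofReal_le_ofReal ?_
    rw [ENNReal.toReal_ofReal ENNReal.toReal_nonneg]
    linarith [Real.add_one_le_exp T.toReal]
  refine ⟨T.toReal + C / (ε * (1 - θ)), by positivity, fun y y' => ?_⟩
  have h2 : ∀ u : S, (θ * (‖(u : V) - y‖ ^ p / ε) - ‖(u : V) - y'‖ ^ p / ε) / (1 - θ)
      ≤ -(δ / (ε * (1 - θ))) * ‖(u : V)‖ ^ p
        + C / (ε * (1 - θ)) * (‖(y : V)‖ ^ p + ‖(y' : V)‖ ^ p) := fun u => by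
    have h3 := div_le_div_of_nonneg_right (hb u y y') (by positivity : 0 ≤ ε * (1 - θ))
    calc _ = (θ * ‖(u : V) - y‖ ^ p - ‖(u : V) - y'‖ ^ p) / (ε * (1 - θ)) := by
          field_simp
      _ ≤ _ := h3
      _ = _ := by field_simp
  refine (expInt_mono (Filter.Eventually.of_forall h2)).trans ?_
  rw [expInt_add_const]
  refine (mul_le_mul_left (hTle : expInt _ _ ≤ _) _).trans ?_
  rw [← ENNReal.ofReal_mul (Real.exp_pos _).le, ← Real.exp_add]
  refine ENNReal.ofReal_le_ofReal (Real.exp_le_exp.2 ?_)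
  have h4 : 0 ≤ T.toReal := ENNReal.toReal_nonneg
  have h5 : 0 ≤ ‖(y : V)‖ ^ p := by positivity
  have h6 : 0 ≤ ‖(y' : V)‖ ^ p := by positivity
  have h7 : 0 ≤ C / (ε * (1 - θ)) := by positivity
  nlinarith [mul_nonneg h4 h5, mul_nonneg h4 h6]

end Subtype

end CausalSDRO

namespace CausalSDRO

set_option linter.unusedSectionVars false

variable {E F G : Type*}
  [NormedAddCommGroup E] [NormedSpace ℝ E] [FiniteDimensional ℝ E]
  [MeasurableSpace E] [BorelSpace E]
  [NormedAddCommGroup F] [NormedSpace ℝ F] [FiniteDimensional ℝ F]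
  [MeasurableSpace F] [BorelSpace F]
  [MeasurableSpace G]
  {𝒳 : Set E} {𝒴 : Set F} {𝒵 : Set G} {M : Data 𝒳 𝒴 𝒵}

/-- The standing assumptions together with nonvanishing reference measures. -/
structure Data.Regular (M : Data 𝒳 𝒴 𝒵) : Prop extends M.Assumptions where
  νX_ne_zero : M.νX ≠ 0
  νY_ne_zero : M.νY ≠ 0

namespace Data

theorem Assumptions.measurable_loss (h : M.Assumptions) : Measurable M.loss :=
  h.measurable_Ψ.comp ((h.measurable_f.comp measurable_fst).prodMk measurable_snd)

theorem Assumptions.loss_ne_bot (h : M.Assumptions) (q : 𝒳 × 𝒴) : M.loss q ≠ ⊥ :=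
  h.Ψ_ne_bot _ _

theorem Assumptions.sigmaFinite_νX (h : M.Assumptions) : SigmaFinite M.νX :=
  sigmaFinite_of_tail (h.tail_X 1 one_pos)

theorem Assumptions.sigmaFinite_νY (h : M.Assumptions) : SigmaFinite M.νY :=
  sigmaFinite_of_tail (h.tail_Y 1 one_pos)

namespace Regular

/-- The real-valued model attached to regular data: costs and loss are divided by `ε`. -/
noncomputable def model (h : M.Regular) : GibbsModel 𝒳 𝒴 where
  P := M.Phat
  η := M.condY
  νX := M.νX
  νY := M.νY
  ψ q := (M.loss q).toReal / M.ε
  c₁ x' x := ‖(x : E) - x'‖ ^ M.p / M.ε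
  c₂ y' y := ‖(y : F) - y'‖ ^ M.p / M.ε
  wX x := ‖(x : E)‖ ^ M.p
  wY y := ‖(y : F)‖ ^ M.p
  prob := h.prob
  markov := h.markov
  sigmaFinite_νX := h.sigmaFinite_νX
  sigmaFinite_νY := h.sigmaFinite_νY
  νX_ne_zero := h.νX_ne_zero
  νY_ne_zero := h.νY_ne_zero
  disint := h.disint.disintegrate
  measurable_ψ := h.measurable_loss.ereal_toReal.div_const _
  measurable_c₁ := by unfold Function.uncurry; fun_prop
  measurable_c₂ := by unfold Function.uncurry; fun_prop
  measurable_wX := by fun_prop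
  measurable_wY := by fun_prop
  wX_nonneg x := by positivity
  wY_nonneg y := by positivity
  integrable_wX := by
    have hm : Measurable fun q : 𝒳 × 𝒴 => ‖(q.1 : E)‖ ^ M.p := by fun_prop
    refine ⟨hm.aestronglyMeasurable, (lintegral_mono fun q => ?_).trans_lt h.moment⟩
    rw [Real.enorm_of_nonneg (by positivity)]
    exact ENNReal.ofReal_le_ofReal (le_add_of_nonneg_right (by positivity))
  integrable_wY := by
    have hm : Measurable fun q : 𝒳 × 𝒴 => ‖(q.2 : F)‖ ^ M.p := by fun_prop
    refine ⟨hm.aestronglyMeasurable, (lintegral_mono fun q => ?_).trans_lt h.moment⟩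
    rw [Real.enorm_of_nonneg (by positivity)]
    exact ENNReal.ofReal_le_ofReal (le_add_of_nonneg_left (by positivity))
  c₁_le := by
    obtain ⟨C, hC, hb⟩ := exists_add_rpow_le h.one_le_p one_lt_two
    have hε := h.ε_pos
    refine ⟨(2 + C) / M.ε, by positivity, fun x x' => ?_⟩
    have h1 := norm_sub_rpow_le h.one_le_p hb (x' : E) (x : E)
    have h2 : 0 ≤ ‖(x : E)‖ ^ M.p := by positivity
    have h3 : 0 ≤ ‖(x' : E)‖ ^ M.p := by positivity
    rw [div_mul_eq_mul_div]
    gcongr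
    nlinarith [mul_nonneg hC h3]
  c₂_le := by
    obtain ⟨C, hC, hb⟩ := exists_add_rpow_le h.one_le_p one_lt_two
    have hε := h.ε_pos
    refine ⟨(2 + C) / M.ε, by positivity, fun x x' => ?_⟩
    have h1 := norm_sub_rpow_le h.one_le_p hb (x' : F) (x : F)
    have h2 : 0 ≤ ‖(x : F)‖ ^ M.p := by positivity
    have h3 : 0 ≤ ‖(x' : F)‖ ^ M.p := by positivity
    rw [div_mul_eq_mul_div]
    gcongr
    nlinarith [mul_nonneg hC h3]
  tail₁ := by
    obtain ⟨C, hC, hb⟩ := exists_expInt_cost_le h.one_le_p h.ε_pos h.tail_X le_rfl one_pos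
    refine ⟨2 * C, by positivity, fun x => ?_⟩
    have h1 := hb x x
    simp only [zero_mul, zero_sub, sub_zero, div_one] at h1
    refine h1.trans (ENNReal.ofReal_le_ofReal (Real.exp_le_exp.2 ?_))
    nlinarith
  tail₂ θ h0 h1 := exists_expInt_cost_le h.one_le_p h.ε_pos h.tail_Y h0 h1

variable (h : M.Regular)

theorem ref_model : h.model.ref = M.Phat.prod M.ν := rfl

theorem model_cost_eq (q' q : 𝒳 × 𝒴) :
    h.model.c₁ q'.1 q.1 + h.model.c₂ q'.2 q.2 = M.cost q' q / M.ε := by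
  simp only [model, cost, add_div]

theorem s_eq_coe {lam : ℝ} (hl : 0 < lam) (q' q : 𝒳 × 𝒴) (hq : M.loss q ≠ ⊤) :
    M.s lam q' q = ((h.model.e lam⁻¹ q'.1 q'.2 q.1 q.2 : ℝ) : EReal) := by
  have hε := h.ε_pos
  rw [s, ← EReal.coe_toReal hq (h.loss_ne_bot q), ← EReal.coe_sub, ← EReal.coe_div]
  congr 1
  simp only [GibbsModel.e, model, cost]
  field_simp
  ring

theorem exp_s_eq {lam : ℝ} (hl : 0 < lam) (q' q : 𝒳 × 𝒴) (hq : M.loss q ≠ ⊤) :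
    EReal.exp (M.s lam q' q)
      = ENNReal.ofReal (Real.exp (h.model.e lam⁻¹ q'.1 q'.2 q.1 q.2)) := by
  rw [h.s_eq_coe hl q' q hq, EReal.exp_coe]

theorem innerInt_eq {lam : ℝ} (hl : 0 < lam) {x : 𝒳} (hx : ∀ᵐ y ∂M.νY, M.loss (x, y) ≠ ⊤)
    (q' : 𝒳 × 𝒴) : M.innerInt lam q' x = expInt M.νY (h.model.e lam⁻¹ q'.1 q'.2 x) :=
  lintegral_congr_ae (hx.mono fun y hy => h.exp_s_eq hl q' (x, y) hy)

end Regular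

end Data

end CausalSDRO

namespace CausalSDRO

set_option linter.unusedSectionVars false

variable {E F G : Type*}
  [NormedAddCommGroup E] [NormedSpace ℝ E] [FiniteDimensional ℝ E]
  [MeasurableSpace E] [BorelSpace E]
  [NormedAddCommGroup F] [NormedSpace ℝ F] [FiniteDimensional ℝ F]
  [MeasurableSpace F] [BorelSpace F]
  [MeasurableSpace G]
  {𝒳 : Set E} {𝒴 : Set F} {𝒵 : Set G} {M : Data 𝒳 𝒴 𝒵}

namespace Data

namespace Regular

variable (h : M.Regular) {lam : ℝ}

theorem log_innerInt_eq (hl : 0 < lam) {x' x : 𝒳} (hx : ∀ᵐ y ∂M.νY, M.loss (x, y) ≠ ⊤) {y' : 𝒴}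
    (hfin : expInt M.νY (h.model.e lam⁻¹ x' y' x) ≠ ∞) :
    ENNReal.log (M.innerInt lam (x', y') x) = (h.model.a lam⁻¹ x' y' x : EReal) := by
  rw [h.innerInt_eq hl hx]
  exact log_expInt h.νY_ne_zero (h.model.measurable_e_comp _ measurable_const measurable_const
    measurable_const measurable_id) hfin

theorem r_eq (hl : 0 < lam) {x' x : 𝒳} (hx : ∀ᵐ y ∂M.νY, M.loss (x, y) ≠ ⊤)
    (hfin : ∀ᵐ y' ∂(M.condY x'), expInt M.νY (h.model.e lam⁻¹ x' y' x) ≠ ∞)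
    (hint : Integrable (fun y' => h.model.a lam⁻¹ x' y' x) (M.condY x')) :
    M.r lam x' x = (h.model.b lam⁻¹ x' x : EReal) :=
  eexpect_eq_coe_of_ae hint (hfin.mono fun _ hy => h.log_innerInt_eq hl hx hy)

theorem g_eq (hl : 0 < lam) {x' x : 𝒳} (hx : ∀ᵐ y ∂M.νY, M.loss (x, y) ≠ ⊤)
    (hfin : ∀ᵐ y' ∂(M.condY x'), expInt M.νY (h.model.e lam⁻¹ x' y' x) ≠ ∞)
    (hint : Integrable (fun y' => h.model.a lam⁻¹ x' y' x) (M.condY x')) :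
    M.g lam x' x = ((lam * M.ε * h.model.b lam⁻¹ x' x : ℝ) : EReal) := by
  have h1 := eexpect_eq_coe_of_ae (μ := M.condY x') (hint.const_mul (lam * M.ε))
    (f := fun y' => ((lam * M.ε : ℝ) : EReal) * ENNReal.log (M.innerInt lam (x', y') x))
    (hfin.mono fun _ hy => by
      rw [h.log_innerInt_eq hl hx hy]
      exact (EReal.coe_mul _ _).symm)
  rw [integral_const_mul] at h1
  exact h1

variable (hfin : ∀ᵐ x ∂M.νX, ∀ᵐ y ∂M.νY, M.loss (x, y) ≠ ⊤)
include hfin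

theorem lintegral_exp_g_eq (hl : 0 < lam) {x' : 𝒳}
    (h1 : ∀ᵐ x ∂M.νX, ∀ᵐ y' ∂(M.condY x'), expInt M.νY (h.model.e lam⁻¹ x' y' x) ≠ ∞)
    (h2 : ∀ᵐ x ∂M.νX, Integrable (fun y' => h.model.a lam⁻¹ x' y' x) (M.condY x')) :
    ∫⁻ x, EReal.exp (M.g lam x' x / ((lam * M.ε : ℝ) : EReal)) ∂M.νX
      = expInt M.νX (h.model.b lam⁻¹ x') := by
  have hε := h.ε_pos
  refine lintegral_congr_ae ?_
  filter_upwards [hfin, h1, h2] with x hx h1 h2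
  rw [h.g_eq hl hx h1 h2, ← EReal.coe_div, EReal.exp_coe,
    mul_div_cancel_left₀ _ (by positivity : lam * M.ε ≠ 0)]

theorem dualObj_eq (hl : 0 < lam) (hG : h.model.Good lam⁻¹) :
    M.dualObj lam = ((lam * M.ρ ^ M.p + lam * M.ε * h.model.K lam⁻¹ : ℝ) : EReal) := by
  rw [dualObj, if_neg hl.ne', EReal.coe_add]
  congr 1
  have h1 := eexpect_eq_coe_of_ae (μ := M.Phat.fst) (hG.int_z.const_mul (lam * M.ε))
    (f := fun xhat => ((lam * M.ε : ℝ) : EReal) *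
        ENNReal.log (∫⁻ x, EReal.exp (M.g lam xhat x / ((lam * M.ε : ℝ) : EReal)) ∂M.νX)) (by
      filter_upwards [hG.fin_a, hG.int_a, hG.fin_z] with x' ha hi hz
      have hz' : ENNReal.log (expInt M.νX (h.model.b lam⁻¹ x')) = (h.model.z lam⁻¹ x' : EReal) :=
        log_expInt h.νX_ne_zero (h.model.measurable_b_comp _ measurable_const measurable_id) hz
      rw [h.lintegral_exp_g_eq hfin hl ha hi, hz']
      exact (EReal.coe_mul _ _).symm)
  rw [h1, integral_const_mul]
  rfl

theorem gibbs_snd_eq (hl : 0 < lam) (hG : h.model.Good lam⁻¹) :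
    M.ν.withDensity (M.gibbsDensity lam) = (h.model.gibbs lam⁻¹).snd := by
  have hprob := h.prob
  have hσX := h.sigmaFinite_νX
  have hσY := h.sigmaFinite_νY
  have hσ : SigmaFinite M.ν := by unfold ν; infer_instance
  have hFm : Measurable fun ω => ENNReal.ofReal (Real.exp (h.model.F lam⁻¹ ω)) := by fun_prop
  have hα : ∀ᵐ ω ∂(M.Phat.prod M.ν),
      M.α lam ω.1.1 = (expInt M.νX (h.model.b lam⁻¹ ω.1.1))⁻¹ := by
    refine h.model.ae_ref_of_ae₁ (p := fun x' => M.α lam x' = (expInt M.νX (h.model.b lam⁻¹ x'))⁻¹) ?_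
    filter_upwards [hG.fin_a, hG.int_a] with x' ha hi
    rw [α]
    congr 1
    refine lintegral_congr_ae ?_
    filter_upwards [hfin, ha, hi] with x hx h1 h2
    rw [h.r_eq hl hx h1 h2, EReal.exp_coe]
  have hloss : ∀ᵐ ω ∂(M.Phat.prod M.ν),
      M.loss ω.2 ≠ ⊤ ∧ ∀ᵐ y ∂M.νY, M.loss (ω.2.1, y) ≠ ⊤ := by
    have h1 : ∀ᵐ q ∂M.ν, M.loss q ≠ ⊤ ∧ ∀ᵐ y ∂M.νY, M.loss (q.1, y) ≠ ⊤ := by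
      refine Filter.Eventually.and ?_ ?_
      · exact (Measure.ae_prod_iff_ae_ae (measurableSet_eq_fun h.measurable_loss
          measurable_const).compl).2 hfin
      · exact Measure.quasiMeasurePreserving_fst.ae hfin
    exact Measure.quasiMeasurePreserving_snd.ae h1
  have hden : ∀ᵐ ω ∂(M.Phat.prod M.ν), M.α lam ω.1.1 * M.β lam ω.1 ω.2.1
      * EReal.exp (M.r lam ω.1.1 ω.2.1 + M.s lam ω.1 ω.2)
        = ENNReal.ofReal (Real.exp (h.model.F lam⁻¹ ω)) := by
    filter_upwards [hα, hloss, hG.ref_fin_a, hG.ref_int_a, hG.ref_fin_a_ae, hG.ref_fin_z]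
      with ω h1 h2 h3 h4 h5 h6
    rw [h1, h.r_eq hl h2.2 h5 h4, h.s_eq_coe hl _ _ h2.1, ← EReal.coe_add, EReal.exp_coe, β,
      h.innerInt_eq hl h2.2]
    have e1 : ENNReal.ofReal (Real.exp (h.model.z lam⁻¹ ω.1.1))
        = expInt h.model.νX (h.model.b lam⁻¹ ω.1.1) := ofReal_exp_logInt h.νX_ne_zero (h.model.measurable_b_comp lam⁻¹
      (measurable_const (a := ω.1.1)) measurable_id) h6
    have e2 : ENNReal.ofReal (Real.exp (h.model.a lam⁻¹ ω.1.1 ω.1.2 ω.2.1))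
        = expInt h.model.νY (h.model.e lam⁻¹ ω.1.1 ω.1.2 ω.2.1) := ofReal_exp_logInt h.νY_ne_zero (h.model.measurable_e_comp lam⁻¹
      (measurable_const (a := ω.1.1)) (measurable_const (a := ω.1.2))
      (measurable_const (a := ω.2.1)) measurable_id) h3
    change (expInt h.model.νX (h.model.b lam⁻¹ ω.1.1))⁻¹ * (expInt h.model.νY _)⁻¹ * _ = _
    rw [← e1, ← e2, ← ENNReal.ofReal_inv_of_pos (Real.exp_pos _),
      ← ENNReal.ofReal_inv_of_pos (Real.exp_pos _), ← Real.exp_neg, ← Real.exp_neg,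
      ← ENNReal.ofReal_mul (Real.exp_pos _).le, ← ENNReal.ofReal_mul (by positivity),
      ← Real.exp_add, ← Real.exp_add, GibbsModel.F]
    congr 2
    ring
  have hden2 : ∀ᵐ q ∂M.ν, M.gibbsDensity lam q
      = ∫⁻ q', ENNReal.ofReal (Real.exp (h.model.F lam⁻¹ (q', q))) ∂M.Phat := by
    have h1 : ∀ᵐ u ∂(M.ν.prod M.Phat), M.α lam u.2.1 * M.β lam u.2 u.1.1
      * EReal.exp (M.r lam u.2.1 u.1.1 + M.s lam u.2 u.1)
        = ENNReal.ofReal (Real.exp (h.model.F lam⁻¹ (u.2, u.1))) := by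
      rw [← Measure.prod_swap] at hden
      exact ae_of_ae_map measurable_swap.aemeasurable hden
    exact (Measure.ae_ae_of_ae_prod h1).mono fun q hq => lintegral_congr_ae hq
  rw [withDensity_congr_ae hden2]
  ext S hS
  rw [withDensity_apply _ hS, Measure.snd_apply hS, GibbsModel.gibbs,
    withDensity_apply _ (measurable_snd hS), ref_model, ← lintegral_indicator hS,
    ← lintegral_indicator (measurable_snd hS),
    lintegral_prod_symm' _ (hFm.indicator (measurable_snd hS))]
  refine lintegral_congr fun q => ?_
  by_cases hq : q ∈ S
  · simp [Set.indicator, hq]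
  · simp [Set.indicator, hq]

end Regular

end Data

end CausalSDRO

namespace CausalSDRO

set_option linter.unusedSectionVars false

theorem tendsto_sub_coe_div_coe {ι : Type*} {l : Filter ι} {f : ι → EReal} {x : EReal}
    (h : Filter.Tendsto f l (nhds x)) (a : ℝ) (b : ℝ) :
    Filter.Tendsto (fun i => (f i - (a : EReal)) / (b : EReal)) l
      (nhds ((x - (a : EReal)) / (b : EReal))) := by
  simp only [EReal.div_eq_inv_mul, ← EReal.coe_inv, sub_eq_add_neg, ← EReal.coe_neg]
  refine EReal.Tendsto.const_mul ?_ (Or.inl (EReal.coe_ne_bot _)) (Or.inl (EReal.coe_ne_top _))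
  exact (EReal.continuousAt_add (p := (x, ((-a : ℝ) : EReal))) (Or.inr (EReal.coe_ne_bot _))
    (Or.inr (EReal.coe_ne_top _))).tendsto.comp (h.prodMk_nhds tendsto_const_nhds)

theorem tendsto_min_natCast (x : EReal) :
    Filter.Tendsto (fun n : ℕ => min x (((n : ℝ)) : EReal)) Filter.atTop (nhds x) := by
  have h : Filter.Tendsto (fun n : ℕ => (((n : ℝ)) : EReal)) Filter.atTop (nhds ⊤) :=
    EReal.tendsto_coe_nhds_top_iff.2 tendsto_natCast_atTop_atTop
  simpa using (tendsto_const_nhds (x := x)).min h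

section

variable {E F G : Type*}
  [NormedAddCommGroup E] [MeasurableSpace E] [NormedAddCommGroup F] [MeasurableSpace F]
  [MeasurableSpace G] {𝒳 : Set E} {𝒴 : Set F} {𝒵 : Set G} (M : Data 𝒳 𝒴 𝒵)

namespace Data

/-- The problem with the loss truncated from above at level `c`. -/
noncomputable def trunc (c : ℝ) : Data 𝒳 𝒴 𝒵 := { M with Ψ := fun z y => min (M.Ψ z y) c }

/-- `∫ exp(g(x̂, x, lam) / (lam ε)) dν_X(x)`. -/
noncomputable def outerInt (lam : ℝ) (xhat : 𝒳) : ℝ≥0∞ :=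
  ∫⁻ x, EReal.exp (M.g lam xhat x / ((lam * M.ε : ℝ) : EReal)) ∂M.νX

theorem dualObj_of_ne_zero {lam : ℝ} (hl : lam ≠ 0) :
    M.dualObj lam = ((lam * M.ρ ^ M.p : ℝ) : EReal)
      + eexpect M.Phat.fst (fun xhat => ((lam * M.ε : ℝ) : EReal) *
        ENNReal.log (M.outerInt lam xhat)) := by
  rw [dualObj, if_neg hl]
  rfl

theorem trunc_trunc {c d : ℝ} (hcd : c ≤ d) : (M.trunc d).trunc c = M.trunc c := by
  have : min (d : EReal) (c : EReal) = c := min_eq_right (EReal.coe_le_coe_iff.2 hcd)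
  simp only [trunc, min_assoc, this]

theorem loss_trunc_le (c : ℝ) (q : 𝒳 × 𝒴) : (M.trunc c).loss q ≤ M.loss q := min_le_left _ _

theorem loss_trunc_ne_top (c : ℝ) (q : 𝒳 × 𝒴) : (M.trunc c).loss q ≠ ⊤ :=
  ne_top_of_le_ne_top (EReal.coe_ne_top c) (min_le_right _ _)

section Monotone

variable {M} {lam : ℝ} (hε : 0 < M.ε) (hl : 0 < lam) (c : ℝ)
include hε hl

theorem s_trunc_le (q' q : 𝒳 × 𝒴) : (M.trunc c).s lam q' q ≤ M.s lam q' q :=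
  EReal.div_le_div_right_of_nonneg (EReal.coe_nonneg.2 (by change 0 ≤ lam * M.ε; positivity))
    (EReal.sub_le_sub (M.loss_trunc_le c q) le_rfl)

theorem innerInt_trunc_le (q' : 𝒳 × 𝒴) (x : 𝒳) :
    (M.trunc c).innerInt lam q' x ≤ M.innerInt lam q' x :=
  lintegral_mono fun _ => EReal.exp_monotone (s_trunc_le hε hl c _ _)

theorem g_trunc_le (x' x : 𝒳) : (M.trunc c).g lam x' x ≤ M.g lam x' x :=
  eexpect_mono_ae (Filter.Eventually.of_forall fun _ =>
    mul_le_mul_of_nonneg_left (ENNReal.log_monotone (innerInt_trunc_le hε hl c _ _))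
      (EReal.coe_nonneg.2 (by change 0 ≤ lam * M.ε; positivity)))

theorem outerInt_trunc_le (x' : 𝒳) : (M.trunc c).outerInt lam x' ≤ M.outerInt lam x' :=
  lintegral_mono fun _ => EReal.exp_monotone (EReal.div_le_div_right_of_nonneg
    (EReal.coe_nonneg.2 (by change 0 ≤ lam * M.ε; positivity)) (g_trunc_le hε hl c _ _))

theorem dualObj_trunc_le : (M.trunc c).dualObj lam ≤ M.dualObj lam := by
  rw [dualObj_of_ne_zero _ hl.ne', dualObj_of_ne_zero _ hl.ne']
  exact add_le_add le_rfl (eexpect_mono_ae (Filter.Eventually.of_forall fun _ =>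
    mul_le_mul_of_nonneg_left (ENNReal.log_monotone (outerInt_trunc_le hε hl c _))
      (EReal.coe_nonneg.2 (by change 0 ≤ lam * M.ε; positivity))))

end Monotone

end Data

end

variable {E F G : Type*}
  [NormedAddCommGroup E] [NormedSpace ℝ E] [FiniteDimensional ℝ E]
  [MeasurableSpace E] [BorelSpace E]
  [NormedAddCommGroup F] [NormedSpace ℝ F] [FiniteDimensional ℝ F]
  [MeasurableSpace F] [BorelSpace F]
  [MeasurableSpace G]
  {𝒳 : Set E} {𝒴 : Set F} {𝒵 : Set G} {M : Data 𝒳 𝒴 𝒵}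

namespace Data

theorem Assumptions.trunc (h : M.Assumptions) (c : ℝ) : (M.trunc c).Assumptions :=
  { h with
    measurable_Ψ := h.measurable_Ψ.min measurable_const
    Ψ_ne_bot := fun z y => by
      have h1 := bot_lt_iff_ne_bot.2 (h.Ψ_ne_bot z y)
      exact (lt_min h1 (EReal.bot_lt_coe c)).ne' }

theorem Regular.trunc (h : M.Regular) (c : ℝ) : (M.trunc c).Regular :=
  ⟨h.toAssumptions.trunc c, h.νX_ne_zero, h.νY_ne_zero⟩

theorem Regular.good_trunc (h : M.Regular) (c : ℝ) {t : ℝ} (ht : 0 ≤ t) :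
    (h.trunc c).model.Good t := by
  refine (GibbsModel.good_of_ae_le (S := c / M.ε) (Filter.Eventually.of_forall fun q => ?_) ht).1
  have h1 : ((M.trunc c).loss q).toReal ≤ c := by
    have := EReal.toReal_le_toReal (min_le_right (M.loss q) (c : EReal))
      ((h.trunc c).loss_ne_bot q) (EReal.coe_ne_top c)
    rwa [EReal.toReal_coe] at this
  exact div_le_div_of_nonneg_right h1 h.ε_pos.le

section Measurability

variable (h : M.Assumptions) {δ : Type*} [MeasurableSpace δ]
include h

theorem Assumptions.measurable_s (lam : ℝ) {f g : δ → 𝒳 × 𝒴} (hf : Measurable f)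
    (hg : Measurable g) : Measurable fun d => M.s lam (f d) (g d) := by
  have hc : Measurable fun d => ((lam * M.cost (f d) (g d) : ℝ) : EReal) := by
    refine measurable_coe_real_ereal.comp (measurable_const.mul ?_)
    unfold cost
    fun_prop
  simp only [s, EReal.div_eq_inv_mul]
  exact ((h.measurable_loss.comp hg).sub hc).const_mul _

theorem Assumptions.measurable_innerInt (lam : ℝ) {f : δ → 𝒳 × 𝒴} {g : δ → 𝒳} (hf : Measurable f)
    (hg : Measurable g) : Measurable fun d => M.innerInt lam (f d) (g d) := by
  have hσ := h.sigmaFinite_νY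
  exact Measurable.lintegral_prod_right'
    (f := fun p : δ × 𝒴 => EReal.exp (M.s lam (f p.1) (g p.1, p.2)))
    (EReal.measurable_exp.comp (h.measurable_s lam (by fun_prop) (by fun_prop)))

theorem Assumptions.measurable_g (lam : ℝ) {f g : δ → 𝒳} (hf : Measurable f) (hg : Measurable g) :
    Measurable fun d => M.g lam (f d) (g d) := by
  have hk := h.markov
  have hm : Measurable fun p : (𝒳 × 𝒳) × 𝒴 =>
      ((lam * M.ε : ℝ) : EReal) * ENNReal.log (M.innerInt lam (p.1.1, p.2) p.1.2) :=
    (ENNReal.measurable_log.comp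
      (h.measurable_innerInt lam (by fun_prop) (by fun_prop))).const_mul _
  have h1 : Measurable fun p : 𝒳 × 𝒳 => M.g lam p.1 p.2 :=
    (measurable_coe_ennreal_ereal.comp (Measurable.lintegral_kernel_prod_right'
      (κ := M.condY.comap Prod.fst measurable_fst) hm.ereal_toENNReal)).sub
      (measurable_coe_ennreal_ereal.comp (Measurable.lintegral_kernel_prod_right'
      (κ := M.condY.comap Prod.fst measurable_fst) hm.neg.ereal_toENNReal))
  exact h1.comp (hf.prodMk hg)

theorem Assumptions.measurable_outerInt (lam : ℝ) : Measurable fun x' => M.outerInt lam x' := by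
  have hσ := h.sigmaFinite_νX
  refine Measurable.lintegral_prod_right'
    (f := fun p : 𝒳 × 𝒳 => EReal.exp (M.g lam p.1 p.2 / ((lam * M.ε : ℝ) : EReal)))
    (EReal.measurable_exp.comp ?_)
  simp only [EReal.div_eq_inv_mul]
  exact (h.measurable_g lam measurable_fst measurable_snd).const_mul _

end Measurability

end Data

end CausalSDRO

namespace CausalSDRO

set_option linter.unusedSectionVars false

variable {E F G : Type*}
  [NormedAddCommGroup E] [NormedSpace ℝ E] [FiniteDimensional ℝ E]
  [MeasurableSpace E] [BorelSpace E]
  [NormedAddCommGroup F] [NormedSpace ℝ F] [FiniteDimensional ℝ F]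
  [MeasurableSpace F] [BorelSpace F]
  [MeasurableSpace G]
  {𝒳 : Set E} {𝒴 : Set F} {𝒵 : Set G} {M : Data 𝒳 𝒴 𝒵}

namespace Data

namespace Regular

theorem loss_trunc_ae (c : ℝ) :
    ∀ᵐ x ∂(M.trunc c).νX, ∀ᵐ y ∂(M.trunc c).νY, (M.trunc c).loss (x, y) ≠ ⊤ :=
  Filter.Eventually.of_forall fun _ => Filter.Eventually.of_forall fun _ =>
    M.loss_trunc_ne_top c _

variable (h : M.Regular) {lam : ℝ} (hl : 0 < lam) (c : ℝ)
include h hl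

theorem exists_inner_minorant : ∀ᵐ x' ∂M.Phat.fst, ∀ᵐ x ∂M.νX, ∃ l : 𝒴 → ℝ,
    Integrable l (M.condY x') ∧ ∀ᵐ y' ∂(M.condY x'), (l y' : EReal)
      ≤ ((lam * M.ε : ℝ) : EReal) * ENNReal.log ((M.trunc c).innerInt lam (x', y') x) := by
  have hG := h.good_trunc c (inv_pos.2 hl).le
  filter_upwards [hG.fin_a, hG.int_a] with x' h1 h2
  filter_upwards [h1, h2] with x h1 h2
  refine ⟨fun y' => lam * M.ε * (h.trunc c).model.a lam⁻¹ x' y' x, h2.const_mul _, ?_⟩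
  filter_upwards [h1] with y' h1
  rw [(h.trunc c).log_innerInt_eq hl (Filter.Eventually.of_forall fun y =>
    M.loss_trunc_ne_top c _) h1]
  exact (EReal.coe_mul _ _).le

theorem exists_outer_minorant : ∃ l : 𝒳 → ℝ, Integrable l M.Phat.fst ∧
    ∀ᵐ x' ∂M.Phat.fst, (l x' : EReal)
      ≤ ((lam * M.ε : ℝ) : EReal) * ENNReal.log ((M.trunc c).outerInt lam x') := by
  have hG := h.good_trunc c (inv_pos.2 hl).le
  refine ⟨fun x' => lam * M.ε * (h.trunc c).model.z lam⁻¹ x', hG.int_z.const_mul _, ?_⟩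
  filter_upwards [hG.fin_a, hG.int_a, hG.fin_z] with x' h1 h2 h3
  have h4 : ENNReal.log (expInt (M.trunc c).νX ((h.trunc c).model.b lam⁻¹ x'))
      = ((h.trunc c).model.z lam⁻¹ x' : EReal) :=
    log_expInt h.νX_ne_zero ((h.trunc c).model.measurable_b_comp _ measurable_const measurable_id) h3
  have h5 : (M.trunc c).outerInt lam x'
      = expInt (M.trunc c).νX ((h.trunc c).model.b lam⁻¹ x') :=
    (h.trunc c).lintegral_exp_g_eq (loss_trunc_ae c) hl h1 h2
  rw [h5, h4]
  exact (EReal.coe_mul _ _).le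

theorem tendsto_innerInt (q' : 𝒳 × 𝒴) (x : 𝒳) :
    Filter.Tendsto (fun n : ℕ => (M.trunc n).innerInt lam q' x) Filter.atTop
      (nhds (M.innerInt lam q' x)) := by
  have hε := h.ε_pos
  refine lintegral_tendsto_of_tendsto_of_monotone (fun n => ?_)
    (Filter.Eventually.of_forall fun y n m hnm => ?_) (Filter.Eventually.of_forall fun y => ?_)
  · exact (EReal.measurable_exp.comp
      ((h.trunc n).measurable_s lam measurable_const (by fun_prop))).aemeasurable
  · refine EReal.exp_monotone ?_
    have := s_trunc_le (M := M.trunc m) hε hl (n : ℝ) q' (x, y)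
    rwa [M.trunc_trunc (Nat.cast_le.2 hnm)] at this
  · have h1 : Filter.Tendsto (fun n : ℕ => (M.trunc n).s lam q' (x, y)) Filter.atTop
        (nhds (M.s lam q' (x, y))) :=
      tendsto_sub_coe_div_coe (tendsto_min_natCast (M.loss (x, y)))
        (lam * M.cost q' (x, y)) (lam * M.ε)
    exact (ENNReal.continuous_exp.tendsto _).comp h1

theorem tendsto_const_mul_log {f : ℕ → ℝ≥0∞} {a : ℝ≥0∞}
    (hf : Filter.Tendsto f Filter.atTop (nhds a)) (c : ℝ) :
    Filter.Tendsto (fun n => (c : EReal) * ENNReal.log (f n)) Filter.atTop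
      (nhds ((c : EReal) * ENNReal.log a)) :=
  EReal.Tendsto.const_mul ((ENNReal.continuous_log.tendsto _).comp hf)
    (Or.inl (EReal.coe_ne_bot _)) (Or.inl (EReal.coe_ne_top _))

theorem tendsto_g : ∀ᵐ x' ∂M.Phat.fst, ∀ᵐ x ∂M.νX,
    Filter.Tendsto (fun n : ℕ => (M.trunc n).g lam x' x) Filter.atTop (nhds (M.g lam x' x)) := by
  have hε := h.ε_pos
  filter_upwards [h.exists_inner_minorant hl ((0 : ℕ) : ℝ)] with x' h1
  filter_upwards [h1] with x ⟨l, hl1, hl2⟩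
  refine tendsto_eexpect_of_monotone (l := l) (fun n => ?_)
    (Filter.Eventually.of_forall fun y n m hnm => ?_) hl1 hl2
    (Filter.Eventually.of_forall fun y => ?_)
  · exact ((ENNReal.measurable_log.comp
      ((h.trunc n).measurable_innerInt lam (by fun_prop) measurable_const)).const_mul
        _).aemeasurable
  · refine mul_le_mul_of_nonneg_left (ENNReal.log_monotone ?_)
      (EReal.coe_nonneg.2 (by change 0 ≤ lam * M.ε; positivity))
    have := innerInt_trunc_le (M := M.trunc m) hε hl (n : ℝ) (x', y) x
    rwa [M.trunc_trunc (Nat.cast_le.2 hnm)] at this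
  · exact h.tendsto_const_mul_log hl (h.tendsto_innerInt hl (x', y) x) _

theorem tendsto_outerInt : ∀ᵐ x' ∂M.Phat.fst,
    Filter.Tendsto (fun n : ℕ => (M.trunc n).outerInt lam x') Filter.atTop
      (nhds (M.outerInt lam x')) := by
  have hε := h.ε_pos
  filter_upwards [h.tendsto_g hl] with x' h1
  refine lintegral_tendsto_of_tendsto_of_monotone (fun n => ?_)
    (Filter.Eventually.of_forall fun x n m hnm => ?_) (h1.mono fun x hx => ?_)
  · have := ((h.trunc n).measurable_g lam (measurable_const (a := x')) measurable_id)
    simp only [EReal.div_eq_inv_mul]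
    exact (EReal.measurable_exp.comp (this.const_mul _)).aemeasurable
  · refine EReal.exp_monotone (EReal.div_le_div_right_of_nonneg
      (EReal.coe_nonneg.2 (by change 0 ≤ lam * M.ε; positivity)) ?_)
    have := g_trunc_le (M := M.trunc m) hε hl (n : ℝ) x' x
    rwa [M.trunc_trunc (Nat.cast_le.2 hnm)] at this
  · refine (ENNReal.continuous_exp.tendsto _).comp ?_
    have := tendsto_sub_coe_div_coe hx 0 (lam * M.ε)
    simp only [EReal.coe_zero, sub_zero] at this
    exact this

theorem tendsto_dualObj :
    Filter.Tendsto (fun n : ℕ => (M.trunc n).dualObj lam) Filter.atTop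
      (nhds (M.dualObj lam)) := by
  have hε := h.ε_pos
  obtain ⟨l, hl1, hl2⟩ := h.exists_outer_minorant hl ((0 : ℕ) : ℝ)
  have h1 := tendsto_eexpect_of_monotone (μ := M.Phat.fst)
    (f := fun (n : ℕ) x' => ((lam * M.ε : ℝ) : EReal) * ENNReal.log ((M.trunc n).outerInt lam x'))
    (F := fun x' => ((lam * M.ε : ℝ) : EReal) * ENNReal.log (M.outerInt lam x')) (l := l)
    (fun n => ((ENNReal.measurable_log.comp
      ((h.trunc n).measurable_outerInt lam)).const_mul _).aemeasurable)
    (Filter.Eventually.of_forall fun x' n m hnm => mul_le_mul_of_nonneg_left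
      (ENNReal.log_monotone (by
        have := outerInt_trunc_le (M := M.trunc m) hε hl (n : ℝ) x'
        rwa [M.trunc_trunc (Nat.cast_le.2 hnm)] at this)) (EReal.coe_nonneg.2 (by positivity)))
    hl1 hl2 ((h.tendsto_outerInt hl).mono fun x' hx => h.tendsto_const_mul_log hl hx _)
  simp only [dualObj_of_ne_zero _ hl.ne']
  exact (EReal.continuousAt_add (p := (((lam * M.ρ ^ M.p : ℝ) : EReal), eexpect M.Phat.fst
    fun x' => ((lam * M.ε : ℝ) : EReal) * ENNReal.log (M.outerInt lam x')))
    (Or.inl (EReal.coe_ne_top _)) (Or.inl (EReal.coe_ne_bot _))).tendsto.comp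
    (tendsto_const_nhds.prodMk_nhds h1)

theorem good_of_dualObj_ne_top (hd : M.dualObj lam ≠ ⊤) :
    (∀ᵐ x ∂M.νX, ∀ᵐ y ∂M.νY, M.loss (x, y) ≠ ⊤) ∧ h.model.Good lam⁻¹ := by
  have hε := h.ε_pos
  have hprob := h.prob
  have hmk := h.markov
  have hc : 0 < lam * M.ε := by positivity
  have hc' : (0 : EReal) < ((lam * M.ε : ℝ) : EReal) := EReal.coe_pos.2 hc
  have hc0 : (0 : EReal) ≤ ((lam * M.ε : ℝ) : EReal) := hc'.le
  have key : ∀ {a : ℝ≥0∞} {r : ℝ},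
      ((lam * M.ε : ℝ) : EReal) * ENNReal.log a = (r : EReal) → a ≠ ∞ := by
    rintro a r h1 rfl
    rw [ENNReal.log_top, EReal.mul_top_of_pos hc'] at h1
    exact EReal.coe_ne_top _ h1.symm
  obtain ⟨l, hl1, hl2⟩ := h.exists_outer_minorant hl 0
  have hout := exists_integrable_of_eexpect_ne_top (μ := M.Phat.fst)
    (f := fun x' => ((lam * M.ε : ℝ) : EReal) * ENNReal.log (M.outerInt lam x'))
    ((ENNReal.measurable_log.comp (h.measurable_outerInt lam)).const_mul _).aemeasurable
    (lintegral_neg_ne_top_of_ae_le hl1 (hl2.mono fun x' hx => hx.trans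
      (mul_le_mul_of_nonneg_left (ENNReal.log_monotone (outerInt_trunc_le hε hl 0 x')) hc0)))
    (fun h1 => hd (by rw [dualObj_of_ne_zero _ hl.ne', h1, EReal.coe_add_top]))
  have hg : ∀ᵐ x' ∂M.Phat.fst, ∀ᵐ x ∂M.νX, M.g lam x' x ≠ ⊤ := by
    filter_upwards [hout.1] with x' h1
    have hm : Measurable fun x =>
        EReal.exp (M.g lam x' x / ((lam * M.ε : ℝ) : EReal)) := by
      simp only [EReal.div_eq_inv_mul]
      exact EReal.measurable_exp.comp
        ((h.measurable_g lam (measurable_const (a := x')) measurable_id).const_mul _)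
    filter_upwards [ae_lt_top hm (key h1)] with x hx h2
    rw [h2, EReal.top_div_of_pos_ne_top hc' (EReal.coe_ne_top _), EReal.exp_top] at hx
    exact lt_irrefl _ hx
  have hin : ∀ᵐ x' ∂M.Phat.fst, ∀ᵐ x ∂M.νX,
      (∀ᵐ y' ∂(M.condY x'), ((lam * M.ε : ℝ) : EReal) * ENNReal.log (M.innerInt lam (x', y') x)
        = ((((lam * M.ε : ℝ) : EReal) * ENNReal.log (M.innerInt lam (x', y') x)).toReal : EReal)) ∧
      Integrable (fun y' => (((lam * M.ε : ℝ) : EReal)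
        * ENNReal.log (M.innerInt lam (x', y') x)).toReal) (M.condY x') := by
    filter_upwards [hg, h.exists_inner_minorant hl 0] with x' h1 h2
    filter_upwards [h1, h2] with x h1 ⟨l, hl1, hl2⟩
    refine exists_integrable_of_eexpect_ne_top ?_ (lintegral_neg_ne_top_of_ae_le hl1
      (hl2.mono fun y hy => hy.trans
      (mul_le_mul_of_nonneg_left (ENNReal.log_monotone (innerInt_trunc_le hε hl 0 _ _)) hc0))) h1
    exact ((ENNReal.measurable_log.comp
      (h.measurable_innerInt lam (by fun_prop) measurable_const)).const_mul _).aemeasurable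
  have hfin : ∀ᵐ x ∂M.νX, ∀ᵐ y ∂M.νY, M.loss (x, y) ≠ ⊤ := by
    obtain ⟨x', hx'⟩ := hin.exists
    filter_upwards [hx'] with x ⟨hx, _⟩
    obtain ⟨y', hy'⟩ := hx.exists
    filter_upwards [ae_lt_top (EReal.measurable_exp.comp
      (h.measurable_s lam measurable_const (by fun_prop))) (key hy')] with y hy h1
    simp only [Function.comp_apply, s, h1, EReal.top_sub_coe] at hy
    rw [EReal.top_div_of_pos_ne_top hc' (EReal.coe_ne_top _), EReal.exp_top] at hy
    exact lt_irrefl _ hy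
  have hfa : ∀ᵐ x' ∂M.Phat.fst, ∀ᵐ x ∂M.νX, ∀ᵐ y' ∂(M.condY x'),
      expInt M.νY (h.model.e lam⁻¹ x' y' x) ≠ ∞ := by
    filter_upwards [hin] with x' h1
    filter_upwards [h1, hfin] with x ⟨h1, _⟩ h2
    filter_upwards [h1] with y' h1
    have := key h1
    rwa [h.innerInt_eq hl h2] at this
  have hia : ∀ᵐ x' ∂M.Phat.fst, ∀ᵐ x ∂M.νX,
      Integrable (fun y' => h.model.a lam⁻¹ x' y' x) (M.condY x') := by
    filter_upwards [hin, hfa] with x' h1 h2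
    filter_upwards [h1, hfin, h2] with x ⟨_, h1⟩ h2 h3
    refine (integrable_const_mul_iff (IsUnit.mk0 _ hc.ne') _).1 (h1.congr ?_)
    filter_upwards [h3] with y' h3
    rw [h.log_innerInt_eq hl h2 h3, ← EReal.coe_mul, EReal.toReal_coe]
  have hz : ∀ᵐ x' ∂M.Phat.fst, M.outerInt lam x' = expInt M.νX (h.model.b lam⁻¹ x') := by
    filter_upwards [hfa, hia] with x' h1 h2
    exact h.lintegral_exp_g_eq hfin hl h1 h2
  have hfz : ∀ᵐ x' ∂M.Phat.fst, expInt M.νX (h.model.b lam⁻¹ x') ≠ ∞ := by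
    filter_upwards [hout.1, hz] with x' h1 h2
    rw [← h2]
    exact key h1
  refine ⟨hfin, hfa, hia, hfz, (integrable_const_mul_iff (IsUnit.mk0 _ hc.ne') _).1
    (hout.2.congr ?_)⟩
  filter_upwards [hfz, hz] with x' h1 h2
  have h4 : ENNReal.log (expInt M.νX (h.model.b lam⁻¹ x')) = (h.model.z lam⁻¹ x' : EReal) :=
    log_expInt h.νX_ne_zero (h.model.measurable_b_comp _ measurable_const measurable_id) h1
  rw [h2, h4, ← EReal.coe_mul, EReal.toReal_coe]

end Regular

end Data

end CausalSDRO

namespace CausalSDRO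

set_option linter.unusedSectionVars false

variable {E F G : Type*}
  [NormedAddCommGroup E] [NormedSpace ℝ E] [FiniteDimensional ℝ E]
  [MeasurableSpace E] [BorelSpace E]
  [NormedAddCommGroup F] [NormedSpace ℝ F] [FiniteDimensional ℝ F]
  [MeasurableSpace F] [BorelSpace F]
  [MeasurableSpace G]
  {𝒳 : Set E} {𝒴 : Set F} {𝒵 : Set G} {M : Data 𝒳 𝒴 𝒵}

namespace Data

namespace Regular

variable (h : M.Regular)

include h in
theorem sigmaFinite_ref : SigmaFinite (M.Phat.prod M.ν) := by
  have := h.prob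
  have := h.sigmaFinite_νX
  have := h.sigmaFinite_νY
  unfold ν
  infer_instance

theorem integrand_ae_eq {γ : Measure ((𝒳 × 𝒴) × (𝒳 × 𝒴))} {f : (𝒳 × 𝒴) × (𝒳 × 𝒴) → ℝ≥0∞}
    (hγ : h.model.IsPlan γ f) :
    ∀ᵐ ω ∂γ, ((M.cost ω.1 ω.2 : ℝ) : EReal)
      + (M.ε : EReal) * ENNReal.log (γ.rnDeriv (M.Phat.prod M.ν) ω)
        = ((M.ε * h.model.kap f ω : ℝ) : EReal) := by
  have hσ := h.sigmaFinite_ref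
  have hε := h.ε_pos
  have h1 : γ.rnDeriv (M.Phat.prod M.ν) =ᵐ[M.Phat.prod M.ν] f := by
    conv_lhs => rw [hγ.eq]
    exact Measure.rnDeriv_withDensity _ hγ.measurable
  have h2 : ∀ᵐ ω ∂γ, f ω ≠ 0 := by
    conv => enter [2]; rw [hγ.eq]
    rw [ae_withDensity_iff hγ.measurable]
    exact Filter.Eventually.of_forall fun _ h => h
  filter_upwards [hγ.ac.ae_le h1, hγ.ac.ae_le hγ.ae_ne_top, h2] with ω h1 h2 h3
  rw [h1]
  have h4 : ENNReal.log (f ω) = ((Real.log (f ω).toReal : ℝ) : EReal) := by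
    conv_lhs => rw [← ENNReal.ofReal_toReal h2]
    exact ENNReal.log_ofReal_of_pos (ENNReal.toReal_pos h3 h2)
  rw [h4, ← EReal.coe_mul, ← EReal.coe_add]
  congr 1
  rw [GibbsModel.kap, add_assoc, h.model_cost_eq]
  field_simp
  ring

theorem planCost_eq {γ : Measure ((𝒳 × 𝒴) × (𝒳 × 𝒴))} {f : (𝒳 × 𝒴) × (𝒳 × 𝒴) → ℝ≥0∞}
    (hγ : h.model.IsPlan γ f) (hk : Integrable (h.model.kap f) γ) :
    M.planCost γ = ((M.ε * ∫ ω, h.model.kap f ω ∂γ : ℝ) : EReal) := by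
  rw [planCost, if_pos (show γ ≪ M.Phat.prod M.ν from hγ.ac), eexpect_eq_coe_of_ae (hk.const_mul M.ε) (h.integrand_ae_eq hγ),
    integral_const_mul]

theorem isCausal_iff {γ : Measure ((𝒳 × 𝒴) × (𝒳 × 𝒴))} [IsProbabilityMeasure γ]
    (hγ : γ.fst = M.Phat) : IsCausal γ ↔ h.model.CausalLaw γ := by
  have := h.prob
  have := h.measurableSet_X.standardBorel
  have := h.measurableSet_Y.standardBorel
  obtain ⟨q⟩ : Nonempty (𝒳 × 𝒴) := nonempty_of_isProbabilityMeasure M.Phat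
  have : Nonempty 𝒳 := ⟨q.1⟩
  have : Nonempty 𝒴 := ⟨q.2⟩
  exact h.model.isCausal_iff_causalLaw hγ

theorem exists_isPlan {γ : Measure ((𝒳 × 𝒴) × (𝒳 × 𝒴))} {Q : Measure (𝒳 × 𝒴)}
    (hγ : M.IsCausalPlan Q γ) (hc : M.planCost γ ≠ ⊤) :
    ∃ f, h.model.IsPlan γ f ∧ Integrable (h.model.kap f) γ := by
  have hε := h.ε_pos
  have hσ := h.sigmaFinite_ref
  have hprob := h.prob
  have hγprob : IsProbabilityMeasure γ := by
    constructor
    rw [← Measure.fst_univ, hγ.1, measure_univ]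
  by_cases hac : γ ≪ M.Phat.prod M.ν
  swap
  · exact absurd (if_neg hac) hc
  rw [planCost, if_pos hac] at hc
  have hplan : h.model.IsPlan γ (γ.rnDeriv (M.Phat.prod M.ν)) :=
    ⟨Measure.measurable_rnDeriv _ _, (Measure.withDensity_rnDeriv_eq _ _ hac).symm, hγ.1,
      (h.isCausal_iff hγ.1).1 hγ.2.2⟩
  refine ⟨_, hplan, ?_⟩
  rw [eexpect_congr_ae (h.integrand_ae_eq hplan)] at hc
  have h1 := (exists_integrable_of_eexpect_ne_top ?_ ?_ hc).2
  · simp only [EReal.toReal_coe] at h1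
    exact (integrable_const_mul_iff (IsUnit.mk0 _ hε.ne') _).1 h1
  · exact (measurable_coe_real_ereal.comp (hplan.measurable_kap.const_mul _)).aemeasurable
  · have h2 := hplan.lintegral_neg_kap_ne_top
    have h3 : ∀ ω, (-((M.ε * h.model.kap (γ.rnDeriv (M.Phat.prod M.ν)) ω : ℝ) : EReal)).toENNReal
        = ENNReal.ofReal M.ε * ENNReal.ofReal (-h.model.kap (γ.rnDeriv (M.Phat.prod M.ν)) ω) :=
      fun ω => by
        rw [← EReal.coe_neg, toENNReal_coe_real, ← mul_neg, ENNReal.ofReal_mul hε.le]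
    simp_rw [h3]
    rw [lintegral_const_mul' _ _ ENNReal.ofReal_ne_top]
    exact ENNReal.mul_ne_top ENNReal.ofReal_ne_top h2

theorem exists_isPlan_of_isFeasible {Q : Measure (𝒳 × 𝒴)} (hQ : M.IsFeasible Q) {δ : ℝ}
    (hδ : 0 < δ) : ∃ γ f, h.model.IsPlan γ f ∧ γ.snd = Q ∧ Integrable (h.model.kap f) γ ∧
      M.ε * ∫ ω, h.model.kap f ω ∂γ ≤ M.ρ ^ M.p + δ := by
  have h1 : M.csdPow Q < ((M.ρ ^ M.p + δ : ℝ) : EReal) :=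
    hQ.2.trans_lt (EReal.coe_lt_coe_iff.2 (by linarith))
  simp only [csdPow, iInf_lt_iff] at h1
  obtain ⟨γ, hγ, h2⟩ := h1
  obtain ⟨f, hf, hk⟩ := h.exists_isPlan hγ h2.ne_top
  rw [h.planCost_eq hf hk] at h2
  exact ⟨γ, f, hf, hγ.2.1, hk, (EReal.coe_lt_coe_iff.1 h2).le⟩

theorem isFeasible_snd {γ : Measure ((𝒳 × 𝒴) × (𝒳 × 𝒴))} {f : (𝒳 × 𝒴) × (𝒳 × 𝒴) → ℝ≥0∞}
    (hγ : h.model.IsPlan γ f) (hk : Integrable (h.model.kap f) γ)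
    (hc : M.ε * ∫ ω, h.model.kap f ω ∂γ ≤ M.ρ ^ M.p) : M.IsFeasible γ.snd := by
  have := hγ.isProbabilityMeasure
  refine ⟨inferInstance, (iInf₂_le γ ⟨hγ.fst, rfl, (h.isCausal_iff hγ.fst).2 hγ.law⟩).trans ?_⟩
  rw [h.planCost_eq hγ hk]
  exact EReal.coe_le_coe_iff.2 hc

end Regular

end Data

end CausalSDRO

namespace CausalSDRO

theorem eexpect_map {α β : Type*} [MeasurableSpace α] [MeasurableSpace β] {μ : Measure α}
    {g : β → EReal} (hg : Measurable g) {T : α → β} (hT : Measurable T) :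
    eexpect (μ.map T) g = eexpect μ fun a => g (T a) := by
  have hn : Measurable fun b => (-g b).toENNReal := hg.neg.ereal_toENNReal
  unfold eexpect
  rw [lintegral_map hg.ereal_toENNReal hT, lintegral_map hn hT]

set_option linter.unusedSectionVars false

variable {E F G : Type*}
  [NormedAddCommGroup E] [NormedSpace ℝ E] [FiniteDimensional ℝ E]
  [MeasurableSpace E] [BorelSpace E]
  [NormedAddCommGroup F] [NormedSpace ℝ F] [FiniteDimensional ℝ F]
  [MeasurableSpace F] [BorelSpace F]
  [MeasurableSpace G]
  {𝒳 : Set E} {𝒴 : Set F} {𝒵 : Set G} {M : Data 𝒳 𝒴 𝒵}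

namespace Data

namespace Regular

variable (h : M.Regular) {lam : ℝ}

/-- The dual objective in real numbers. -/
noncomputable def v (lam : ℝ) : ℝ := lam * M.ρ ^ M.p + lam * M.ε * h.model.K lam⁻¹

variable {h}
variable {γ : Measure ((𝒳 × 𝒴) × (𝒳 × 𝒴))} {f : (𝒳 × 𝒴) × (𝒳 × 𝒴) → ℝ≥0∞}

theorem ae_loss_eq (hfin : ∀ᵐ x ∂M.νX, ∀ᵐ y ∂M.νY, M.loss (x, y) ≠ ⊤)
    (hγ : h.model.IsPlan γ f) :
    ∀ᵐ ω ∂γ, M.loss ω.2 = ((M.ε * h.model.ψ ω.2 : ℝ) : EReal) := by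
  have hσX := h.sigmaFinite_νX
  have hσY := h.sigmaFinite_νY
  have h1 : ∀ᵐ q ∂M.ν, M.loss q ≠ ⊤ := (Measure.ae_prod_iff_ae_ae
    (measurableSet_eq_fun h.measurable_loss measurable_const).compl).2 hfin
  have h2 : ∀ᵐ ω ∂(M.Phat.prod M.ν), M.loss ω.2 ≠ ⊤ := Measure.quasiMeasurePreserving_snd.ae h1
  filter_upwards [hγ.ac.ae_le h2] with ω h2
  have : M.ε * h.model.ψ ω.2 = (M.loss ω.2).toReal :=
    mul_div_cancel₀ _ h.ε_pos.ne'
  rw [this, EReal.coe_toReal h2 (h.loss_ne_bot _)]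

theorem eexpect_loss_eq (hfin : ∀ᵐ x ∂M.νX, ∀ᵐ y ∂M.νY, M.loss (x, y) ≠ ⊤)
    (hγ : h.model.IsPlan γ f) (hψ : Integrable (fun ω => h.model.ψ ω.2) γ) :
    eexpect γ.snd M.loss = ((M.ε * ∫ ω, h.model.ψ ω.2 ∂γ : ℝ) : EReal) := by
  rw [Measure.snd, eexpect_map h.measurable_loss measurable_snd,
    eexpect_eq_coe_of_ae (hψ.const_mul M.ε) (ae_loss_eq hfin hγ), integral_const_mul]

/-- The duality gap of a plan is the relative entropy with respect to the Gibbs plan. -/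
theorem duality_gap (hl : 0 < lam) (hfin : ∀ᵐ x ∂M.νX, ∀ᵐ y ∂M.νY, M.loss (x, y) ≠ ⊤)
    (hG : h.model.Good lam⁻¹) (hγ : h.model.IsPlan γ f) (hk : Integrable (h.model.kap f) γ)
    (hb : eexpect γ.snd M.loss ≠ ⊥) :
    Integrable (h.model.logRatio lam⁻¹ f) γ ∧ ∃ L : ℝ, eexpect γ.snd M.loss = (L : EReal) ∧
      L + lam * M.ε * ∫ ω, h.model.logRatio lam⁻¹ f ω ∂γ
        = h.v lam + lam * (M.ε * ∫ ω, h.model.kap f ω ∂γ - M.ρ ^ M.p) := by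
  have hε := h.ε_pos
  have hneg : ∫⁻ ω, ENNReal.ofReal (-(lam⁻¹ * h.model.ψ ω.2)) ∂γ ≠ ∞ := by
    have h1 := lintegral_neg_ne_top_of_eexpect_ne_bot hb
    have hn : Measurable fun q => (-M.loss q).toENNReal := h.measurable_loss.neg.ereal_toENNReal
    rw [Measure.snd, lintegral_map hn measurable_snd] at h1
    have h2 : ∀ᵐ ω ∂γ, ENNReal.ofReal (-(lam⁻¹ * h.model.ψ ω.2))
        = ENNReal.ofReal (lam⁻¹ / M.ε) * (-M.loss ω.2).toENNReal := by
      filter_upwards [ae_loss_eq hfin hγ] with ω h2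
      rw [h2, ← EReal.coe_neg, toENNReal_coe_real, ← ENNReal.ofReal_mul (by positivity)]
      congr 1
      field_simp
    rw [lintegral_congr_ae h2, lintegral_const_mul' _ _ ENNReal.ofReal_ne_top]
    exact ENNReal.mul_ne_top ENNReal.ofReal_ne_top h1
  obtain ⟨h1, h2, h3⟩ := hγ.entropy_identity hG hneg hk
  have h4 : Integrable (fun ω => h.model.ψ ω.2) γ :=
    (integrable_const_mul_iff (IsUnit.mk0 _ (inv_pos.2 hl).ne') _).1 h2
  refine ⟨h1, _, eexpect_loss_eq hfin hγ h4, ?_⟩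
  rw [integral_const_mul] at h3
  have h5 : ∫ ω, h.model.logRatio lam⁻¹ f ω ∂γ = ∫ ω, h.model.kap f ω ∂γ + h.model.K lam⁻¹
    - lam⁻¹ * ∫ ω, h.model.ψ ω.2 ∂γ := by linarith
  rw [h5, v]
  field_simp
  ring

theorem eexpect_loss_le (hl : 0 < lam) (hfin : ∀ᵐ x ∂M.νX, ∀ᵐ y ∂M.νY, M.loss (x, y) ≠ ⊤)
    (hG : h.model.Good lam⁻¹) {Q : Measure (𝒳 × 𝒴)} (hQ : M.IsFeasible Q) :
    eexpect Q M.loss ≤ (h.v lam : EReal) := by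
  have hε := h.ε_pos
  by_cases hb : eexpect Q M.loss = ⊥
  · rw [hb]; exact bot_le
  obtain ⟨γ, f, hγ, rfl, -, -⟩ := h.exists_isPlan_of_isFeasible hQ one_pos
  have hall : ∀ δ : ℝ, 0 < δ → eexpect γ.snd M.loss ≤ ((h.v lam + lam * δ : ℝ) : EReal) := by
    intro δ hδ
    obtain ⟨γ', f', hγ', hs, hk, hc⟩ := h.exists_isPlan_of_isFeasible hQ hδ
    rw [← hs] at hb ⊢
    obtain ⟨h1, L, h2, h3⟩ := duality_gap hl hfin hG hγ' hk hb
    rw [h2, EReal.coe_le_coe_iff]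
    have h4 := mul_nonneg (mul_pos hl hε).le (hγ'.integral_logRatio_nonneg hG h1)
    nlinarith
  have h5 := hall 1 one_pos
  obtain ⟨L, hL⟩ : ∃ L : ℝ, eexpect γ.snd M.loss = (L : EReal) :=
    ⟨_, (EReal.coe_toReal (ne_top_of_le_ne_top (EReal.coe_ne_top _) h5) hb).symm⟩
  simp only [hL, EReal.coe_le_coe_iff] at hall ⊢
  refine le_of_forall_pos_le_add fun δ hδ => ?_
  have := hall (δ / lam) (by positivity)
  rwa [mul_div_cancel₀ _ hl.ne'] at this

/-- At an interior local minimum of the dual objective the Gibbs plan is feasible and attains the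
dual value. -/
theorem gibbs_of_isLocalMin (hl : 0 < lam)
    (hfin : ∀ᵐ x ∂M.νX, ∀ᵐ y ∂M.νY, M.loss (x, y) ≠ ⊤) {t : ℝ} (hG : h.model.Good t)
    (ht : lam⁻¹ < t) (hmin : IsLocalMin h.v lam) :
    M.IsFeasible (h.model.gibbs lam⁻¹).snd ∧
      eexpect (h.model.gibbs lam⁻¹).snd M.loss = (h.v lam : EReal) := by
  have hl' : 0 < lam⁻¹ := inv_pos.2 hl
  have hε := h.ε_pos
  obtain ⟨hψ, hk, hki⟩ := hG.gibbs_integrable hl' ht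
  have hG' : h.model.Good lam⁻¹ := hG.of_le hl'.le ht.le
  have hplan := hG'.isPlan_gibbs
  set m := ∫ ω, h.model.ψ ω.2 ∂(h.model.gibbs lam⁻¹) with hm
  have hder : HasDerivAt h.model.K m lam⁻¹ := by
    refine GibbsModel.Good.hasDerivAt_K (δ := min (t - lam⁻¹) (lam⁻¹ / 2)) (hG.of_le ?_ ?_) ?_ ?_
    · have : 0 < min (t - lam⁻¹) (lam⁻¹ / 2) := lt_min (by linarith) (by linarith)
      linarith
    · linarith [min_le_left (t - lam⁻¹) (lam⁻¹ / 2)]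
    · exact lt_min (by linarith) (by linarith)
    · linarith [min_le_right (t - lam⁻¹) (lam⁻¹ / 2)]
  have hv : HasDerivAt h.v (1 * M.ρ ^ M.p + ((1 * M.ε) * h.model.K lam⁻¹
      + (lam * M.ε) * (m * (-(lam ^ 2)⁻¹)))) lam :=
    ((hasDerivAt_id lam).mul_const _).add
      (((hasDerivAt_id lam).mul_const M.ε).mul (hder.comp lam (hasDerivAt_inv hl.ne')))
  have h0 := hmin.hasDerivAt_eq_zero hv
  have h1 : M.ε * (lam⁻¹ * m - h.model.K lam⁻¹) = M.ρ ^ M.p := by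
    have : lam * M.ε * (m * (-(lam ^ 2)⁻¹)) = -(M.ε * (lam⁻¹ * m)) := by
      field_simp
    rw [this] at h0
    linarith
  refine ⟨h.isFeasible_snd hplan hk ?_, ?_⟩
  · rw [hki, h1]
  · rw [eexpect_loss_eq hfin hplan hψ, ← hm, v, ← h1]
    congr 1
    field_simp
    ring

end Regular

end Data

end CausalSDRO

namespace CausalSDRO

theorem eexpect_const_bot {α : Type*} [MeasurableSpace α] (μ : Measure α) [IsProbabilityMeasure μ] :
    eexpect μ (fun _ => (⊥ : EReal)) = ⊥ := by
  simp [eexpect]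

theorem GibbsModel.K_strictConvex_of_ne {X Y : Type*} [MeasurableSpace X] [MeasurableSpace Y]
    {G : GibbsModel X Y} (hne : ¬ ∃ C : ℝ, ∀ᵐ q ∂(G.νX.prod G.νY), G.ψ q = C) {s t v w : ℝ}
    (hs : G.Good s) (ht : G.Good t) (hs0 : 0 < s) (ht0 : 0 < t) (hst : s ≠ t) (hv : 0 < v)
    (hw : 0 < w) (hvw : v + w = 1) : G.K (v * s + w * t) < v * G.K s + w * G.K t := by
  rcases hst.lt_or_gt with h | h
  · exact K_strictConvex hne hs ht hs0 h hv hw hvw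
  · have := K_strictConvex hne ht hs ht0 h hw hv (by linarith)
    rwa [add_comm, add_comm (v * G.K s)]

set_option linter.unusedSectionVars false

variable {E F G : Type*}
  [NormedAddCommGroup E] [NormedSpace ℝ E] [FiniteDimensional ℝ E]
  [MeasurableSpace E] [BorelSpace E]
  [NormedAddCommGroup F] [NormedSpace ℝ F] [FiniteDimensional ℝ F]
  [MeasurableSpace F] [BorelSpace F]
  [MeasurableSpace G]
  {𝒳 : Set E} {𝒴 : Set F} {𝒵 : Set G} {M : Data 𝒳 𝒴 𝒵} {lam : ℝ}

namespace Data

theorem Assumptions.regular (h : M.Assumptions) (hl : 0 < lam) (hb : M.dualObj lam ≠ ⊥) :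
    M.Regular := by
  have hε := h.ε_pos
  have hprob := h.prob
  have hmk := h.markov
  have hc : (0 : EReal) < ((lam * M.ε : ℝ) : EReal) := EReal.coe_pos.2 (by positivity)
  have hout : ¬ ∀ x', M.outerInt lam x' = 0 := fun h0 => hb (by
    simp only [dualObj_of_ne_zero _ hl.ne', h0, ENNReal.log_zero, EReal.mul_bot_of_pos hc,
      eexpect_const_bot, EReal.add_bot])
  refine ⟨h, fun h0 => hout fun x' => by simp [outerInt, h0], fun h0 => hout fun x' => ?_⟩
  have hg : ∀ x, M.g lam x' x = ⊥ := fun x => by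
    simp only [g, innerInt, h0, lintegral_zero_measure, ENNReal.log_zero, EReal.mul_bot_of_pos hc,
      eexpect_const_bot]
  simp only [outerInt, hg, EReal.bot_div_of_pos_ne_top hc (EReal.coe_ne_top _), EReal.exp_bot,
    lintegral_zero]

namespace Regular

variable {h : M.Regular}

theorem not_const_ψ (hne : ¬ ∃ C : ℝ, ∀ᵐ q ∂M.ν, M.loss q = (C : EReal))
    (hfin : ∀ᵐ x ∂M.νX, ∀ᵐ y ∂M.νY, M.loss (x, y) ≠ ⊤) :
    ¬ ∃ C : ℝ, ∀ᵐ q ∂(h.model.νX.prod h.model.νY), h.model.ψ q = C := by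
  have hσX := h.sigmaFinite_νX
  have hσY := h.sigmaFinite_νY
  rintro ⟨C, hC⟩
  refine hne ⟨M.ε * C, ?_⟩
  have hC : ∀ᵐ q ∂M.ν, h.model.ψ q = C := hC
  have h1 : ∀ᵐ q ∂M.ν, M.loss q ≠ ⊤ := (Measure.ae_prod_iff_ae_ae
    (measurableSet_eq_fun h.measurable_loss measurable_const).compl).2 hfin
  filter_upwards [hC, h1] with q h2 h3
  have : M.ε * h.model.ψ q = (M.loss q).toReal := mul_div_cancel₀ _ h.ε_pos.ne'
  rw [← h2, this, EReal.coe_toReal h3 (h.loss_ne_bot _)]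

theorem good_of_loss_le {S : ℝ} (hS : ∀ᵐ q ∂M.ν, M.loss q ≤ (S : EReal)) {t : ℝ} (ht : 0 ≤ t) :
    h.model.Good t ∧ h.model.K t ≤ t * (S / M.ε) + h.model.K 0 := by
  refine GibbsModel.good_of_ae_le ?_ ht
  have h1 : ∀ᵐ q ∂M.ν, h.model.ψ q ≤ S / M.ε := by
    filter_upwards [hS] with q hq
    have := EReal.toReal_le_toReal hq (h.loss_ne_bot q) (EReal.coe_ne_top S)
    rw [EReal.toReal_coe] at this
    exact div_le_div_of_nonneg_right this h.ε_pos.le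
  exact h1

theorem v_strictConvex (hne : ¬ ∃ C : ℝ, ∀ᵐ q ∂(h.model.νX.prod h.model.νY), h.model.ψ q = C)
    {x y a b : ℝ} (hx : 0 < x) (hy : 0 < y) (hGx : h.model.Good x⁻¹) (hGy : h.model.Good y⁻¹)
    (hxy : x ≠ y) (ha : 0 < a) (hb : 0 < b) (hab : a + b = 1) :
    h.v (a * x + b * y) < a * h.v x + b * h.v y := by
  have hε := h.ε_pos
  have hz : 0 < a * x + b * y := by positivity
  have h1 := GibbsModel.K_strictConvex_of_ne hne hGx hGy (inv_pos.2 hx) (inv_pos.2 hy)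
    (inv_injective.ne hxy) (v := a * x / (a * x + b * y)) (w := b * y / (a * x + b * y))
    (by positivity) (by positivity) (by field_simp)
  have h2 : a * x / (a * x + b * y) * x⁻¹ + b * y / (a * x + b * y) * y⁻¹
      = (a * x + b * y)⁻¹ := by
    field_simp
    exact hab
  rw [h2] at h1
  have h3 := mul_lt_mul_of_pos_left h1 (mul_pos hz hε)
  have h4 : (a * x + b * y) * M.ε * (a * x / (a * x + b * y) * h.model.K x⁻¹
      + b * y / (a * x + b * y) * h.model.K y⁻¹)
      = a * (x * M.ε * h.model.K x⁻¹) + b * (y * M.ε * h.model.K y⁻¹) := by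
    field_simp
  rw [h4] at h3
  simp only [v]
  linarith

theorem strictConvexOn_dualObj (h : M.Regular)
    (hne : ¬ ∃ C : ℝ, ∀ᵐ q ∂M.ν, M.loss q = (C : EReal)) :
    StrictConvexOn ℝ {lam : ℝ | 0 < lam ∧ M.dualObj lam ≠ ⊤} (fun lam => (M.dualObj lam).toReal) := by
  have key : ∀ x ∈ {lam : ℝ | 0 < lam ∧ M.dualObj lam ≠ ⊤},
      ∀ y ∈ {lam : ℝ | 0 < lam ∧ M.dualObj lam ≠ ⊤}, ∀ a b : ℝ, 0 ≤ a → 0 ≤ b → a + b = 1 →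
      0 < a * x + b * y ∧ h.model.Good (a * x + b * y)⁻¹ := by
    intro x hx y hy a b ha hb hab
    have hx0 : 0 < x := hx.1
    have hy0 : 0 < y := hy.1
    have hmin : min x y ≤ a * x + b * y := by
      calc min x y = a * min x y + b * min x y := by rw [← add_mul, hab, one_mul]
        _ ≤ _ := by gcongr <;> simp
    have hm0 : 0 < min x y := lt_min hx0 hy0
    have hGm : h.model.Good (min x y)⁻¹ := by
      rcases min_choice x y with hm | hm <;> rw [hm]
      · exact (h.good_of_dualObj_ne_top hx.1 hx.2).2
      · exact (h.good_of_dualObj_ne_top hy.1 hy.2).2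
    have hz := hm0.trans_le hmin
    exact ⟨hz, hGm.of_le (inv_pos.2 hz).le (inv_anti₀ hm0 hmin)⟩
  refine ⟨fun x hx y hy a b ha hb hab => ?_, fun x hx y hy hxy a b ha hb hab => ?_⟩
  · obtain ⟨hfin, -⟩ := h.good_of_dualObj_ne_top hx.1 hx.2
    obtain ⟨h1, h2⟩ := key x hx y hy a b ha hb hab
    refine ⟨h1, ?_⟩
    rw [smul_eq_mul, smul_eq_mul, h.dualObj_eq hfin h1 h2]
    exact EReal.coe_ne_top _
  · obtain ⟨hfin, hGx⟩ := h.good_of_dualObj_ne_top hx.1 hx.2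
    obtain ⟨-, hGy⟩ := h.good_of_dualObj_ne_top hy.1 hy.2
    obtain ⟨h1, h2⟩ := key x hx y hy a b ha.le hb.le hab
    simp only [smul_eq_mul]
    rw [h.dualObj_eq hfin h1 h2, h.dualObj_eq hfin hx.1 hGx, h.dualObj_eq hfin hy.1 hGy]
    exact v_strictConvex (not_const_ψ hne hfin) hx.1 hy.1 hGx hGy hxy ha hb hab

theorem isMinOn_of_isDualOptimal (hopt : M.IsDualOptimal lam) :
    IsMinOn (fun lam => (M.dualObj lam).toReal) {lam : ℝ | 0 < lam ∧ M.dualObj lam ≠ ⊤} lam :=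
  fun _ hy => EReal.toReal_le_toReal (hopt.2.2.2 _ hy.1.le) hopt.2.1 hy.2

theorem not_isDualOptimal_zero (h : M.Regular)
    (hne : ¬ ∃ C : ℝ, ∀ᵐ q ∂M.ν, M.loss q = (C : EReal)) (hl : 0 < lam)
    (hopt : M.IsDualOptimal lam) : ¬ M.IsDualOptimal 0 := by
  intro h0
  have hε := h.ε_pos
  obtain ⟨hfin, -⟩ := h.good_of_dualObj_ne_top hl hopt.2.2.1
  obtain ⟨S, hS⟩ : ∃ S : ℝ, M.dualObj 0 = (S : EReal) :=
    ⟨_, (EReal.coe_toReal h0.2.2.1 h0.2.1).symm⟩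
  have hloss : ∀ᵐ q ∂M.ν, M.loss q ≤ (S : EReal) := by
    rw [← hS, dualObj, if_pos rfl]
    exact ae_le_essSup
  have hG : ∀ t : ℝ, 0 ≤ t → h.model.Good t := fun t ht => (good_of_loss_le hloss ht).1
  have hd : ∀ x : ℝ, 0 < x → M.dualObj x = (h.v x : EReal) := fun x hx =>
    h.dualObj_eq hfin hx (hG _ (inv_pos.2 hx).le)
  set c := M.ρ ^ M.p + M.ε * h.model.K 0 with hc
  have hle : ∀ x : ℝ, 0 < x → h.v x ≤ S + x * c := fun x hx => by
    have h1 := mul_le_mul_of_nonneg_left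
      (good_of_loss_le (h := h) hloss (inv_pos.2 hx).le).2 (mul_pos hx hε).le
    have h2 : x * M.ε * (x⁻¹ * (S / M.ε) + h.model.K 0) = S + x * M.ε * h.model.K 0 := by
      field_simp
    rw [h2] at h1
    simp only [v, hc]
    linarith
  have hmin : ∀ x : ℝ, 0 < x → S ≤ h.v x := fun x hx => by
    have := h0.2.2.2 x hx.le
    rwa [hS, hd x hx, EReal.coe_le_coe_iff] at this
  have hlS : h.v lam = S := by
    refine le_antisymm ?_ (hmin lam hl)
    have := hopt.2.2.2 0 le_rfl
    rwa [hS, hd lam hl, EReal.coe_le_coe_iff] at this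
  have hψ := not_const_ψ (h := h) hne hfin
  have hhalf : h.v (lam / 2) ≤ S := by
    refine le_of_forall_pos_le_add fun δ hδ => ?_
    set θ := min (1 / 3) (δ / (lam * (|c| + 1))) with hθ
    have hc1 : 0 < |c| + 1 := by positivity
    have hθ0 : 0 < θ := lt_min (by norm_num) (by positivity)
    have hθ1 : θ ≤ 1 / 3 := min_le_left _ _
    have hθ2 : θ * (lam * (|c| + 1)) ≤ δ := by
      rw [← le_div_iff₀ (by positivity)]
      exact min_le_right _ _
    have h1θ : 0 < 1 - θ := by linarith
    have hθl : 0 < θ * lam := by positivity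
    have h1 := v_strictConvex hψ hθl hl (hG _ (inv_pos.2 hθl).le) (hG _ (inv_pos.2 hl).le)
      (a := 1 / (2 * (1 - θ))) (b := (1 - 2 * θ) / (2 * (1 - θ))) (by nlinarith) (by positivity)
      (div_pos (by linarith) (by positivity)) (by field_simp; ring)
    have h2 : 1 / (2 * (1 - θ)) * (θ * lam) + (1 - 2 * θ) / (2 * (1 - θ)) * lam = lam / 2 := by
      field_simp; ring
    rw [h2, hlS] at h1
    have h3 := hle (θ * lam) hθl
    have ha1 : 1 / (2 * (1 - θ)) ≤ 1 := by
      rw [div_le_one (by positivity)]; linarith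
    have ha0 : 0 < 1 / (2 * (1 - θ)) := by positivity
    have hab : (1 - 2 * θ) / (2 * (1 - θ)) = 1 - 1 / (2 * (1 - θ)) := by field_simp; ring
    rw [hab] at h1
    have h4 : θ * lam * c ≤ δ := by
      have h5 : c ≤ |c| + 1 := by linarith [le_abs_self c]
      have := mul_le_mul_of_nonneg_left h5 hθl.le
      linarith
    have h5 : 1 / (2 * (1 - θ)) * h.v (θ * lam) ≤ 1 / (2 * (1 - θ)) * (S + δ) := by gcongr; linarith
    have h6 : 1 / (2 * (1 - θ)) * δ ≤ δ := mul_le_of_le_one_left hδ.le ha1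
    linarith
  have hl2 : 0 < lam / 2 := by positivity
  have h1 := v_strictConvex hψ hl2 hl (hG _ (inv_pos.2 hl2).le) (hG _ (inv_pos.2 hl).le)
    (a := 1 / 2) (b := 1 / 2) (by linarith) (by norm_num) (by norm_num) (by norm_num)
  have h2 := hmin (1 / 2 * (lam / 2) + 1 / 2 * lam) (by positivity)
  linarith

theorem eq_of_isDualOptimal (h : M.Regular)
    (hne : ¬ ∃ C : ℝ, ∀ᵐ q ∂M.ν, M.loss q = (C : EReal)) (hl : 0 < lam)
    (hopt : M.IsDualOptimal lam) {mu : ℝ} (hmu : M.IsDualOptimal mu) : mu = lam := by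
  rcases hmu.1.eq_or_lt with rfl | hpos
  · exact absurd hmu (not_isDualOptimal_zero h hne hl hopt)
  · exact (strictConvexOn_dualObj h hne).eq_of_isMinOn (isMinOn_of_isDualOptimal hmu)
      (isMinOn_of_isDualOptimal hopt) ⟨hpos, hmu.2.2.1⟩ ⟨hl, hopt.2.2.1⟩

end Regular

end Data

end CausalSDRO

namespace CausalSDRO

set_option linter.unusedSectionVars false

variable {E F G : Type*}
  [NormedAddCommGroup E] [NormedSpace ℝ E] [FiniteDimensional ℝ E]
  [MeasurableSpace E] [BorelSpace E]
  [NormedAddCommGroup F] [NormedSpace ℝ F] [FiniteDimensional ℝ F]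
  [MeasurableSpace F] [BorelSpace F]
  [MeasurableSpace G]
  {𝒳 : Set E} {𝒴 : Set F} {𝒵 : Set G} {M : Data 𝒳 𝒴 𝒵} {lam : ℝ}

namespace Data

namespace Regular

variable {h : M.Regular}

/-- A feasible distribution whose expected loss reaches the dual value is the Gibbs mixture. -/
theorem eq_gibbs_snd (hl : 0 < lam) (hfin : ∀ᵐ x ∂M.νX, ∀ᵐ y ∂M.νY, M.loss (x, y) ≠ ⊤)
    (hG : h.model.Good lam⁻¹) {P : Measure (𝒳 × 𝒴)} (hP : M.IsFeasible P)
    (hv : (h.v lam : EReal) ≤ eexpect P M.loss) : P = (h.model.gibbs lam⁻¹).snd := by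
  have hε := h.ε_pos
  have := hP.1
  have := hG.isProbabilityMeasure_gibbs
  refine eq_of_mul_measure_le fun U hU τ hτ => le_of_forall_pos_le_add fun δ hδ => ?_
  obtain ⟨γ, f, hγ, rfl, hk, hc⟩ := h.exists_isPlan_of_isFeasible hP (mul_pos hε hδ)
  have := hγ.isProbabilityMeasure
  obtain ⟨h1, L, h2, h3⟩ := duality_gap hl hfin hG hγ hk
    (ne_bot_of_le_ne_bot (EReal.coe_ne_bot _) hv)
  rw [h2, EReal.coe_le_coe_iff] at hv
  have h4 : ∫ ω, h.model.logRatio lam⁻¹ f ω ∂γ ≤ δ := by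
    have h5 : lam * M.ε * ∫ ω, h.model.logRatio lam⁻¹ f ω ∂γ ≤ lam * M.ε * δ := by
      have := mul_le_mul_of_nonneg_left
        (show M.ε * ∫ ω, h.model.kap f ω ∂γ - M.ρ ^ M.p ≤ M.ε * δ by linarith) hl.le
      linarith
    exact le_of_mul_le_mul_left h5 (by positivity)
  have h5 := hγ.mul_measure_le hG h1 (measurable_snd hU) hτ.le
  rw [Measure.snd, Measure.snd, map_measureReal_apply measurable_snd hU,
    map_measureReal_apply measurable_snd hU]
  linarith

theorem isLocalMin_v (hopt : M.IsDualOptimal lam) {mu : ℝ} (hmu : 0 < mu)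
    (hlt : mu < lam) (hd : M.dualObj mu ≠ ⊤) : IsLocalMin h.v lam := by
  obtain ⟨hfin, hG⟩ := h.good_of_dualObj_ne_top hmu hd
  have hdual : ∀ x, mu < x → M.dualObj x = (h.v x : EReal) := fun x hx =>
    h.dualObj_eq hfin (hmu.trans hx)
      (hG.of_le (inv_pos.2 (hmu.trans hx)).le (inv_anti₀ hmu hx.le))
  filter_upwards [Ioi_mem_nhds hlt] with x hx
  have hx : mu < x := hx
  have := hopt.2.2.2 x (hmu.trans hx).le
  rwa [hdual x hx, hdual lam hlt, EReal.coe_le_coe_iff] at this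

theorem continuousAt_v (hG : ∀ t : ℝ, 0 ≤ t → h.model.Good t) (hl : 0 < lam) :
    ContinuousAt h.v lam := by
  have hl' : 0 < lam⁻¹ := inv_pos.2 hl
  have h1 : ContinuousAt h.model.K lam⁻¹ :=
    (GibbsModel.Good.hasDerivAt_K (δ := lam⁻¹ / 2) (hG _ (by linarith)) (by linarith)
      (by linarith)).continuousAt
  have h2 : ContinuousAt (fun x => h.model.K x⁻¹) lam :=
    ContinuousAt.comp (f := fun x : ℝ => x⁻¹) h1 (continuousAt_inv₀ hl.ne')
  unfold v
  fun_prop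

/-- If the dual objective is infinite to the left of the optimal solution, the dual value is
approached by Gibbs mixtures of problems with truncated loss. -/
theorem exists_isFeasible_lt (h : M.Regular)
    (hne : ¬ ∃ C : ℝ, ∀ᵐ q ∂M.ν, M.loss q = (C : EReal)) (hl : 0 < lam)
    (hopt : M.IsDualOptimal lam) (htop : ∀ x, 0 < x → x < lam → M.dualObj x = ⊤) {L : ℝ}
    (hL : (L : EReal) < M.dualObj lam) :
    ∃ Q, M.IsFeasible Q ∧ (L : EReal) < eexpect Q M.loss := by
  have hε := h.ε_pos
  have hG : ∀ n : ℕ, ∀ t : ℝ, 0 ≤ t → (h.trunc n).model.Good t := fun n t ht => h.good_trunc n ht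
  have hd : ∀ n : ℕ, ∀ x : ℝ, 0 < x → (M.trunc n).dualObj x = ((h.trunc n).v x : EReal) :=
    fun n x hx => (h.trunc n).dualObj_eq (loss_trunc_ae _) hx (hG n _ (inv_pos.2 hx).le)
  have hmono : ∀ n m : ℕ, n ≤ m → ∀ x : ℝ, 0 < x → (h.trunc n).v x ≤ (h.trunc m).v x := by
    intro n m hnm x hx
    have := dualObj_trunc_le (M := M.trunc m) hε hx n
    rwa [M.trunc_trunc (Nat.cast_le.2 hnm), hd n x hx, hd m x hx, EReal.coe_le_coe_iff] at this
  obtain ⟨V, hV⟩ : ∃ V : ℝ, M.dualObj lam = (V : EReal) :=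
    ⟨_, (EReal.coe_toReal hopt.2.2.1 hopt.2.1).symm⟩
  have hle : ∀ n : ℕ, (h.trunc n).v lam ≤ V := fun n => by
    have := dualObj_trunc_le (M := M) hε hl n
    rwa [hd n lam hl, hV, EReal.coe_le_coe_iff] at this
  have hev : ∀ {x c : ℝ}, 0 < x → (c : EReal) < M.dualObj x →
      ∀ᶠ n : ℕ in Filter.atTop, c < (h.trunc n).v x := by
    intro x c hx hc
    filter_upwards [(h.tendsto_dualObj hx).eventually_const_lt hc] with n hn
    rwa [hd n x hx, EReal.coe_lt_coe_iff] at hn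
  obtain ⟨m, hm⟩ := (hev hl hL).exists
  obtain ⟨η, hη0, hη⟩ := Metric.eventually_nhds_iff.1
    ((continuousAt_v (hG m) hl).eventually (lt_mem_nhds hm))
  set κ := min (η / 2) (lam / 2) with hκ
  have hκ0 : 0 < κ := lt_min (by linarith) (by linarith)
  have hκ1 : κ < η := (min_le_left _ _).trans_lt (by linarith)
  have hκ2 : κ < lam := (min_le_right _ _).trans_lt (by linarith)
  have hlo : 0 < lam - κ := by linarith
  have hhi : 0 < lam + κ := by linarith
  have hVlo : (V : EReal) < M.dualObj (lam - κ) := by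
    rw [htop _ hlo (by linarith)]
    exact EReal.coe_lt_top V
  have hVhi : (V : EReal) < M.dualObj (lam + κ) := by
    rw [← hV]
    refine lt_of_le_of_ne (hopt.2.2.2 _ hhi.le) fun heq => ?_
    have := h.eq_of_isDualOptimal hne hl hopt (mu := lam + κ)
      ⟨hhi.le, heq ▸ hopt.2.1, heq ▸ hopt.2.2.1, fun y hy => heq ▸ hopt.2.2.2 y hy⟩
    linarith
  obtain ⟨n, ⟨hn1, hn2⟩, hnm⟩ :=
    (((hev hlo hVlo).and (hev hhi hVhi)).and (Filter.eventually_ge_atTop m)).exists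
  have hpos : ∀ x ∈ Set.Icc (lam - κ) (lam + κ), 0 < x := fun x hx => hlo.trans_le hx.1
  obtain ⟨x, hx, hxmin⟩ := isCompact_Icc.exists_isMinOn (s := Set.Icc (lam - κ) (lam + κ))
    ⟨lam, by constructor <;> linarith⟩
    (fun x hx => (continuousAt_v (hG n) (hpos x hx)).continuousWithinAt)
  have hxV : (h.trunc n).v x ≤ V :=
    (hxmin (show lam ∈ Set.Icc (lam - κ) (lam + κ) by constructor <;> linarith)).trans (hle n)
  have hx1 : lam - κ < x := lt_of_le_of_ne hx.1 fun heq => by rw [heq] at hn1; linarith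
  have hx2 : x < lam + κ := lt_of_le_of_ne hx.2 fun heq => by rw [← heq] at hn2; linarith
  have hx0 : 0 < x := hpos x hx
  obtain ⟨hf, hval⟩ := gibbs_of_isLocalMin hx0 (loss_trunc_ae (M := M) n)
    (hG n (x⁻¹ + 1) (by positivity)) (by linarith) (hxmin.isLocalMin (Icc_mem_nhds hx1 hx2))
  refine ⟨_, hf, ?_⟩
  have h1 : L < (h.trunc m).v x := hη (by rw [Real.dist_eq, abs_lt]; constructor <;> linarith)
  calc (L : EReal) < ((h.trunc n).v x : EReal) :=
        EReal.coe_lt_coe_iff.2 (h1.trans_le (hmono m n hnm x hx0))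
    _ = _ := hval.symm
    _ ≤ _ := eexpect_mono_ae (Filter.Eventually.of_forall fun q => M.loss_trunc_le n q)

theorem isFeasible_gibbs (h : M.Regular) (hl : 0 < lam) (hopt : M.IsDualOptimal lam) {mu : ℝ}
    (hmu : 0 < mu) (hlt : mu < lam) (hd : M.dualObj mu ≠ ⊤) :
    M.IsFeasible (h.model.gibbs lam⁻¹).snd ∧
      eexpect (h.model.gibbs lam⁻¹).snd M.loss = (h.v lam : EReal) := by
  obtain ⟨hfin, hG⟩ := h.good_of_dualObj_ne_top hmu hd
  exact gibbs_of_isLocalMin hl hfin hG (inv_strictAnti₀ hmu hlt)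
    (isLocalMin_v hopt hmu hlt hd)

theorem le_eexpect_of_isWorstCase (h : M.Regular) (hl : 0 < lam) (hopt : M.IsDualOptimal lam)
    {P : Measure (𝒳 × 𝒴)} (hP : M.IsWorstCase P) : M.dualObj lam ≤ eexpect P M.loss := by
  obtain ⟨hfin, hG⟩ := h.good_of_dualObj_ne_top hl hopt.2.2.1
  by_cases hleft : ∃ mu, 0 < mu ∧ mu < lam ∧ M.dualObj mu ≠ ⊤
  · obtain ⟨mu, hmu, hlt, hd⟩ := hleft
    obtain ⟨h1, h2⟩ := h.isFeasible_gibbs hl hopt hmu hlt hd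
    rw [h.dualObj_eq hfin hl hG]
    exact h2.symm.le.trans (hP.2 _ h1)
  · push Not at hleft
    have hne : ¬ ∃ C : ℝ, ∀ᵐ q ∂M.ν, M.loss q = (C : EReal) := by
      rintro ⟨C, hC⟩
      have hl2 : 0 < lam / 2 := by linarith
      have h1 := hleft (lam / 2) hl2 (by linarith)
      rw [h.dualObj_eq hfin hl2 (good_of_loss_le (hC.mono fun q hq => hq.le)
        (inv_pos.2 hl2).le).1] at h1
      exact EReal.coe_ne_top _ h1
    by_contra hlt
    obtain ⟨L, hL1, hL2⟩ := EReal.lt_iff_exists_real_btwn.1 (not_le.1 hlt)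
    obtain ⟨Q, hQ, hLQ⟩ := h.exists_isFeasible_lt hne hl hopt hleft hL2
    exact lt_irrefl _ (hLQ.trans_le ((hP.2 Q hQ).trans hL1.le))

end Regular

end Data

end CausalSDRO
theorem theorem2 {E F G : Type*}
    [NormedAddCommGroup E] [NormedSpace ℝ E] [FiniteDimensional ℝ E]
    [MeasurableSpace E] [BorelSpace E]
    [NormedAddCommGroup F] [NormedSpace ℝ F] [FiniteDimensional ℝ F]
    [MeasurableSpace F] [BorelSpace F]
    [NormedAddCommGroup G] [NormedSpace ℝ G] [FiniteDimensional ℝ G]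
    [MeasurableSpace G] [BorelSpace G]
    {𝒳 : Set E} {𝒴 : Set F} {𝒵 : Set G}
    (M : CausalSDRO.Data 𝒳 𝒴 𝒵) (hM : M.Assumptions)
    (lamStar : ℝ) (hpos : 0 < lamStar) (hopt : M.IsDualOptimal lamStar) :
    -- if the loss is not almost everywhere constant, the dual objective is strictly convex on the
    -- part of `(0, ∞)` where it is finite, and the dual optimal solution is unique
    ((¬ ∃ C : ℝ, ∀ᵐ q ∂M.ν, M.loss q = (C : EReal)) →
      StrictConvexOn ℝ {lam : ℝ | 0 < lam ∧ M.dualObj lam ≠ ⊤} (fun lam => (M.dualObj lam).toReal) ∧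
      ∀ lam : ℝ, M.IsDualOptimal lam → lam = lamStar) ∧
    -- a worst-case distribution has the Gibbs mixture density
    (∀ P : MeasureTheory.Measure (𝒳 × 𝒴), M.IsWorstCase P →
      P = M.ν.withDensity (M.gibbsDensity lamStar)) ∧
    -- and the Gibbs mixture is indeed a worst-case distribution, provided that the dual objective
    -- is finite also somewhere to the left of `lamStar`
    ((∃ lam : ℝ, 0 < lam ∧ lam < lamStar ∧ M.dualObj lam < ⊤) →
      M.IsWorstCase (M.ν.withDensity (M.gibbsDensity lamStar))) := by
  have h := hM.regular hpos hopt.2.1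
  obtain ⟨hfin, hG⟩ := h.good_of_dualObj_ne_top hpos hopt.2.2.1
  refine ⟨fun hne => ⟨h.strictConvexOn_dualObj hne,
    fun lam hlam => h.eq_of_isDualOptimal hne hpos hopt hlam⟩, fun P hP => ?_, ?_⟩
  · rw [h.gibbs_snd_eq hfin hpos hG]
    refine CausalSDRO.Data.Regular.eq_gibbs_snd hpos hfin hG hP.1 ?_
    have := h.le_eexpect_of_isWorstCase hpos hopt hP
    rwa [h.dualObj_eq hfin hpos hG] at this
  · rintro ⟨mu, hmu, hlt, hd⟩
    rw [h.gibbs_snd_eq hfin hpos hG]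
    obtain ⟨h1, h2⟩ := h.isFeasible_gibbs hpos hopt hmu hlt hd.ne
    refine ⟨h1, fun Q hQ => ?_⟩
    rw [h2]
    exact CausalSDRO.Data.Regular.eexpect_loss_le hpos hfin hG hQ
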